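/- Work in flat spacetime $\mathbb R^4$ with signature $(-,+,+,+)$, $p\cdot x=-p^0x^0+\vec p\cdot\vec x$, and write $\sigma=(x-x')^2=(x-x')\cdot(x-x')$. Let $m>0$. For every $x'$ the Feynman propagator of the free massive scalar field is defined, as a tempered distribution in $x$, by $$G(x,x')=\lim_{\epsilon\to0^+}\frac1{(2\pi)^4}\int_{\mathbb R^4}dp\,\frac{e^{ip\cdot(x-x')}}{m^2-i\epsilon+p^2},$$ the limit being taken after smearing with a Schwartz test function (it exists). (1) Proper-time representation. One has $$G(x,x')=\frac1{(4\pi)^2}\int_0^\infty\frac{ds}{s^2}\,e^{-i\left(m^2s-\frac{(x-x')^2}{4s}\right)}$$ in the sense of distributions: after smearing in $x$ with a Schwartz function $\varphi$ the integral over $s$ converges absolutely and equals $G(\cdot,x')(\varphi)$. Moreover $$K(M,\sigma)=\frac1{(4\pi)^2}\int_0^\infty\frac{ds}{s^2}\,e^{-i\left(Ms-\frac{\sigma}{4s}\right)}$$ converges absolutely and is analytic for $\operatorname{Im}M<0$, $\operatorname{Im}\sigma>0$, and $G$ is its boundary value: $G(\cdot,x')(\varphi)=\lim_{\epsilon,\delta\to0^+}\int\varphi(x)\,K\big(m^2-i\epsilon,(x-x')^2+i\delta\big)\,dx$.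 (2) Hankel function. Let $H^{(2)}_1=J_1-iY_1$ (principal branch). Off the light cone $G$ is the function $$G(x,x')=-\frac{m^2}{8\pi}\,\frac{H_1^{(2)}(z)}{z},\qquad z^2=-m^2(x-x')^2,$$ where $z=m\sqrt{-(x-x')^2}>0$ for timelike separation, $(x-x')^2<0$, and where, by continuation through the lower half $z^2$-plane, $z=-im\sqrt{(x-x')^2}$ for spacelike separation, $(x-x')^2>0$. This holds for the distribution $G(\cdot,x')$ on smooth test functions with compact support in the timelike, respectively the spacelike, region, and for the pointwise limits $\lim_{\epsilon,\delta\to0^+}K(m^2-i\epsilon,\sigma+i\delta)$, $\sigma\in\mathbb R\setminus\{0\}$. (3) Singular structure. Put $c_k=\dfrac1{2^{2k+1}k!(k+1)!}$, so that $c_0=\tfrac12$, $c_1=\tfrac1{2^24}$, $c_2=\tfrac1{2^24^26}$, and $h_k=\sum_{j=1}^k\tfrac1j+\tfrac1{2(k+1)}$, so that $h_0=\tfrac12$, $h_1=1+\tfrac14$, $h_2=1+\tfrac12+\tfrac16$. Let $\bar G=\operatorname{Re}G$ and $G^{(1)}=2\operatorname{Im}G$ (on real test functions), let $\theta$ be the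 step function, and let $\delta((x-x')^2)$ be given by $\delta(t^2-a^2)=\frac1{2a}[\delta(t-a)+\delta(t+a)]$ with $t=x^0-x'^0$, $a=|\vec x-\vec x'|$. Then, as distributions, with power series converging for all values of $\sigma$, $$\bar G(x,x')=\frac1{4\pi}\,\delta\big((x-x')^2\big)-\frac{m^2}{8\pi}\,\theta\big(-(x-x')^2\big)\sum_{k\ge0}c_k\,(m^2\sigma)^k ,$$ $$G^{(1)}(x,x')=\frac{m^2}{2\pi^2}\Big\{\frac1{m^2\sigma}+\big[\gamma-\log2+\log m+\tfrac12\log|\sigma|\big]\sum_{k\ge0}c_k(m^2\sigma)^k-\sum_{k\ge0}c_kh_k(m^2\sigma)^k\Big\},$$ where $\sigma=(x-x')^2$, $\gamma$ is the Euler–Mascheroni constant, and the second formula is a principal value at the light cone: its value on $\varphi$ is the limit as $\eta\to0^+$ of the integrals over $\{|\sigma|>\eta\}$. -/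

import Mathlib

open MeasureTheory Filter Topology
open scoped SchwartzMap

noncomputable section

/-- Flat four-dimensional spacetime, with coordinates `x 0` (time) and `x 1, x 2, x 3` (space) and
Lebesgue measure; the same type is used for momenta. -/
abbrev Spacetime : Type := EuclideanSpace ℝ (Fin 4)

/-- The Minkowski product `p · x = η_{μν} p^μ x^ν` of signature `(-,+,+,+)`. -/
def minkowski (p x : Spacetime) : ℝ :=
  -(p 0 * x 0) + p 1 * x 1 + p 2 * x 2 + p 3 * x 3

/-- The squared interval `(x - x')²`: negative for timelike, positive for spacelike separation. -/
def interval (x x' : Spacetime) : ℝ :=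
  minkowski (x - x') (x - x')

/-- The integrand, in the momentum `p`, of
`∫ dp e^{i p (x - x')} / (m² - iε + p²)` after smearing in `x` with the test function `φ`. -/
def feynmanIntegrand (m ε : ℝ) (x' : Spacetime) (φ : 𝓢(Spacetime, ℂ)) (p : Spacetime) : ℂ :=
  (∫ x : Spacetime, Complex.exp (Complex.I * (minkowski p (x - x') : ℂ)) * φ x) /
    ((m : ℂ) ^ 2 - Complex.I * (ε : ℂ) + (minkowski p p : ℂ))

/-- The tempered distribution `T` is the Feynman propagator `G(·, x')` of mass `m`:
`G(x, x') = lim_{ε → 0+} (2π)⁻⁴ ∫ dp e^{i p (x - x')} / (m² - iε + p²)`,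
the limit being taken after all integrations (convergence in the sense of distributions). -/
def IsFeynmanPropagator (m : ℝ) (x' : Spacetime) (T : 𝓢'(Spacetime, ℂ)) : Prop :=
  ∀ φ : 𝓢(Spacetime, ℂ),
    (∀ ε : ℝ, 0 < ε → Integrable (feynmanIntegrand m ε x' φ)) ∧
    Tendsto (fun ε : ℝ => 1 / (2 * (Real.pi : ℂ)) ^ 4 * ∫ p : Spacetime, feynmanIntegrand m ε x' φ p)
      (𝓝[>] 0) (𝓝 (T φ))

/-- The proper-time integrand `s⁻² e^{-i (M s - σ / (4 s))}`, for a complex squared mass `M` and a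
complex squared interval `σ`. -/
def schwingerIntegrand (M σ : ℂ) (s : ℝ) : ℂ :=
  1 / (s : ℂ) ^ 2 * Complex.exp (-Complex.I * (M * (s : ℂ) - σ / (4 * (s : ℂ))))

/-- The proper-time integral `(4π)⁻² ∫_0^∞ s⁻² e^{-i (M s - σ / (4 s))} ds`. -/
def schwingerKernel (M σ : ℂ) : ℂ :=
  1 / (4 * (Real.pi : ℂ)) ^ 2 * ∫ s in Set.Ioi (0 : ℝ), schwingerIntegrand M σ s

/-- The Bessel function `J_n` of the first kind, of integer order `n ≥ 0`. -/
def besselJ (n : ℕ) (z : ℂ) : ℂ :=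
  ∑' k : ℕ, (-1) ^ k / ((k.factorial : ℂ) * ((k + n).factorial : ℂ)) * (z / 2) ^ (2 * k + n)

/-- The Bessel function `Y_1` of the second kind (principal branch),
`Y_1(z) = (2/π) [-J_0(z)/z + (γ + log (z/2)) J_1(z) - z/2 + (z³/(2²4)) (1 + 1/2) - ...]`. -/
def besselY1 (z : ℂ) : ℂ :=
  2 / (Real.pi : ℂ) *
    (-(besselJ 0 z / z) + ((Real.eulerMascheroniConstant : ℂ) + Complex.log (z / 2)) * besselJ 1 z
      - ∑' k : ℕ, (-1) ^ k * (harmonic (k + 1) : ℂ) / ((k.factorial : ℂ) * ((k + 1).factorial : ℂ)) *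
          (z / 2) ^ (2 * k + 1))

/-- The Hankel function of the second kind of order one, `H_1^{(2)} = J_1 - i Y_1`. -/
def hankelH2 (z : ℂ) : ℂ :=
  besselJ 1 z - Complex.I * besselY1 z

/-- `-(m²/8π) H_1^{(2)}(z) / z`. -/
def hankelForm (m : ℝ) (z : ℂ) : ℂ :=
  -((m : ℂ) ^ 2 / (8 * (Real.pi : ℂ))) * (hankelH2 z / z)

/-- A real test function regarded as a complex one. -/
def complexify (φ : 𝓢(Spacetime, ℝ)) : 𝓢(Spacetime, ℂ) :=
  SchwartzMap.postcompCLM Complex.ofRealCLM φ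

/-- The distribution `Ḡ = Re G`, through its values on real test functions. -/
def barG (T : 𝓢'(Spacetime, ℂ)) (φ : 𝓢(Spacetime, ℝ)) : ℝ :=
  (T (complexify φ)).re

/-- Hadamard's elementary function `G^{(1)} = 2 Im G`, through its values on real test functions. -/
def hadamardG (T : 𝓢'(Spacetime, ℂ)) (φ : 𝓢(Spacetime, ℝ)) : ℝ :=
  2 * (T (complexify φ)).im

/-- The integrand over `ξ ∈ ℝ³` of the distribution `δ((x - x')²)`, obtained from
`δ(t² - a²) = (δ(t - a) + δ(t + a)) / (2a)` with `a = ‖ξ‖`. -/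
def lightConeIntegrand (x' : Spacetime) (φ : 𝓢(Spacetime, ℝ)) (ξ : EuclideanSpace ℝ (Fin 3)) : ℝ :=
  (φ (x' + !₂[‖ξ‖, ξ 0, ξ 1, ξ 2]) + φ (x' + !₂[-‖ξ‖, ξ 0, ξ 1, ξ 2])) / (2 * ‖ξ‖)

/-- The distribution `δ((x - x')²)` on the light cone of `x'`. -/
def lightConeDelta (x' : Spacetime) (φ : 𝓢(Spacetime, ℝ)) : ℝ :=
  ∫ ξ : EuclideanSpace ℝ (Fin 3), lightConeIntegrand x' φ ξ

/-- The coefficients `1/2, 1/(2² 4), 1/(2² 4² 6), ...`. -/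
def coneCoeff (k : ℕ) : ℝ :=
  1 / (2 ^ (2 * k + 1) * (k.factorial : ℝ) * ((k + 1).factorial : ℝ))

/-- The coefficients `(1/2)(1/2), (1/(2² 4))(1 + 1/4), (1/(2² 4² 6))(1 + 1/2 + 1/6), ...`. -/
def coneCoeff' (k : ℕ) : ℝ :=
  coneCoeff k * ((harmonic k : ℝ) + 1 / (2 * ((k : ℝ) + 1)))

/-- The sum `1/2 + t/(2² 4) + t²/(2² 4² 6) + ...`. -/
def coneSeries (t : ℝ) : ℝ :=
  ∑' k : ℕ, coneCoeff k * t ^ k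

/-- The sum `1/4 + (t/(2² 4))(1 + 1/4) + (t²/(2² 4² 6))(1 + 1/2 + 1/6) + ...`. -/
def coneSeries' (t : ℝ) : ℝ :=
  ∑' k : ℕ, coneCoeff' k * t ^ k

/-- The light-cone expansion of `G^{(1)}` as a function of the squared interval `σ ≠ 0`. -/
def hadamardExpansion (m σ : ℝ) : ℝ :=
  m ^ 2 / (2 * Real.pi ^ 2) *
    (1 / (m ^ 2 * σ)
      + (Real.eulerMascheroniConstant - Real.log 2 + Real.log m + Real.log |σ| / 2)
          * coneSeries (m ^ 2 * σ)
      - coneSeries' (m ^ 2 * σ))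

end

/-! The proof rests on the Schwinger identity `1/(D - iε) = i ∫_0^∞ e^{-i s D - ε s} ds` with `D =
m² + p²`. Smeared with a test function, the momentum integral becomes an oscillating Gaussian equal
to `-iπ² s⁻² e^{iσ/(4s)}` (`integral_exp_mul_waveTransform`), and `i · (-iπ²) / (2π)⁴ = 1 / (4π)²`
is the constant of the proper-time formula. The smeared amplitude is `O(s⁻²)` in position space and
`O(1)` in momentum space, hence at most `C / (1 + s²)` (`norm_properTimeAmplitude_le`). This single
bound makes the propagator a tempered distribution and gives every limit in `ε` and `δ` by dominated
convergence.

For the pointwise kernel put `A = iM`, `B = -iσ`. Then `∫ s⁻² e^{-As - B/(4s)} ds = 4/B + R(A, B)`,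
with `R` explicit in logarithms and two entire series (`besselIntegral_two_eq`). For `A = 1` and `B
= y > 0` this is an ODE argument: `P(y) = ∫ e^{-s - y/(4s)} ds` and the candidate series both solve
`y f'' = f / 4`. They agree because their difference and its derivative vanish at the singular point
`y = 0`, where the constant `γ - log 2` enters through `Γ'(1) = -γ`. Scaling and the identity
theorem extend the formula to `Re A, Re B > 0`. Its logarithms are analytic across the nonzero
imaginary axis, so the boundary values off the cone are read off and compared with the series of
`H_1^{(2)}`.

At the light cone take `ε = δ = η`. The term `4/(η - iσ)` has a Poisson kernel as real part, which
produces the delta function, and a smoothed `4/σ` as imaginary part, which produces the principal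
value. The remainder is at most logarithmic in `σ`, uniformly in `η` (`norm_besselRemainder_le`), so
it passes to the limit by dominated convergence. All of this is integrated in coordinates in which
the interval `u` is itself a coordinate, with Lebesgue density `√(t² + u) / 2`. A test function
times this density is continuous and bounded by `C / (1 + t²)`, so functions of the interval are
tested as functions of one variable (`tendsto_integral_mul_comp_interval_div`). The step function in
`Re G` comes from the phases of `log (im²)` and `log (-iσ)`, which add up for `σ < 0` and cancel for
`σ > 0`. -/

noncomputable section

/-! ### Entire power series -/

/-- The coefficients of an everywhere convergent power series. -/
def EntireCoeff (a : ℕ → ℂ) : Prop :=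
  ∀ r : ℝ, Summable fun k => ‖a k‖ * r ^ k

/-- The sum of a power series. -/
def powerSum (a : ℕ → ℂ) (z : ℂ) : ℂ := ∑' k, a k * z ^ k

/-- The coefficients of the derived power series. -/
def derivCoeff (a : ℕ → ℂ) (k : ℕ) : ℂ := (k + 1) * a (k + 1)

theorem EntireCoeff.summable {a : ℕ → ℂ} (ha : EntireCoeff a) (z : ℂ) :
    Summable fun k => a k * z ^ k := by
  refine Summable.of_norm ?_
  simpa [norm_mul, norm_pow] using ha ‖z‖

theorem EntireCoeff.of_norm_le {a : ℕ → ℂ} (ha : ∀ k, ‖a k‖ ≤ 1 / (k.factorial : ℝ)) :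
    EntireCoeff a := by
  intro r
  refine Summable.of_norm_bounded (g := fun k => |r| ^ k / k.factorial)
    (Real.summable_pow_div_factorial |r|) fun k => ?_
  rw [norm_mul, norm_norm, norm_pow, Real.norm_eq_abs, div_eq_inv_mul, ← one_div]
  gcongr
  exact ha k

theorem EntireCoeff.tail {a : ℕ → ℂ} (ha : EntireCoeff a) : EntireCoeff fun k => a (k + 1) := by
  intro r
  have h := (summable_nat_add_iff 1).2 (ha (|r| + 1))
  refine Summable.of_norm_bounded h fun k => ?_
  rw [norm_mul, norm_norm, norm_pow, Real.norm_eq_abs]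
  have h1 : |r| ^ k ≤ (|r| + 1) ^ (k + 1) := by
    calc |r| ^ k ≤ (|r| + 1) ^ k := by gcongr; linarith
      _ ≤ (|r| + 1) ^ (k + 1) := pow_le_pow_right₀ (by linarith [abs_nonneg r]) (Nat.le_succ k)
  gcongr

/-- The factor `k ≤ 2 ^ k` is absorbed by doubling the radius. -/
theorem EntireCoeff.natCast_mul {a : ℕ → ℂ} (ha : EntireCoeff a) :
    EntireCoeff fun k => (k : ℂ) * a k := by
  intro r
  have h := ha (2 * |r|)
  refine Summable.of_norm_bounded h fun k => ?_
  rw [norm_mul, norm_norm, norm_pow, Real.norm_eq_abs, norm_mul, mul_pow]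
  have h1 : ‖(k : ℂ)‖ ≤ 2 ^ k := by
    rw [Complex.norm_natCast]
    exact_mod_cast (Nat.lt_two_pow_self (n := k)).le
  calc ‖(k : ℂ)‖ * ‖a k‖ * |r| ^ k ≤ 2 ^ k * ‖a k‖ * |r| ^ k := by gcongr
    _ = _ := by ring

theorem EntireCoeff.derivCoeff {a : ℕ → ℂ} (ha : EntireCoeff a) : EntireCoeff (derivCoeff a) := by
  have := ha.natCast_mul.tail
  push_cast at this
  exact this

theorem EntireCoeff.add {a b : ℕ → ℂ} (ha : EntireCoeff a) (hb : EntireCoeff b) :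
    EntireCoeff fun k => a k + b k := by
  intro r
  refine Summable.of_norm_bounded ((ha |r|).add (hb |r|)) fun k => ?_
  rw [norm_mul, norm_norm, norm_pow, Real.norm_eq_abs, ← add_mul]
  gcongr
  exact norm_add_le _ _

theorem EntireCoeff.const_mul {a : ℕ → ℂ} (ha : EntireCoeff a) (c : ℂ) :
    EntireCoeff fun k => c * a k := by
  intro r
  simpa [norm_mul, mul_assoc] using (ha r).mul_left ‖c‖

theorem powerSum_add {a b : ℕ → ℂ} (ha : EntireCoeff a) (hb : EntireCoeff b) (z : ℂ) :
    powerSum (fun k => a k + b k) z = powerSum a z + powerSum b z := by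
  simp only [powerSum, add_mul]
  exact (ha.summable z).tsum_add (hb.summable z)

theorem powerSum_const_mul (a : ℕ → ℂ) (c z : ℂ) :
    powerSum (fun k => c * a k) z = c * powerSum a z := by
  simp only [powerSum, mul_assoc, tsum_mul_left]

theorem powerSum_eq_zero_add {a : ℕ → ℂ} (ha : EntireCoeff a) (z : ℂ) :
    powerSum a z = a 0 + z * powerSum (fun k => a (k + 1)) z := by
  rw [powerSum, (ha.summable z).tsum_eq_zero_add, powerSum, ← tsum_mul_left]
  simp only [pow_zero, mul_one]
  congr 2
  ext k
  ring

theorem mul_powerSum_derivCoeff {a : ℕ → ℂ} (ha : EntireCoeff a) (z : ℂ) :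
    z * powerSum (derivCoeff a) z = powerSum (fun k => (k : ℂ) * a k) z := by
  rw [powerSum_eq_zero_add ha.natCast_mul]
  simp only [CharP.cast_eq_zero, zero_mul, zero_add]
  push_cast
  rfl

theorem powerSum_zero (a : ℕ → ℂ) : powerSum a 0 = a 0 := by
  rw [powerSum, tsum_eq_single 0]
  · simp
  · intro k hk
    simp [hk]

theorem hasDerivAt_powerSum {a : ℕ → ℂ} (ha : EntireCoeff a) (z : ℂ) :
    HasDerivAt (powerSum a) (powerSum (derivCoeff a) z) z := by
  set r : ℝ := ‖z‖ + 1
  have hz : z ∈ Metric.ball (0 : ℂ) r := by simp [r]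
  have hu : Summable fun k : ℕ => ‖(k : ℂ) * a k‖ * r ^ (k - 1) := by
    rw [← summable_nat_add_iff 1]
    simpa using ha.natCast_mul.tail r
  have h := hasDerivAt_tsum_of_isPreconnected (g := fun k z => a k * z ^ k)
    (g' := fun k z => a k * ((k : ℂ) * z ^ (k - 1))) hu Metric.isOpen_ball
    (convex_ball (0 : ℂ) r).isPreconnected (fun k y _ => (hasDerivAt_pow k y).const_mul (a k))
    (fun k y hy => ?_) hz (ha.summable z) hz
  · refine h.congr_deriv ?_
    have hs : Summable fun k : ℕ => a k * ((k : ℂ) * z ^ (k - 1)) := by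
      rw [← summable_nat_add_iff 1]
      refine (ha.derivCoeff.summable z).congr fun k => ?_
      simp [derivCoeff]
      ring
    rw [hs.tsum_eq_zero_add, powerSum]
    simp only [CharP.cast_eq_zero, zero_mul, mul_zero, zero_add, Nat.add_sub_cancel]
    refine tsum_congr fun k => ?_
    simp [derivCoeff]
    ring
  · rw [mem_ball_zero_iff] at hy
    rw [← mul_assoc, mul_comm (a k), norm_mul, norm_pow]
    gcongr

theorem continuous_powerSum {a : ℕ → ℂ} (ha : EntireCoeff a) : Continuous (powerSum a) :=
  continuous_iff_continuousAt.2 fun z => (hasDerivAt_powerSum ha z).continuousAt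

theorem differentiable_powerSum {a : ℕ → ℂ} (ha : EntireCoeff a) : Differentiable ℂ (powerSum a) :=
  fun z => (hasDerivAt_powerSum ha z).differentiableAt

/-! ### The light-cone series -/

/-- The entire function `∑ c_k z^k`, equal to `I_1(√z) / √z`. -/
def coneSum : ℂ → ℂ := powerSum fun k => (coneCoeff k : ℂ)

/-- The entire function `∑ c_k h_k z^k`. -/
def coneSum' : ℂ → ℂ := powerSum fun k => (coneCoeff' k : ℂ)

theorem coneCoeff_pos (k : ℕ) : 0 < coneCoeff k := by
  unfold coneCoeff; positivity

theorem coneCoeff_zero : coneCoeff 0 = 1 / 2 := by norm_num [coneCoeff]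

theorem coneCoeff'_zero : coneCoeff' 0 = 1 / 4 := by norm_num [coneCoeff', coneCoeff_zero]

theorem harmonic_le_self (k : ℕ) : (harmonic k : ℝ) ≤ k := by
  induction k with
  | zero => simp
  | succ k ih =>
    rw [harmonic_succ]
    push_cast
    have : ((k : ℝ) + 1)⁻¹ ≤ 1 := inv_le_one_of_one_le₀ (by linarith [(Nat.cast_nonneg k : (0:ℝ) ≤ k)])
    linarith

theorem harmonic_nonneg_real (k : ℕ) : (0 : ℝ) ≤ (harmonic k : ℝ) := by
  have : 0 ≤ harmonic k := by
    rw [harmonic]; exact Finset.sum_nonneg fun i _ => by positivity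
  exact_mod_cast this

/-- The spare factor `k + 1` absorbs the bracket `h_k ≤ k + 1` of `coneCoeff'`, so that one estimate
dominates both light-cone series by the exponential series. -/
theorem coneCoeff_mul_le (k : ℕ) : coneCoeff k * (k + 1) ≤ 1 / (k.factorial : ℝ) := by
  rw [coneCoeff, Nat.factorial_succ]
  have hf : (1 : ℝ) ≤ k.factorial := by exact_mod_cast Nat.succ_le_of_lt (Nat.factorial_pos k)
  have h2 : (1 : ℝ) ≤ 2 ^ (2 * k + 1) := one_le_pow₀ (by norm_num)
  push_cast
  rw [div_mul_eq_mul_div, one_mul, div_le_div_iff₀ (by positivity) (by positivity)]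
  have : (1 : ℝ) ≤ 2 ^ (2 * k + 1) * k.factorial := one_le_mul_of_one_le_of_one_le h2 hf
  calc ((k : ℝ) + 1) * k.factorial = 1 * (k.factorial * ((k + 1))) := by ring
    _ ≤ (2 ^ (2 * k + 1) * k.factorial) * (k.factorial * ((k + 1))) := by gcongr
    _ = _ := by ring

theorem entireCoeff_coneCoeff : EntireCoeff fun k => (coneCoeff k : ℂ) := by
  refine EntireCoeff.of_norm_le fun k => ?_
  rw [Complex.norm_real, Real.norm_of_nonneg (coneCoeff_pos k).le]
  refine le_trans ?_ (coneCoeff_mul_le k)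
  exact le_mul_of_one_le_right (coneCoeff_pos k).le (by linarith [(Nat.cast_nonneg k : (0:ℝ) ≤ k)])

theorem entireCoeff_coneCoeff' : EntireCoeff fun k => (coneCoeff' k : ℂ) := by
  refine EntireCoeff.of_norm_le fun k => ?_
  have hk : (0 : ℝ) ≤ k := Nat.cast_nonneg k
  have h0 := harmonic_nonneg_real k
  have h1 : 1 / (2 * ((k : ℝ) + 1)) ≤ 1 := by
    rw [div_le_one (by positivity)]; linarith
  have h2 : 0 ≤ 1 / (2 * ((k : ℝ) + 1)) := by positivity
  rw [Complex.norm_real, coneCoeff', Real.norm_of_nonneg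
    (mul_nonneg (coneCoeff_pos k).le (by linarith))]
  refine le_trans ?_ (coneCoeff_mul_le k)
  exact mul_le_mul_of_nonneg_left (by linarith [harmonic_le_self k]) (coneCoeff_pos k).le

theorem EntireCoeff.summable_ofReal {a : ℕ → ℝ} (ha : EntireCoeff fun k => (a k : ℂ)) (t : ℝ) :
    Summable fun k => a k * t ^ k := by
  have := ha.summable (t : ℂ)
  exact_mod_cast this

theorem coneSum_ofReal (t : ℝ) : coneSum t = (coneSeries t : ℂ) := by
  rw [coneSum, powerSum, coneSeries, Complex.ofReal_tsum]
  simp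

theorem coneSum'_ofReal (t : ℝ) : coneSum' t = (coneSeries' t : ℂ) := by
  rw [coneSum', powerSum, coneSeries', Complex.ofReal_tsum]
  simp

theorem coneCoeff_succ (k : ℕ) : ((k : ℝ) + 1) * (k + 2) * coneCoeff (k + 1) = coneCoeff k / 4 := by
  rw [coneCoeff, coneCoeff, Nat.factorial_succ (k + 1), Nat.factorial_succ k]
  push_cast
  have hf : (k.factorial : ℝ) ≠ 0 := by positivity
  field_simp
  ring

/-- The increment `h_{k+1} - h_k = (k + 3/2) / ((k + 1)(k + 2))` turns the recursion for `c_k` into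
this one and produces its inhomogeneous term. -/
theorem coneCoeff'_succ (k : ℕ) :
    ((k : ℝ) + 1) * (k + 2) * coneCoeff' (k + 1) =
      ((k : ℝ) + 3 / 2) * coneCoeff (k + 1) + coneCoeff' k / 4 := by
  have h := coneCoeff_succ k
  have h4 : coneCoeff k = 4 * (((k : ℝ) + 1) * (k + 2) * coneCoeff (k + 1)) := by linarith
  rw [coneCoeff', coneCoeff', h4, harmonic_succ]
  push_cast
  field_simp
  ring

/-- This is `coneCoeff_succ` read coefficientwise. It says that `f = z S` solves `z f'' = f / 4`,
the equation of `√z I_1(√z)`; `S` denotes `coneSum`. -/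
theorem coneSum_ode (z : ℂ) :
    2 * powerSum (derivCoeff fun k => (coneCoeff k : ℂ)) z +
      z * powerSum (derivCoeff (derivCoeff fun k => (coneCoeff k : ℂ))) z = coneSum z / 4 := by
  have hc := entireCoeff_coneCoeff
  rw [mul_powerSum_derivCoeff hc.derivCoeff, ← powerSum_const_mul,
    ← powerSum_add (hc.derivCoeff.const_mul 2) hc.derivCoeff.natCast_mul, coneSum,
    div_eq_inv_mul, ← powerSum_const_mul]
  congr 1
  ext k
  have h := coneCoeff_succ k
  have h' : ((k : ℂ) + 1) * (k + 2) * coneCoeff (k + 1) = coneCoeff k / 4 := by exact_mod_cast h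
  simp only [derivCoeff]
  linear_combination h'

/-- This is what remains of `z f'' = f / 4` for `f = 1 + (½ log z + c) z S - z T`, with `T` denoting
`coneSum'`, once the terms carrying the logarithm have cancelled by `coneSum_ode`. -/
theorem coneSum'_ode (z : ℂ) :
    coneSum z / 2 + z * powerSum (derivCoeff fun k => (coneCoeff k : ℂ)) z + z * coneSum' z / 4 =
      1 / 4 + z * (2 * powerSum (derivCoeff fun k => (coneCoeff' k : ℂ)) z +
        z * powerSum (derivCoeff (derivCoeff fun k => (coneCoeff' k : ℂ))) z) := by
  have hc := entireCoeff_coneCoeff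
  have hd := entireCoeff_coneCoeff'
  have e1 := powerSum_eq_zero_add hc z
  rw [mul_powerSum_derivCoeff hd.derivCoeff, ← powerSum_const_mul _ 2,
    ← powerSum_add (hd.derivCoeff.const_mul 2) hd.derivCoeff.natCast_mul]
  have e2 : coneSum' z = powerSum (fun k => 4 * ((((k : ℂ) + 1) * (k + 2)) * coneCoeff' (k + 1)
      + (-1) * (((k : ℂ) + 3 / 2) * coneCoeff (k + 1)))) z := by
    rw [coneSum']
    congr 1
    ext k
    have h := coneCoeff'_succ k
    have h' : ((k : ℂ) + 1) * (k + 2) * coneCoeff' (k + 1) =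
      ((k : ℂ) + 3 / 2) * coneCoeff (k + 1) + coneCoeff' k / 4 := by
      have := congrArg (fun x : ℝ => (x : ℂ)) h
      push_cast at this
      exact this
    linear_combination -4 * h'
  have e3 : EntireCoeff fun k => (((k : ℂ) + 1) * (k + 2)) * (coneCoeff' (k + 1) : ℂ) := by
    have := (hd.derivCoeff.const_mul 2).add hd.derivCoeff.natCast_mul
    convert this using 2 with k
    simp [derivCoeff]; ring
  have e4 : EntireCoeff fun k => ((k : ℂ) + 3 / 2) * (coneCoeff (k + 1) : ℂ) := by
    have := hc.derivCoeff.add (hc.tail.const_mul (1 / 2))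
    convert this using 2 with k
    simp [derivCoeff]; ring
  have e5 : powerSum (fun k => ((k : ℂ) + 3 / 2) * (coneCoeff (k + 1) : ℂ)) z =
      powerSum (derivCoeff fun k => (coneCoeff k : ℂ)) z +
        1 / 2 * powerSum (fun k => (coneCoeff (k + 1) : ℂ)) z := by
    rw [← powerSum_const_mul, ← powerSum_add hc.derivCoeff (hc.tail.const_mul (1 / 2))]
    congr 1
    ext k
    simp [derivCoeff]; ring
  have e6 : powerSum (fun k => 2 * derivCoeff (fun k => (coneCoeff' k : ℂ)) k +
      (k : ℂ) * derivCoeff (fun k => (coneCoeff' k : ℂ)) k) z =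
      powerSum (fun k => (((k : ℂ) + 1) * (k + 2)) * (coneCoeff' (k + 1) : ℂ)) z := by
    congr 1
    ext k
    simp [derivCoeff]; ring
  rw [e6, e2, powerSum_const_mul, powerSum_add e3 (e4.const_mul (-1)), powerSum_const_mul, e5, coneSum,
    e1]
  rw [coneCoeff_zero]
  push_cast
  ring

end

noncomputable section

/-! ### Bessel integrals -/

/-- The integrand `s^{-k} e^{-A s - B / (4 s)}`. -/
def besselIntegrand (k : ℕ) (A B : ℂ) (s : ℝ) : ℂ :=
  ((s : ℂ)⁻¹) ^ k * Complex.exp (-(A * s + B / (4 * s)))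

/-- The integral `∫_0^∞ s^{-k} e^{-A s - B / (4 s)} ds`. -/
def besselIntegral (k : ℕ) (A B : ℂ) : ℂ :=
  ∫ s in Set.Ioi (0 : ℝ), besselIntegrand k A B s

theorem norm_besselIntegrand (k : ℕ) (A B : ℂ) {s : ℝ} (hs : 0 < s) :
    ‖besselIntegrand k A B s‖ = (s⁻¹) ^ k * Real.exp (-(A.re * s + B.re / (4 * s))) := by
  rw [besselIntegrand, norm_mul, norm_pow, norm_inv, Complex.norm_real, Real.norm_of_nonneg hs.le,
    Complex.norm_exp]
  have : B / (4 * (s : ℂ)) = B * (((4 * s)⁻¹ : ℝ) : ℂ) := by push_cast; rw [div_eq_mul_inv]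
  rw [this]
  simp only [Complex.neg_re, Complex.add_re, Complex.re_mul_ofReal]
  rw [div_eq_mul_inv]

theorem continuousOn_besselIntegrand (k : ℕ) (A B : ℂ) :
    ContinuousOn (besselIntegrand k A B) (Set.Ioi 0) := by
  unfold besselIntegrand
  have h : ∀ s ∈ Set.Ioi (0 : ℝ), (s : ℂ) ≠ 0 := fun s hs => by
    exact_mod_cast (Set.mem_Ioi.1 hs).ne'
  have h4 : ∀ s ∈ Set.Ioi (0 : ℝ), 4 * (s : ℂ) ≠ 0 := fun s hs => mul_ne_zero (by norm_num) (h s hs)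
  have hc : ContinuousOn (fun s : ℝ => (s : ℂ)) (Set.Ioi 0) :=
    Complex.continuous_ofReal.continuousOn
  exact ((hc.inv₀ h).pow k).mul (Complex.continuous_exp.comp_continuousOn
    ((continuousOn_const.mul hc).add (continuousOn_const.div (continuousOn_const.mul hc) h4)).neg)

/-- This is `x ^ k / k! ≤ e ^ x` at `x = b / (4 s)`: the exponential removes every power singularity
at `s = 0`. -/
theorem inv_pow_mul_exp_le (k : ℕ) {b s : ℝ} (hb : 0 < b) (hs : 0 < s) :
    (s⁻¹) ^ k * Real.exp (-(b / (4 * s))) ≤ k.factorial * (4 / b) ^ k := by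
  have h := Real.pow_div_factorial_le_exp (b / (4 * s)) (by positivity) k
  rw [Real.exp_neg, ← div_eq_mul_inv, div_le_iff₀ (Real.exp_pos _)]
  rw [div_le_iff₀ (by positivity)] at h
  calc (s⁻¹) ^ k = (4 / b) ^ k * (b / (4 * s)) ^ k := by
        rw [← mul_pow]; congr 1; field_simp
    _ ≤ (4 / b) ^ k * (Real.exp (b / (4 * s)) * k.factorial) := by gcongr
    _ = _ := by ring

theorem integrableOn_inv_pow_mul_exp (k : ℕ) {a b : ℝ} (ha : 0 < a) (hb : 0 < b) :
    IntegrableOn (fun s : ℝ => (s⁻¹) ^ k * Real.exp (-(a * s + b / (4 * s)))) (Set.Ioi 0) := by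
  have h0 : IntegrableOn (fun s : ℝ => k.factorial * (4 / b) ^ k * Real.exp (-a * s))
      (Set.Ioi 0) := (integrableOn_exp_mul_Ioi (by linarith) 0).const_mul _
  refine Integrable.mono' h0 ?_ ?_
  · refine Measurable.aestronglyMeasurable ?_
    fun_prop
  · refine (ae_restrict_mem measurableSet_Ioi).mono fun s hs => ?_
    have hs : 0 < s := hs
    rw [Real.norm_of_nonneg (by positivity), neg_add, Real.exp_add]
    calc (s⁻¹) ^ k * (Real.exp (-(a * s)) * Real.exp (-(b / (4 * s))))
        = ((s⁻¹) ^ k * Real.exp (-(b / (4 * s)))) * Real.exp (-(a * s)) := by ring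
      _ ≤ (k.factorial * (4 / b) ^ k) * Real.exp (-(a * s)) := by
          exact mul_le_mul_of_nonneg_right (inv_pow_mul_exp_le k hb hs) (Real.exp_pos _).le
      _ = _ := by rw [neg_mul]

theorem integrableOn_besselIntegrand (k : ℕ) {A B : ℂ} (hA : 0 < A.re) (hB : 0 < B.re) :
    IntegrableOn (besselIntegrand k A B) (Set.Ioi 0) := by
  refine Integrable.mono' (integrableOn_inv_pow_mul_exp k hA hB)
    ((continuousOn_besselIntegrand k A B).aestronglyMeasurable measurableSet_Ioi) ?_
  refine (ae_restrict_mem measurableSet_Ioi).mono fun s hs => ?_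
  rw [norm_besselIntegrand k A B hs]

/-- On a ball of radius half the real part, that real part stays bounded below. This supplies the
dominating functions for differentiation under the integral sign in either parameter. -/
theorem half_re_le_of_mem_ball {B w : ℂ} (hw : w ∈ Metric.ball B (B.re / 2)) :
    B.re / 2 ≤ w.re := by
  have h1 : |(w - B).re| ≤ ‖w - B‖ := Complex.abs_re_le_norm _
  rw [mem_ball_iff_norm] at hw
  have := neg_abs_le (w - B).re
  rw [Complex.sub_re] at *
  linarith

theorem hasDerivAt_besselIntegral_right (k : ℕ) {A B : ℂ} (hA : 0 < A.re) (hB : 0 < B.re) :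
    HasDerivAt (besselIntegral k A) (-(1 / 4) * besselIntegral (k + 1) A B) B := by
  have hB2 : 0 < B.re / 2 := by linarith
  have key := hasDerivAt_integral_of_dominated_loc_of_deriv_le
    (F := fun w s => besselIntegrand k A w s)
    (F' := fun w s => -(1 / 4) * besselIntegrand (k + 1) A w s)
    (μ := volume.restrict (Set.Ioi 0)) (x₀ := B)
    (bound := fun s => (s⁻¹) ^ (k + 1) * Real.exp (-(A.re * s + (B.re / 2) / (4 * s))))
    (Metric.ball_mem_nhds B hB2)
    (Eventually.of_forall fun w =>
      (continuousOn_besselIntegrand k A w).aestronglyMeasurable measurableSet_Ioi)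
    (integrableOn_besselIntegrand k hA hB)
    (((continuousOn_besselIntegrand (k + 1) A B).aestronglyMeasurable measurableSet_Ioi).const_mul _)
    ?_ (integrableOn_inv_pow_mul_exp (k + 1) hA hB2) ?_
  · refine key.2.congr_deriv ?_
    rw [integral_const_mul, besselIntegral]
  · refine (ae_restrict_mem measurableSet_Ioi).mono fun s hs w hw => ?_
    have hs : 0 < s := hs
    rw [norm_mul, norm_besselIntegrand _ _ _ hs]
    have h1 : ‖-(1 / 4 : ℂ)‖ ≤ 1 := by norm_num
    have h2 := half_re_le_of_mem_ball hw
    calc _ ≤ 1 * ((s⁻¹) ^ (k + 1) * Real.exp (-(A.re * s + w.re / (4 * s)))) := by gcongr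
      _ ≤ _ := by rw [one_mul]; gcongr
  · refine (ae_restrict_mem measurableSet_Ioi).mono fun s hs w hw => ?_
    have hs : (s : ℂ) ≠ 0 := by exact_mod_cast (Set.mem_Ioi.1 hs).ne'
    have h1 : HasDerivAt (fun w : ℂ => -(A * s + w / (4 * s))) (-(1 / (4 * s))) w := by
      exact (((hasDerivAt_id w).div_const (4 * (s : ℂ))).const_add (A * s)).neg
    refine (h1.cexp.const_mul (((s : ℂ)⁻¹) ^ k)).congr_deriv ?_
    simp only [besselIntegrand, inv_pow]
    field_simp
    ring

theorem hasDerivAt_besselIntegral_left (k : ℕ) {A B : ℂ} (hA : 0 < A.re) (hB : 0 < B.re) :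
    HasDerivAt (fun w => besselIntegral (k + 1) w B) (-besselIntegral k A B) A := by
  have hA2 : 0 < A.re / 2 := by linarith
  have key := hasDerivAt_integral_of_dominated_loc_of_deriv_le
    (F := fun w s => besselIntegrand (k + 1) w B s)
    (F' := fun w s => -besselIntegrand k w B s)
    (μ := volume.restrict (Set.Ioi 0)) (x₀ := A)
    (bound := fun s => (s⁻¹) ^ k * Real.exp (-((A.re / 2) * s + B.re / (4 * s))))
    (Metric.ball_mem_nhds A hA2)
    (Eventually.of_forall fun w =>
      (continuousOn_besselIntegrand (k + 1) w B).aestronglyMeasurable measurableSet_Ioi)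
    (integrableOn_besselIntegrand (k + 1) hA hB)
    ((continuousOn_besselIntegrand k A B).aestronglyMeasurable measurableSet_Ioi).neg
    ?_ (integrableOn_inv_pow_mul_exp k hA2 hB) ?_
  · refine key.2.congr_deriv ?_
    rw [integral_neg, besselIntegral]
  · refine (ae_restrict_mem measurableSet_Ioi).mono fun s hs w hw => ?_
    have hs : 0 < s := hs
    rw [norm_neg, norm_besselIntegrand _ _ _ hs]
    have h2 := half_re_le_of_mem_ball hw
    gcongr
  · refine (ae_restrict_mem measurableSet_Ioi).mono fun s hs w hw => ?_
    have hs : (s : ℂ) ≠ 0 := by exact_mod_cast (Set.mem_Ioi.1 hs).ne'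
    have h1 : HasDerivAt (fun w : ℂ => -(w * s + B / (4 * s))) (-(1 * (s : ℂ))) w := by
      exact (((hasDerivAt_id w).mul_const (s : ℂ)).add_const (B / (4 * s))).neg
    refine (h1.cexp.const_mul (((s : ℂ)⁻¹) ^ (k + 1))).congr_deriv ?_
    simp only [besselIntegrand, inv_pow]
    field_simp
    ring

theorem schwingerIntegrand_eq (M σ : ℂ) (s : ℝ) :
    schwingerIntegrand M σ s = besselIntegrand 2 (Complex.I * M) (-(Complex.I * σ)) s := by
  rw [schwingerIntegrand, besselIntegrand, one_div, inv_pow]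
  congr 2
  ring

theorem schwingerKernel_eq (M σ : ℂ) :
    schwingerKernel M σ =
      1 / (4 * (Real.pi : ℂ)) ^ 2 * besselIntegral 2 (Complex.I * M) (-(Complex.I * σ)) := by
  rw [schwingerKernel, besselIntegral]
  simp only [schwingerIntegrand_eq]

/-- Scaling of the proper time. -/
theorem besselIntegral_two_scale {a : ℝ} (ha : 0 < a) (B : ℂ) :
    besselIntegral 2 a B = a * besselIntegral 2 1 (a * B) := by
  have h := integral_comp_mul_left_Ioi (besselIntegrand 2 1 (a * B)) 0 ha
  rw [mul_zero] at h
  rw [besselIntegral, besselIntegral]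
  have hac : (a : ℂ) ≠ 0 := by exact_mod_cast ha.ne'
  have h2 : ∫ s in Set.Ioi (0 : ℝ), besselIntegrand 2 a B s =
      ∫ s in Set.Ioi (0 : ℝ), (a : ℂ) ^ 2 * besselIntegrand 2 1 (a * B) (a * s) := by
    refine setIntegral_congr_fun measurableSet_Ioi fun s hs => ?_
    have hs : (s : ℂ) ≠ 0 := by exact_mod_cast (Set.mem_Ioi.1 hs).ne'
    simp only [besselIntegrand]
    push_cast
    have e1 : (a : ℂ) * B / (4 * (a * s)) = B / (4 * s) := by field_simp
    rw [e1]
    field_simp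
  rw [h2, integral_const_mul, h, Complex.real_smul]
  push_cast
  field_simp

end

noncomputable section

/-! ### Behaviour of the Bessel integrals at the origin -/

/-- The real integral `∫_0^∞ s^{-k} e^{-s - y / (4 s)} ds`. -/
def besselReal (k : ℕ) (y : ℝ) : ℝ :=
  ∫ s in Set.Ioi (0 : ℝ), (s⁻¹) ^ k * Real.exp (-(s + y / (4 * s)))

theorem besselIntegral_one_ofReal (k : ℕ) (y : ℝ) :
    besselIntegral k 1 y = (besselReal k y : ℂ) := by
  rw [besselIntegral, besselReal, ← integral_complex_ofReal]
  refine integral_congr_ae (Eventually.of_forall fun s => ?_)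
  simp [besselIntegrand]

theorem hasDerivAt_besselReal (k : ℕ) {y : ℝ} (hy : 0 < y) :
    HasDerivAt (besselReal k) (-(1 / 4) * besselReal (k + 1) y) y := by
  have h := (hasDerivAt_besselIntegral_right k (A := 1) (B := (y : ℂ)) (by simp) (by simpa)).real_of_complex
  have e : (fun x : ℝ => (besselIntegral k 1 (x : ℂ)).re) = besselReal k := by
    ext x; rw [besselIntegral_one_ofReal, Complex.ofReal_re]
  rw [e] at h
  refine h.congr_deriv ?_
  rw [besselIntegral_one_ofReal, show -(1 / 4 : ℂ) * (besselReal (k + 1) y : ℂ) =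
    ((-(1 / 4) * besselReal (k + 1) y : ℝ) : ℂ) by push_cast; ring, Complex.ofReal_re]

theorem integrableOn_besselReal (k : ℕ) {y : ℝ} (hy : 0 < y) :
    IntegrableOn (fun s : ℝ => (s⁻¹) ^ k * Real.exp (-(s + y / (4 * s)))) (Set.Ioi 0) := by
  simpa using integrableOn_inv_pow_mul_exp k one_pos hy

theorem hasDerivAt_exp_neg_add_div (y : ℝ) {s : ℝ} (hs : s ≠ 0) :
    HasDerivAt (fun s : ℝ => Real.exp (-(s + y / (4 * s))))
      ((-1 + y / 4 * (s⁻¹) ^ 2) * Real.exp (-(s + y / (4 * s)))) s := by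
  have h1 : HasDerivAt (fun s : ℝ => y / 4 * s⁻¹) (y / 4 * (-(s ^ 2)⁻¹)) s :=
    (hasDerivAt_inv hs).const_mul _
  have h2 : HasDerivAt (fun s : ℝ => -(s + y / 4 * s⁻¹)) (-(1 + y / 4 * (-(s ^ 2)⁻¹))) s :=
    ((hasDerivAt_id s).add h1).neg
  have e : (fun s : ℝ => Real.exp (-(s + y / (4 * s)))) =
      fun s : ℝ => Real.exp (-(s + y / 4 * s⁻¹)) := by
    ext s; congr 3; rw [div_mul_eq_div_div, div_eq_mul_inv (y / 4)]
  rw [e]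
  refine h2.exp.congr_deriv ?_
  have e2 : y / (4 * s) = y / 4 * s⁻¹ := by rw [div_mul_eq_div_div, div_eq_mul_inv (y / 4)]
  rw [e2, inv_pow]
  ring

theorem exp_neg_add_div_le (s : ℝ) {y : ℝ} (hy : 0 < y) (hs : 0 < s) :
    Real.exp (-(s + y / (4 * s))) ≤ 4 / y * s := by
  have h := inv_pow_mul_exp_le 1 hy hs
  have h2 : Real.exp (-(s + y / (4 * s))) ≤ Real.exp (-(y / (4 * s))) := by
    apply Real.exp_le_exp.2; linarith
  refine h2.trans ?_
  rw [pow_one, pow_one, Nat.factorial_one, Nat.cast_one, one_mul, inv_mul_le_iff₀ hs] at h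
  linarith

theorem exp_neg_add_div_le_exp {s y : ℝ} (hy : 0 ≤ y) (hs : 0 < s) :
    Real.exp (-(s + y / (4 * s))) ≤ Real.exp (-s) := by
  apply Real.exp_le_exp.2
  have : 0 ≤ y / (4 * s) := by positivity
  linarith

/-- The derivative of `e^{-s - y/(4s)}` integrates to zero over the half line. Since each derivative
in `y` contributes `-1/4` and one more power of `1/s`, the identity is the equation `y P'' = P / 4`
for `P = besselReal 0`. -/
theorem besselReal_zero_eq {y : ℝ} (hy : 0 < y) : besselReal 0 y = y / 4 * besselReal 2 y := by
  -- The constant second factor reduces integration by parts to the fundamental theorem of calculus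
  -- on the half line.
  have h := integral_Ioi_deriv_mul_eq_sub (a := 0) (a' := (0 : ℝ)) (b' := 0)
    (u := fun s : ℝ => Real.exp (-(s + y / (4 * s)))) (v := fun _ => 1)
    (u' := fun s => (-1 + y / 4 * (s⁻¹) ^ 2) * Real.exp (-(s + y / (4 * s)))) (v' := fun _ => 0)
    (fun s hs => hasDerivAt_exp_neg_add_div y (Set.mem_Ioi.1 hs).ne')
    (fun s _ => hasDerivAt_const s 1) ?_ ?_ ?_
  · simp only [mul_one, mul_zero, add_zero, sub_zero] at h
    have i0 := integrableOn_besselReal 0 hy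
    have i2 := (integrableOn_besselReal 2 hy).const_mul (y / 4)
    have e : ∀ s : ℝ, (-1 + y / 4 * (s⁻¹) ^ 2) * Real.exp (-(s + y / (4 * s))) =
        y / 4 * ((s⁻¹) ^ 2 * Real.exp (-(s + y / (4 * s)))) -
          (s⁻¹) ^ 0 * Real.exp (-(s + y / (4 * s))) := fun s => by ring
    simp only [e] at h
    rw [integral_sub i2 i0, integral_const_mul] at h
    rw [besselReal, besselReal]
    linarith
  · have i0 := integrableOn_besselReal 0 hy
    have i2 := (integrableOn_besselReal 2 hy).const_mul (y / 4)
    refine (i2.sub i0).congr (Eventually.of_forall fun s => ?_)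
    simp only [Pi.sub_apply, Pi.add_apply, Pi.mul_apply]
    ring
  · have : Tendsto (fun s : ℝ => 4 / y * s) (𝓝[>] 0) (𝓝 0) := by
      have : Tendsto (fun s : ℝ => 4 / y * s) (𝓝 0) (𝓝 (4 / y * 0)) :=
        (continuous_const.mul continuous_id).tendsto 0
      rw [mul_zero] at this
      exact this.mono_left nhdsWithin_le_nhds
    refine squeeze_zero' ?_ ?_ this
    · exact Eventually.of_forall fun s => by simp only [Pi.mul_apply]; positivity
    · filter_upwards [self_mem_nhdsWithin] with s hs
      simpa using exp_neg_add_div_le s hy hs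
  · have : Tendsto (fun s : ℝ => Real.exp (-s)) atTop (𝓝 0) := Real.tendsto_exp_neg_atTop_nhds_zero
    refine squeeze_zero' ?_ ?_ this
    · exact Eventually.of_forall fun s => by simp only [Pi.mul_apply]; positivity
    · filter_upwards [eventually_gt_atTop 0] with s hs
      simpa using exp_neg_add_div_le_exp hy.le hs

/-! ### The logarithmic moment and Euler's constant -/

theorem abs_log_le {s : ℝ} (hs : 0 < s) : |Real.log s| ≤ 2 * s ^ (-(1 / 2) : ℝ) + s := by
  have hr : 0 < s ^ (-(1 / 2) : ℝ) := Real.rpow_pos_of_pos hs _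
  rcases le_total s 1 with h | h
  · have h1 := Real.abs_log_mul_self_rpow_lt s (1 / 2) hs h (by norm_num)
    rw [abs_mul, abs_of_pos (Real.rpow_pos_of_pos hs _)] at h1
    rw [Real.rpow_neg hs.le]
    have hp := Real.rpow_pos_of_pos hs (1 / 2)
    have : |Real.log s| ≤ 2 * (s ^ (1 / 2 : ℝ))⁻¹ := by
      rw [← div_eq_mul_inv, le_div_iff₀ hp]; linarith
    linarith
  · rw [abs_of_nonneg (Real.log_nonneg h)]
    have := Real.log_le_sub_one_of_pos hs
    linarith

theorem integrableOn_rpow_mul_exp_neg {r : ℝ} (hr : 0 < r) :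
    IntegrableOn (fun s : ℝ => s ^ (r - 1) * Real.exp (-s)) (Set.Ioi 0) := by
  refine (Real.GammaIntegral_convergent hr).congr (Eventually.of_forall fun s => ?_)
  simp only []
  ring

theorem integrableOn_abs_log_mul_exp_neg :
    IntegrableOn (fun s : ℝ => |Real.log s| * Real.exp (-s)) (Set.Ioi 0) := by
  have h1 := (integrableOn_rpow_mul_exp_neg (r := 1 / 2) (by norm_num)).const_mul 2
  have h2 := integrableOn_rpow_mul_exp_neg (r := 2) (by norm_num)
  refine Integrable.mono' (h1.add h2) ?_ ?_
  · exact Measurable.aestronglyMeasurable (by fun_prop)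
  · refine (ae_restrict_mem measurableSet_Ioi).mono fun s hs => ?_
    have hs : 0 < s := hs
    rw [Real.norm_of_nonneg (by positivity)]
    have := abs_log_le hs
    simp only [Pi.add_apply]
    rw [show (2 : ℝ) - 1 = 1 by norm_num, Real.rpow_one, show (1 : ℝ) / 2 - 1 = -(1 / 2) by norm_num]
    nlinarith [Real.exp_pos (-s)]

/-- Differentiating the Gamma integral at `1` inserts a factor `log s`, so the integral is `Γ'(1) =
-γ`. -/
theorem integral_log_mul_exp_neg :
    ∫ s in Set.Ioi (0 : ℝ), Real.log s * Real.exp (-s) = -Real.eulerMascheroniConstant := by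
  have h1 := Complex.hasDerivAt_GammaIntegral (s := 1) (by simp)
  have h2 : HasDerivAt Complex.Gamma
      (∫ t : ℝ in Set.Ioi 0, (t : ℂ) ^ ((1 : ℂ) - 1) * (Real.log t * Real.exp (-t))) 1 := by
    refine h1.congr_of_eventuallyEq ?_
    have : ∀ᶠ s : ℂ in 𝓝 1, 0 < s.re :=
      (isOpen_lt continuous_const Complex.continuous_re).mem_nhds (by simp)
    filter_upwards [this] with s hs
    exact Complex.Gamma_eq_integral hs
  have h3 := HasDerivAt.real_of_complex (e := Complex.Gamma) (z := 1) (by simpa using h2)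
  have e : (fun x : ℝ => (Complex.Gamma (x : ℂ)).re) = Real.Gamma := by
    ext x; rw [Complex.Gamma_ofReal, Complex.ofReal_re]
  rw [e] at h3
  have h4 := h3.deriv
  rw [Real.eulerMascheroniConstant_eq_neg_deriv, neg_neg, h4]
  have e2 : ∀ t : ℝ, (Real.log t : ℂ) * Real.exp (-t) = ((Real.log t * Real.exp (-t) : ℝ) : ℂ) :=
    fun t => by push_cast; rfl
  have e3 : (∫ t : ℝ in Set.Ioi 0, (Real.log t : ℂ) * Complex.exp (-t)) =
      ((∫ t : ℝ in Set.Ioi 0, Real.log t * Real.exp (-t) : ℝ) : ℂ) := by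
    rw [← integral_complex_ofReal]
    simp
  rw [e3, Complex.ofReal_re]

/-- The logarithmic moment `∫_0^∞ log s e^{-s - y / (4 s)} ds`. -/
def besselLog (y : ℝ) : ℝ :=
  ∫ s in Set.Ioi (0 : ℝ), Real.log s * Real.exp (-(s + y / (4 * s)))

theorem integrableOn_besselLog {y : ℝ} (hy : 0 ≤ y) :
    IntegrableOn (fun s : ℝ => Real.log s * Real.exp (-(s + y / (4 * s)))) (Set.Ioi 0) := by
  refine Integrable.mono' integrableOn_abs_log_mul_exp_neg
    (Measurable.aestronglyMeasurable (by fun_prop)) ?_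
  refine (ae_restrict_mem measurableSet_Ioi).mono fun s hs => ?_
  rw [norm_mul, Real.norm_eq_abs, Real.norm_of_nonneg (Real.exp_pos _).le]
  exact mul_le_mul_of_nonneg_left (exp_neg_add_div_le_exp hy hs) (abs_nonneg _)

theorem tendsto_besselLog :
    Tendsto besselLog (𝓝[>] 0) (𝓝 (-Real.eulerMascheroniConstant)) := by
  rw [← integral_log_mul_exp_neg]
  refine tendsto_integral_filter_of_dominated_convergence
    (fun s => |Real.log s| * Real.exp (-s)) ?_ ?_ integrableOn_abs_log_mul_exp_neg ?_
  · exact Eventually.of_forall fun y => Measurable.aestronglyMeasurable (by fun_prop)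
  · filter_upwards [self_mem_nhdsWithin] with y hy
    refine (ae_restrict_mem measurableSet_Ioi).mono fun s hs => ?_
    rw [norm_mul, Real.norm_eq_abs, Real.norm_of_nonneg (Real.exp_pos _).le]
    exact mul_le_mul_of_nonneg_left (exp_neg_add_div_le_exp (le_of_lt hy) hs) (abs_nonneg _)
  · refine Eventually.of_forall fun s => ?_
    have : Continuous fun y : ℝ => Real.log s * Real.exp (-(s + y / (4 * s))) := by fun_prop
    have h := (this.tendsto 0).mono_left (nhdsWithin_le_nhds (s := Set.Ioi 0))
    simpa using h

/-- The substitution `s ↦ c / s`. For `c = y / 4` it leaves the exponent `s + y / (4 s)` unchanged,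
which is how it is used. -/
theorem integral_comp_div_mul_Ioi {c : ℝ} (hc : 0 < c) (g : ℝ → ℝ) :
    ∫ s in Set.Ioi (0 : ℝ), c * (s⁻¹) ^ 2 * g (c / s) = ∫ s in Set.Ioi (0 : ℝ), g s := by
  have him : (fun s : ℝ => c / s) '' Set.Ioi 0 = Set.Ioi 0 := by
    ext x
    simp only [Set.mem_image, Set.mem_Ioi]
    constructor
    · rintro ⟨s, hs, rfl⟩; positivity
    · intro hx; exact ⟨c / x, by positivity, by field_simp⟩
  have hd : ∀ s ∈ Set.Ioi (0 : ℝ), HasDerivWithinAt (fun s : ℝ => c / s) (c * (-(s ^ 2)⁻¹))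
      (Set.Ioi 0) s := fun s hs => by
    have := ((hasDerivAt_inv (Set.mem_Ioi.1 hs).ne').const_mul c).hasDerivWithinAt (s := Set.Ioi 0)
    simpa [div_eq_mul_inv] using this
  have hinj : Set.InjOn (fun s : ℝ => c / s) (Set.Ioi 0) := by
    intro x hx y hy h
    have hx : x ≠ 0 := (Set.mem_Ioi.1 hx).ne'
    have hy : y ≠ 0 := (Set.mem_Ioi.1 hy).ne'
    simp only [] at h
    rw [div_eq_div_iff hx hy] at h
    exact (mul_left_cancel₀ hc.ne' h).symm
  have h := integral_image_eq_integral_abs_deriv_smul measurableSet_Ioi hd hinj g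
  rw [him] at h
  rw [h]
  refine setIntegral_congr_fun measurableSet_Ioi fun s _ => ?_
  simp only [smul_eq_mul, mul_neg, abs_neg, abs_mul, abs_of_pos hc]
  rw [abs_of_nonneg (by positivity), inv_pow]

/-- Integration by parts with `ds / s = d(log s)` gives `∫ log s (1 - y/(4s²)) e^{-s - y/(4s)} ds`.
The reflection `s ↦ y/(4s)` turns the second term into an integral of `log (y/4) - log s`. This
isolates the singularity `-log y` of the integral at `y = 0`. -/
theorem besselReal_one_eq {y : ℝ} (hy : 0 < y) :
    besselReal 1 y = 2 * besselLog y - Real.log (y / 4) * besselReal 0 y := by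
  have hc : 0 < y / 4 := by positivity
  have hsub := integral_comp_div_mul_Ioi hc
    (fun s => Real.log (y / 4 / s) * Real.exp (-(s + y / (4 * s))))
  have e1 : ∀ s ∈ Set.Ioi (0 : ℝ), y / 4 * (s⁻¹) ^ 2 *
      (Real.log (y / 4 / (y / 4 / s)) * Real.exp (-(y / 4 / s + y / (4 * (y / 4 / s))))) =
      y / 4 * (s⁻¹) ^ 2 * (Real.log s * Real.exp (-(s + y / (4 * s)))) := by
    intro s hs
    have hs : s ≠ 0 := (Set.mem_Ioi.1 hs).ne'
    have a1 : y / 4 / (y / 4 / s) = s := by field_simp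
    have a2 : y / 4 / s + y / (4 * (y / 4 / s)) = s + y / (4 * s) := by field_simp; ring
    rw [a1, a2]
  rw [setIntegral_congr_fun measurableSet_Ioi e1] at hsub
  have i0 := integrableOn_besselReal 0 hy
  have i1 := integrableOn_besselReal 1 hy
  have iL := integrableOn_besselLog hy.le
  have e2 : ∀ s ∈ Set.Ioi (0 : ℝ), Real.log (y / 4 / s) * Real.exp (-(s + y / (4 * s))) =
      Real.log (y / 4) * ((s⁻¹) ^ 0 * Real.exp (-(s + y / (4 * s)))) -
        Real.log s * Real.exp (-(s + y / (4 * s))) := by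
    intro s hs
    have hs : s ≠ 0 := (Set.mem_Ioi.1 hs).ne'
    rw [Real.log_div hc.ne' hs]
    ring
  rw [setIntegral_congr_fun measurableSet_Ioi e2, integral_sub (i0.const_mul _) iL,
    integral_const_mul] at hsub
  -- Half of the decay `e^{-s}` is spent on `|log s| ≤ 2 (1/s + 1) e^{s/2}`, which leaves the
  -- convergent integrals with `a = 1 / 2`.
  have iLL : IntegrableOn (fun s : ℝ => y / 4 * (s⁻¹) ^ 2 *
      (Real.log s * Real.exp (-(s + y / (4 * s))))) (Set.Ioi 0) := by
    have i2 := integrableOn_inv_pow_mul_exp 2 (a := 1 / 2) (b := y) (by norm_num) hy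
    have i3 := integrableOn_inv_pow_mul_exp 3 (a := 1 / 2) (b := y) (by norm_num) hy
    refine Integrable.mono' ((i3.const_mul (y)).add (i2.const_mul (y))) 
      (Measurable.aestronglyMeasurable (by fun_prop)) ?_
    refine (ae_restrict_mem measurableSet_Ioi).mono fun s hs => ?_
    have hs : 0 < s := hs
    have hlog : |Real.log s| ≤ 2 * (s⁻¹ + 1) * Real.exp (s / 2) := by
      have h1 : |Real.log s| ≤ s⁻¹ + s := by
        rw [abs_le]
        have l1 := Real.log_le_sub_one_of_pos hs
        have l2 := Real.log_le_sub_one_of_pos (inv_pos.2 hs)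
        rw [Real.log_inv] at l2
        have := inv_pos.2 hs
        constructor <;> linarith
      have h2 := Real.add_one_le_exp (s / 2)
      have h3 : 0 < s⁻¹ := inv_pos.2 hs
      nlinarith
    have hexp : Real.exp (-(s + y / (4 * s))) =
        Real.exp (-(s / 2)) * Real.exp (-(1 / 2 * s + y / (4 * s))) := by
      rw [← Real.exp_add]; congr 1; ring
    rw [norm_mul (y / 4 * s⁻¹ ^ 2), norm_mul (Real.log s), Real.norm_eq_abs (Real.log s), Real.norm_of_nonneg (Real.exp_pos _).le,
      Real.norm_of_nonneg (by positivity), hexp]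
    have hE : Real.exp (s / 2) * Real.exp (-(s / 2)) = 1 := by
      rw [← Real.exp_add]; simp
    simp only [Pi.add_apply]
    calc y / 4 * s⁻¹ ^ 2 * (|Real.log s| *
          (Real.exp (-(s / 2)) * Real.exp (-(1 / 2 * s + y / (4 * s)))))
        ≤ y / 4 * s⁻¹ ^ 2 * ((2 * (s⁻¹ + 1) * Real.exp (s / 2)) *
          (Real.exp (-(s / 2)) * Real.exp (-(1 / 2 * s + y / (4 * s))))) := by gcongr
      _ = y / 2 * s⁻¹ ^ 2 * (s⁻¹ + 1) * (Real.exp (s / 2) * Real.exp (-(s / 2))) *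
          Real.exp (-(1 / 2 * s + y / (4 * s))) := by ring
      _ = (1 / 2) * (y * (s⁻¹ ^ 3 * Real.exp (-(1 / 2 * s + y / (4 * s)))) +
          y * (s⁻¹ ^ 2 * Real.exp (-(1 / 2 * s + y / (4 * s))))) := by rw [hE]; ring
      _ ≤ _ := by
        have : 0 ≤ y * (s⁻¹ ^ 3 * Real.exp (-(1 / 2 * s + y / (4 * s)))) +
          y * (s⁻¹ ^ 2 * Real.exp (-(1 / 2 * s + y / (4 * s)))) := by positivity
        linarith
  have hibp := integral_Ioi_deriv_mul_eq_sub (a := 0) (a' := (0 : ℝ)) (b' := 0)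
    (u := Real.log) (v := fun s : ℝ => Real.exp (-(s + y / (4 * s))))
    (u' := fun s => s⁻¹)
    (v' := fun s => (-1 + y / 4 * (s⁻¹) ^ 2) * Real.exp (-(s + y / (4 * s))))
    (fun s hs => Real.hasDerivAt_log (Set.mem_Ioi.1 hs).ne')
    (fun s hs => hasDerivAt_exp_neg_add_div y (Set.mem_Ioi.1 hs).ne') ?_ ?_ ?_
  · have e3 : ∀ s : ℝ, s⁻¹ * Real.exp (-(s + y / (4 * s))) +
        Real.log s * ((-1 + y / 4 * (s⁻¹) ^ 2) * Real.exp (-(s + y / (4 * s)))) =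
        ((s⁻¹) ^ 1 * Real.exp (-(s + y / (4 * s))) -
          Real.log s * Real.exp (-(s + y / (4 * s)))) +
          y / 4 * (s⁻¹) ^ 2 * (Real.log s * Real.exp (-(s + y / (4 * s)))) := fun s => by ring
    simp only [e3] at hibp
    have iD : IntegrableOn (fun s : ℝ => (s⁻¹) ^ 1 * Real.exp (-(s + y / (4 * s))) -
      Real.log s * Real.exp (-(s + y / (4 * s)))) (Set.Ioi 0) := i1.sub iL
    rw [integral_add iD iLL, integral_sub i1 iL, hsub] at hibp
    rw [besselReal, besselReal, besselLog]
    linarith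
  · refine ((i1.sub iL).add iLL).congr (Eventually.of_forall fun s => ?_)
    simp only [Pi.add_apply, Pi.mul_apply, Pi.sub_apply]
    ring
  · have h0 : Tendsto (fun s : ℝ => 4 / y * |Real.log s * s|) (𝓝[>] 0) (𝓝 0) := by
      have := (tendsto_log_mul_rpow_nhdsGT_zero (r := 1) one_pos).abs.const_mul (4 / y)
      simpa using this
    refine squeeze_zero_norm' ?_ h0
    filter_upwards [self_mem_nhdsWithin] with s hs
    have hs : 0 < s := hs
    simp only [Pi.mul_apply]
    rw [norm_mul, Real.norm_eq_abs, Real.norm_of_nonneg (Real.exp_pos _).le, abs_mul, abs_of_pos hs]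
    have := exp_neg_add_div_le s hy hs
    calc |Real.log s| * Real.exp (-(s + y / (4 * s))) ≤ |Real.log s| * (4 / y * s) := by gcongr
      _ = _ := by ring
  · have h0 : Tendsto (fun s : ℝ => s ^ 1 * Real.exp (-s)) atTop (𝓝 0) :=
      Real.tendsto_pow_mul_exp_neg_atTop_nhds_zero 1
    refine squeeze_zero_norm' ?_ h0
    filter_upwards [eventually_ge_atTop 1] with s hs
    have hs0 : 0 < s := by linarith
    simp only [Pi.mul_apply]
    rw [norm_mul, Real.norm_eq_abs, Real.norm_of_nonneg (Real.exp_pos _).le,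
      abs_of_nonneg (Real.log_nonneg hs), pow_one]
    have l1 := Real.log_le_sub_one_of_pos hs0
    have := exp_neg_add_div_le_exp hy.le hs0
    gcongr
    linarith

/-- From `1 - e^{-x} ≤ √x` at `x = y / (4 s)`. The linear bound `1 - e^{-x} ≤ x` would leave `s⁻¹
e^{-s}`, which is not integrable at `0`; the rate `√y` is still enough to beat `log y`. -/
theorem one_sub_besselReal_zero_le {y : ℝ} (hy : 0 < y) :
    |besselReal 0 y - 1| ≤ (∫ s in Set.Ioi (0 : ℝ), s ^ (1 / 2 - 1 : ℝ) * Real.exp (-s)) * √y := by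
  have i0 := integrableOn_besselReal 0 hy
  have h1 : besselReal 0 y - 1 = ∫ s in Set.Ioi (0 : ℝ),
      ((s⁻¹) ^ 0 * Real.exp (-(s + y / (4 * s))) - Real.exp (-s)) := by
    rw [integral_sub i0 (integrableOn_exp_neg_Ioi 0), integral_exp_neg_Ioi_zero, besselReal]
  rw [h1, ← Real.norm_eq_abs, ← integral_mul_const]
  refine norm_integral_le_of_norm_le
    ((integrableOn_rpow_mul_exp_neg (r := 1 / 2) (by norm_num)).mul_const _) ?_
  refine (ae_restrict_mem measurableSet_Ioi).mono fun s hs => ?_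
  have hs : 0 < s := hs
  rw [pow_zero, one_mul, neg_add, Real.exp_add]
  set x := y / (4 * s) with hx
  have hx0 : 0 ≤ x := by positivity
  have e1 : Real.exp (-s) * Real.exp (-x) - Real.exp (-s) = -(Real.exp (-s) * (1 - Real.exp (-x))) := by
    ring
  have hle1 : Real.exp (-x) ≤ 1 := Real.exp_le_one_iff.2 (by linarith)
  rw [e1, norm_neg, Real.norm_of_nonneg (mul_nonneg (Real.exp_pos _).le (by linarith))]
  have h2 : 1 - Real.exp (-x) ≤ √x := by
    have h3 := Real.add_one_le_exp (-x)
    have h4 := Real.exp_pos (-x)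
    rcases le_total x 1 with h | h
    · have : x ≤ √x := Real.le_sqrt_of_sq_le (by nlinarith)
      linarith
    · have : 1 ≤ √x := Real.one_le_sqrt.2 h
      linarith
  have h3 : √x ≤ s ^ (1 / 2 - 1 : ℝ) * √y := by
    rw [show (1 / 2 - 1 : ℝ) = -(1 / 2) by norm_num, Real.rpow_neg hs.le, ← Real.sqrt_eq_rpow,
      ← Real.sqrt_inv, ← Real.sqrt_mul (by positivity)]
    apply Real.sqrt_le_sqrt
    rw [hx, div_mul_eq_div_div, div_eq_mul_inv (y / 4), mul_comm]
    gcongr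
    linarith
  calc Real.exp (-s) * (1 - Real.exp (-x)) ≤ Real.exp (-s) * (s ^ (1 / 2 - 1 : ℝ) * √y) := by
        gcongr; linarith
    _ = _ := by ring

theorem tendsto_besselReal_zero : Tendsto (besselReal 0) (𝓝[>] 0) (𝓝 1) := by
  rw [tendsto_iff_norm_sub_tendsto_zero]
  set C := ∫ s in Set.Ioi (0 : ℝ), s ^ (1 / 2 - 1 : ℝ) * Real.exp (-s)
  have h : Tendsto (fun y : ℝ => C * √y) (𝓝[>] 0) (𝓝 0) := by
    have : Tendsto (fun y : ℝ => C * √y) (𝓝 0) (𝓝 (C * √0)) :=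
      (continuous_const.mul Real.continuous_sqrt).tendsto 0
    rw [Real.sqrt_zero, mul_zero] at this
    exact this.mono_left nhdsWithin_le_nhds
  refine squeeze_zero' (Eventually.of_forall fun _ => norm_nonneg _) ?_ h
  filter_upwards [self_mem_nhdsWithin] with y hy
  exact one_sub_besselReal_zero_le hy

theorem tendsto_log_mul_besselReal_zero_sub_one :
    Tendsto (fun y => Real.log y * (besselReal 0 y - 1)) (𝓝[>] 0) (𝓝 0) := by
  set C := ∫ s in Set.Ioi (0 : ℝ), s ^ (1 / 2 - 1 : ℝ) * Real.exp (-s)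
  have h : Tendsto (fun y : ℝ => C * |Real.log y * y ^ (1 / 2 : ℝ)|) (𝓝[>] 0) (𝓝 0) := by
    have := (tendsto_log_mul_rpow_nhdsGT_zero (r := 1 / 2) (by norm_num)).abs.const_mul C
    simpa using this
  refine squeeze_zero_norm' ?_ h
  filter_upwards [self_mem_nhdsWithin] with y hy
  have hy : 0 < y := hy
  rw [norm_mul, abs_mul, Real.norm_eq_abs, ← Real.sqrt_eq_rpow, abs_of_nonneg (Real.sqrt_nonneg y)]
  calc _ ≤ |Real.log y| * (C * √y) := by gcongr; exact one_sub_besselReal_zero_le hy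
    _ = _ := by ring

/-- `2 K_0(√y) + log y → 2 log 2 - 2 γ` as `y → 0+`. -/
theorem tendsto_besselReal_one_add_log :
    Tendsto (fun y => besselReal 1 y + Real.log y) (𝓝[>] 0)
      (𝓝 (2 * Real.log 2 - 2 * Real.eulerMascheroniConstant)) := by
  have h := ((tendsto_besselLog.const_mul 2).sub tendsto_log_mul_besselReal_zero_sub_one).add
    (tendsto_besselReal_zero.const_mul (Real.log 4))
  have e4 : Real.log 4 = 2 * Real.log 2 := by
    rw [show (4 : ℝ) = 2 ^ 2 by norm_num, Real.log_pow]; norm_num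
  have e : 2 * -Real.eulerMascheroniConstant - 0 + Real.log 4 * 1 =
      2 * Real.log 2 - 2 * Real.eulerMascheroniConstant := by rw [e4]; ring
  rw [e] at h
  refine h.congr' ?_
  filter_upwards [self_mem_nhdsWithin] with y hy
  have hy : 0 < y := hy
  rw [besselReal_one_eq hy, Real.log_div hy.ne' (by norm_num)]
  ring

end

noncomputable section

/-! ### Closed form of the Bessel integral -/

/-- All coefficients are positive, so the sum is at least its constant term. Nonvanishing on the
half line is needed to divide by `y S(y)` when the solutions of the differential equation are
compared. -/
theorem half_le_coneSeries {t : ℝ} (ht : 0 ≤ t) : 1 / 2 ≤ coneSeries t := by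
  have h := (entireCoeff_coneCoeff.summable_ofReal t).sum_le_tsum {0}
    (fun k _ => mul_nonneg (coneCoeff_pos k).le (pow_nonneg ht k))
  simpa [coneCoeff_zero, coneSeries] using h

theorem coneSum_ofReal_ne_zero {t : ℝ} (ht : 0 ≤ t) : coneSum t ≠ 0 := by
  rw [coneSum_ofReal]
  have : 0 < coneSeries t := lt_of_lt_of_le (by norm_num) (half_le_coneSeries ht)
  exact_mod_cast this.ne'

/-- First derivative of `coneSum`. -/
def coneSumD : ℂ → ℂ := powerSum (derivCoeff fun k => (coneCoeff k : ℂ))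

/-- Second derivative of `coneSum`. -/
def coneSumDD : ℂ → ℂ := powerSum (derivCoeff (derivCoeff fun k => (coneCoeff k : ℂ)))

/-- First derivative of `coneSum'`. -/
def coneSumD' : ℂ → ℂ := powerSum (derivCoeff fun k => (coneCoeff' k : ℂ))

/-- Second derivative of `coneSum'`. -/
def coneSumDD' : ℂ → ℂ := powerSum (derivCoeff (derivCoeff fun k => (coneCoeff' k : ℂ)))

theorem hasDerivAt_coneSum (z : ℂ) : HasDerivAt coneSum (coneSumD z) z :=
  hasDerivAt_powerSum entireCoeff_coneCoeff z

theorem hasDerivAt_coneSumD (z : ℂ) : HasDerivAt coneSumD (coneSumDD z) z :=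
  hasDerivAt_powerSum entireCoeff_coneCoeff.derivCoeff z

theorem hasDerivAt_coneSum' (z : ℂ) : HasDerivAt coneSum' (coneSumD' z) z :=
  hasDerivAt_powerSum entireCoeff_coneCoeff' z

theorem hasDerivAt_coneSumD' (z : ℂ) : HasDerivAt coneSumD' (coneSumDD' z) z :=
  hasDerivAt_powerSum entireCoeff_coneCoeff'.derivCoeff z

theorem continuous_coneSum : Continuous coneSum := continuous_powerSum entireCoeff_coneCoeff

theorem continuous_coneSum' : Continuous coneSum' := continuous_powerSum entireCoeff_coneCoeff'

/-- The constant `γ - log 2`. -/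
def besselConst : ℝ := Real.eulerMascheroniConstant - Real.log 2

/-- The candidate `1 + (½ log y + γ - log 2) y S(y) - y T(y)` for `√y K_1(√y)`. -/
def besselCandidate (y : ℝ) : ℂ :=
  1 + ((1 / 2 * Real.log y + besselConst : ℝ) : ℂ) * (y * coneSum y) - y * coneSum' y

/-- The derivative of `besselCandidate`. -/
def besselCandidateD (y : ℝ) : ℂ :=
  coneSum y / 2 + ((1 / 2 * Real.log y + besselConst : ℝ) : ℂ) * (coneSum y + y * coneSumD y) -
    (coneSum' y + y * coneSumD' y)

theorem hasDerivAt_ofReal_mul {f : ℂ → ℂ} {f' : ℂ} {y : ℝ} (hf : HasDerivAt f f' y) :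
    HasDerivAt (fun y : ℝ => (y : ℂ) * f y) (f y + y * f') y := by
  have := (hasDerivAt_id (y : ℂ)).mul hf
  simpa using this.comp_ofReal

theorem hasDerivAt_log_add_const {y : ℝ} (hy : y ≠ 0) :
    HasDerivAt (fun y : ℝ => ((1 / 2 * Real.log y + besselConst : ℝ) : ℂ))
      ((1 / 2 * y⁻¹ : ℝ) : ℂ) y :=
  (((Real.hasDerivAt_log hy).const_mul (1 / 2)).add_const besselConst).ofReal_comp

theorem hasDerivAt_besselCandidate {y : ℝ} (hy : 0 < y) :
    HasDerivAt besselCandidate (besselCandidateD y) y := by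
  have h1 := (hasDerivAt_log_add_const hy.ne').mul (hasDerivAt_ofReal_mul (hasDerivAt_coneSum y))
  have h2 := hasDerivAt_ofReal_mul (hasDerivAt_coneSum' y)
  refine ((h1.const_add 1).sub h2).congr_deriv ?_
  rw [besselCandidateD]
  have : (y : ℂ) ≠ 0 := by exact_mod_cast hy.ne'
  push_cast
  field_simp

/-- The terms multiplied by the logarithm cancel by `coneSum_ode`; the others are exactly
`coneSum'_ode`. -/
theorem hasDerivAt_besselCandidateD {y : ℝ} (hy : 0 < y) :
    ∃ d : ℂ, HasDerivAt besselCandidateD d y ∧ y * d = besselCandidate y / 4 := by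
  have h0 := ((hasDerivAt_coneSum y).comp_ofReal).div_const 2
  have h1 := (hasDerivAt_log_add_const hy.ne').mul
    ((hasDerivAt_coneSum y).comp_ofReal.add (hasDerivAt_ofReal_mul (hasDerivAt_coneSumD y)))
  have h2 := (hasDerivAt_coneSum' y).comp_ofReal.add (hasDerivAt_ofReal_mul (hasDerivAt_coneSumD' y))
  refine ⟨_, (h0.add h1).sub h2, ?_⟩
  have o1 := coneSum_ode y
  have o2 := coneSum'_ode y
  change 2 * coneSumD y + y * coneSumDD y = coneSum y / 4 at o1
  change coneSum y / 2 + y * coneSumD y + y * coneSum' y / 4 =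
    1 / 4 + y * (2 * coneSumD' y + y * coneSumDD' y) at o2
  have hyc : (y : ℂ) ≠ 0 := by exact_mod_cast hy.ne'
  have hi : (y : ℂ) * (y : ℂ)⁻¹ = 1 := mul_inv_cancel₀ hyc
  rw [besselCandidate]
  simp only [Pi.add_apply]
  push_cast
  linear_combination y * (1 / 2 * (Real.log y : ℂ) + besselConst) * o1 + o2 +
    (1 / 2) * (coneSum y + y * coneSumD y) * hi

theorem tendsto_ofReal_nhdsGT_zero {f : ℂ → ℂ} (hf : Continuous f) :
    Tendsto (fun y : ℝ => f y) (𝓝[>] 0) (𝓝 (f 0)) := by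
  have : Continuous fun y : ℝ => f y := hf.comp Complex.continuous_ofReal
  have h := (this.tendsto 0).mono_left (nhdsWithin_le_nhds (s := Set.Ioi 0))
  simpa using h

theorem tendsto_log_mul_self_ofReal :
    Tendsto (fun y : ℝ => ((Real.log y * y : ℝ) : ℂ)) (𝓝[>] 0) (𝓝 0) := by
  have h := tendsto_log_mul_rpow_nhdsGT_zero (r := 1) one_pos
  simp only [Real.rpow_one] at h
  exact_mod_cast (Complex.continuous_ofReal.tendsto 0).comp h

theorem coneSum_zero : coneSum 0 = 1 / 2 := by
  rw [coneSum, powerSum_zero, coneCoeff_zero]; norm_num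

theorem coneSum'_zero : coneSum' 0 = 1 / 4 := by
  rw [coneSum', powerSum_zero, coneCoeff'_zero]; norm_num

theorem tendsto_besselCandidate : Tendsto besselCandidate (𝓝[>] 0) (𝓝 1) := by
  have hS := tendsto_ofReal_nhdsGT_zero continuous_coneSum
  have hyT := tendsto_ofReal_nhdsGT_zero (continuous_id.mul continuous_coneSum')
  have hyS := tendsto_ofReal_nhdsGT_zero (continuous_id.mul continuous_coneSum)
  have h := (((tendsto_log_mul_self_ofReal.mul hS).const_mul (1 / 2)).const_add 1).add
    ((hyS.const_mul (besselConst : ℂ)).sub hyT)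
  simp only [id, zero_mul, mul_zero, add_zero, sub_zero, Pi.mul_apply] at h
  refine h.congr fun y => ?_
  rw [besselCandidate]
  push_cast
  ring

/-- This limit fixes the constants. The two `log y` cancel because `S(0) = 1/2`, and the finite
parts cancel because the constant in the candidate is `γ - log 2` and `T(0) = 1/4`. -/
theorem tendsto_besselDefectD :
    Tendsto (fun y : ℝ => -(1 / 4) * (besselReal 1 y : ℂ) - besselCandidateD y) (𝓝[>] 0) (𝓝 0) := by
  have hc := entireCoeff_coneCoeff
  have cD : Continuous coneSumD := continuous_powerSum hc.derivCoeff
  have cD' : Continuous coneSumD' := continuous_powerSum entireCoeff_coneCoeff'.derivCoeff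
  have cT : Continuous (powerSum fun k => (coneCoeff (k + 1) : ℂ)) := continuous_powerSum hc.tail
  have h1 := (Complex.continuous_ofReal.tendsto _).comp tendsto_besselReal_one_add_log
  have cS := continuous_coneSum
  have cS' := continuous_coneSum'
  -- After `1/2` is split off `S(y)`, the rest of the factor of the logarithm is divisible by `y`,
  -- and `y log y → 0`.
  have h2 := tendsto_log_mul_self_ofReal.mul (tendsto_ofReal_nhdsGT_zero
    (f := fun z => powerSum (fun k => (coneCoeff (k + 1) : ℂ)) z + coneSumD z) (by fun_prop))
  have h3 := tendsto_ofReal_nhdsGT_zero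
    (f := fun z => 1 / 2 * coneSum z + besselConst * (coneSum z + z * coneSumD z)) (by fun_prop)
  have h4 := tendsto_ofReal_nhdsGT_zero (f := fun z => coneSum' z + z * coneSumD' z) (by fun_prop)
  have h := (((h1.const_mul (-(1 / 4))).sub (h2.const_mul (1 / 2))).sub h3).add h4
  simp only [coneSum_zero, coneSum'_zero, zero_mul, mul_zero, add_zero, sub_zero] at h
  have e : -(1 / 4) * ((2 * Real.log 2 - 2 * Real.eulerMascheroniConstant : ℝ) : ℂ) -
      (1 / 2 * (1 / 2) + (besselConst : ℂ) * (1 / 2)) + 1 / 4 = 0 := by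
    rw [besselConst]
    push_cast
    ring
  rw [e] at h
  refine h.congr fun y => ?_
  have e1 : coneSum y = _ := powerSum_eq_zero_add hc y
  rw [coneCoeff_zero] at e1
  simp only [besselCandidateD, Function.comp]
  push_cast at e1 ⊢
  linear_combination (1 / 2) * (Real.log y : ℂ) * e1

/-- The difference `P` of the two sides solves `y f'' = f / 4` and vanishes at `0` together with its
derivative. The equation is singular there, so uniqueness is obtained from the Wronskian with the
solution `y S(y)`: it is constant, hence zero, and so `P` is a multiple of `y S(y)`. The derivative
of `y S(y)` tends to `1/2` at `0`, so the multiple is zero. -/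
theorem besselReal_zero_eq_candidate {y : ℝ} (hy : 0 < y) :
    (besselReal 0 y : ℂ) = besselCandidate y := by
  set P : ℝ → ℂ := fun y => (besselReal 0 y : ℂ) - besselCandidate y with hP
  set P1 : ℝ → ℂ := fun y => -(1 / 4) * (besselReal 1 y : ℂ) - besselCandidateD y with hP1
  set s1 : ℝ → ℂ := fun y => (y : ℂ) * coneSum y with hs1
  set s1' : ℝ → ℂ := fun y => coneSum y + (y : ℂ) * coneSumD y with hs1'
  have dP : ∀ x : ℝ, 0 < x → HasDerivAt P (P1 x) x := fun x hx => by
    have := (hasDerivAt_besselReal 0 hx).ofReal_comp.sub (hasDerivAt_besselCandidate hx)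
    refine this.congr_deriv ?_
    simp [hP1]
  have dP1 : ∀ x : ℝ, 0 < x → ∃ d, HasDerivAt P1 d x ∧ x * d = P x / 4 := fun x hx => by
    obtain ⟨d, hd, hxd⟩ := hasDerivAt_besselCandidateD hx
    refine ⟨_, ((hasDerivAt_besselReal 1 hx).ofReal_comp.const_mul (-(1 / 4) : ℂ)).sub hd, ?_⟩
    have h0 := besselReal_zero_eq hx
    simp only [hP]
    rw [h0]
    push_cast
    linear_combination -hxd
  have ds1 : ∀ x : ℝ, HasDerivAt s1 (s1' x) x := fun x =>
    hasDerivAt_ofReal_mul (hasDerivAt_coneSum x)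
  have ds1' : ∀ x : ℝ, ∃ d, HasDerivAt s1' d x ∧ x * d = s1 x / 4 := fun x => by
    refine ⟨_, (hasDerivAt_coneSum x).comp_ofReal.add (hasDerivAt_ofReal_mul (hasDerivAt_coneSumD x)), ?_⟩
    have o1 := coneSum_ode x
    change 2 * coneSumD x + x * coneSumDD x = coneSum x / 4 at o1
    simp only [hs1]
    linear_combination x * o1
  have hs1ne : ∀ x : ℝ, 0 < x → s1 x ≠ 0 := fun x hx =>
    mul_ne_zero (by exact_mod_cast hx.ne') (coneSum_ofReal_ne_zero hx.le)
  have tP : Tendsto P (𝓝[>] 0) (𝓝 0) := by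
    have h := ((Complex.continuous_ofReal.tendsto _).comp tendsto_besselReal_zero).sub
      tendsto_besselCandidate
    simpa using h
  have tP1 : Tendsto P1 (𝓝[>] 0) (𝓝 0) := tendsto_besselDefectD
  have ts1 : Tendsto s1 (𝓝[>] 0) (𝓝 0) := by
    have := ((ds1 0).continuousAt.tendsto).mono_left (nhdsWithin_le_nhds (s := Set.Ioi 0))
    simpa [hs1] using this
  have ts1' : Tendsto s1' (𝓝[>] 0) (𝓝 (1 / 2)) := by
    obtain ⟨d, hd, -⟩ := ds1' 0
    have := (hd.continuousAt.tendsto).mono_left (nhdsWithin_le_nhds (s := Set.Ioi 0))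
    simpa [hs1', coneSum_zero] using this
  have hconst : ∀ f : ℝ → ℂ, (∀ x, 0 < x → HasDerivAt f 0 x) → ∀ x, 0 < x → f x = f 1 := by
    intro f hf x hx
    exact isOpen_Ioi.is_const_of_deriv_eq_zero (isPreconnected_Ioi (a := (0 : ℝ)))
      (fun x hx => (hf x hx).differentiableAt.differentiableWithinAt)
      (fun x hx => (hf x hx).deriv) hx (Set.mem_Ioi.2 one_pos)
  -- The Wronskian is constant on the half line and tends to zero at the origin.
  have hW0 : ∀ x, 0 < x → P x * s1' x - P1 x * s1 x = 0 := by
    have hW := hconst (fun x => P x * s1' x - P1 x * s1 x) fun x hx => by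
      obtain ⟨d, hd, hxd⟩ := dP1 x hx
      obtain ⟨e, he, hxe⟩ := ds1' x
      refine (((dP x hx).mul he).sub (hd.mul (ds1 x))).congr_deriv ?_
      have hxc : (x : ℂ) ≠ 0 := by exact_mod_cast hx.ne'
      apply mul_left_cancel₀ hxc
      linear_combination P x * hxe - s1 x * hxd
    have tW : Tendsto (fun x => P x * s1' x - P1 x * s1 x) (𝓝[>] 0) (𝓝 0) := by
      have := (tP.mul ts1').sub (tP1.mul ts1)
      simpa using this
    have tW' : Tendsto (fun x => P x * s1' x - P1 x * s1 x) (𝓝[>] 0)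
        (𝓝 (P 1 * s1' 1 - P1 1 * s1 1)) := by
      refine tendsto_const_nhds.congr' ?_
      filter_upwards [self_mem_nhdsWithin] with x hx
      exact (hW x hx).symm
    intro x hx
    rw [hW x hx]
    exact tendsto_nhds_unique tW' tW
  -- The numerator of the derivative of the quotient is minus the Wronskian.
  have hq := hconst (fun x => P x / s1 x) fun x hx => by
    refine ((dP x hx).div (ds1 x) (hs1ne x hx)).congr_deriv ?_
    rw [show P1 x * s1 x - P x * s1' x = 0 by linear_combination -(hW0 x hx), zero_div]
  set c := P 1 / s1 1
  have hPc : ∀ x, 0 < x → P x = c * s1 x := fun x hx => by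
    have h : P x / s1 x = c := hq x hx
    rwa [div_eq_iff (hs1ne x hx)] at h
  have hP1c : ∀ x, 0 < x → P1 x = c * s1' x := fun x hx => by
    apply mul_right_cancel₀ (hs1ne x hx)
    have := hW0 x hx
    rw [hPc x hx] at this
    linear_combination -this
  have hc0 : c = 0 := by
    have t1 : Tendsto P1 (𝓝[>] 0) (𝓝 (c * (1 / 2))) := by
      refine (ts1'.const_mul c).congr' ?_
      filter_upwards [self_mem_nhdsWithin] with x hx
      exact (hP1c x hx).symm
    have := tendsto_nhds_unique t1 tP1
    simpa using this
  have := hPc y hy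
  rw [hc0, zero_mul] at this
  exact sub_eq_zero.1 this

/-- The part of the Bessel integral with at most a logarithmic singularity at `B = 0`. -/
def besselRemainder (A B : ℂ) : ℂ :=
  4 * A * (((Complex.log A + Complex.log B) / 2 + (besselConst : ℂ)) * coneSum (A * B) -
    coneSum' (A * B))

theorem besselIntegral_two_one_ofReal {y : ℝ} (hy : 0 < y) :
    besselIntegral 2 1 y = 4 / y + besselRemainder 1 y := by
  have h0 := besselReal_zero_eq hy
  have h1 := besselReal_zero_eq_candidate hy
  have hyc : (y : ℂ) ≠ 0 := by exact_mod_cast hy.ne'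
  rw [h0, besselCandidate] at h1
  rw [besselIntegral_one_ofReal, besselRemainder, Complex.log_one, ← Complex.ofReal_log hy.le, one_mul]
  push_cast at h1
  field_simp
  linear_combination 8 * h1

theorem besselIntegral_two_ofReal {a y : ℝ} (ha : 0 < a) (hy : 0 < y) :
    besselIntegral 2 a y = 4 / y + besselRemainder a y := by
  have hac : (a : ℂ) ≠ 0 := by exact_mod_cast ha.ne'
  have hyc : (y : ℂ) ≠ 0 := by exact_mod_cast hy.ne'
  rw [besselIntegral_two_scale ha, ← Complex.ofReal_mul, besselIntegral_two_one_ofReal (by positivity),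
    besselRemainder, besselRemainder, Complex.log_one, ← Complex.ofReal_log (by positivity),
    ← Complex.ofReal_log ha.le, ← Complex.ofReal_log hy.le, Real.log_mul ha.ne' hy.ne', one_mul]
  push_cast
  field_simp
  ring

/-! ### Analytic continuation to complex parameters -/

theorem eqOn_re_pos_of_eq_ofReal {f g : ℂ → ℂ} (hf : ∀ z : ℂ, 0 < z.re → DifferentiableAt ℂ f z)
    (hg : ∀ z : ℂ, 0 < z.re → DifferentiableAt ℂ g z) (h : ∀ x : ℝ, 0 < x → f x = g x)
    {z : ℂ} (hz : 0 < z.re) : f z = g z := by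
  have hU : IsOpen {z : ℂ | 0 < z.re} := isOpen_lt continuous_const Complex.continuous_re
  have hf' : AnalyticOnNhd ℂ f {z : ℂ | 0 < z.re} :=
    DifferentiableOn.analyticOnNhd (fun z hz => (hf z hz).differentiableWithinAt) hU
  have hg' : AnalyticOnNhd ℂ g {z : ℂ | 0 < z.re} :=
    DifferentiableOn.analyticOnNhd (fun z hz => (hg z hz).differentiableWithinAt) hU
  refine hf'.eqOn_of_preconnected_of_frequently_eq hg'
    (convex_halfSpace_re_gt 0).isPreconnected (z₀ := 1) (by simp) ?_ hz
  -- Real points approaching `1` from the right provide the accumulation point required by the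
  -- identity theorem.
  have ht : Tendsto (fun x : ℝ => (x : ℂ)) (𝓝[>] 1) (𝓝[≠] 1) := by
    refine tendsto_nhdsWithin_iff.2 ⟨?_, ?_⟩
    · exact (Complex.continuous_ofReal.tendsto 1).mono_left nhdsWithin_le_nhds
    · filter_upwards [self_mem_nhdsWithin] with x hx
      have : x ≠ 1 := (Set.mem_Ioi.1 hx).ne'
      simpa using this
  refine ht.frequently (Eventually.frequently ?_)
  filter_upwards [self_mem_nhdsWithin] with x hx
  exact h x (one_pos.trans hx)

theorem analyticAt_besselRemainder {q : ℂ × ℂ} (h1 : q.1 ∈ Complex.slitPlane)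
    (h2 : q.2 ∈ Complex.slitPlane) :
    AnalyticAt ℂ (fun q : ℂ × ℂ => besselRemainder q.1 q.2) q := by
  have hS : AnalyticAt ℂ coneSum (q.1 * q.2) :=
    (differentiable_powerSum entireCoeff_coneCoeff).analyticAt _
  have hT : AnalyticAt ℂ coneSum' (q.1 * q.2) :=
    (differentiable_powerSum entireCoeff_coneCoeff').analyticAt _
  have m : AnalyticAt ℂ (fun q : ℂ × ℂ => q.1 * q.2) q := analyticAt_fst.mul analyticAt_snd
  have hS2 : AnalyticAt ℂ (fun q : ℂ × ℂ => coneSum (q.1 * q.2)) q :=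
    AnalyticAt.fun_comp (f := fun q : ℂ × ℂ => q.1 * q.2) hS m
  have hT2 : AnalyticAt ℂ (fun q : ℂ × ℂ => coneSum' (q.1 * q.2)) q :=
    AnalyticAt.fun_comp (f := fun q : ℂ × ℂ => q.1 * q.2) hT m
  have l1 : AnalyticAt ℂ (fun q : ℂ × ℂ => Complex.log q.1) q := analyticAt_fst.clog h1
  have l2 : AnalyticAt ℂ (fun q : ℂ × ℂ => Complex.log q.2) q := analyticAt_snd.clog h2
  exact (analyticAt_const.mul analyticAt_fst).mul
    (((((l1.add l2).div analyticAt_const (by norm_num)).add analyticAt_const).mul hS2).sub hT2)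

theorem slitPlane_of_re_pos {z : ℂ} (hz : 0 < z.re) : z ∈ Complex.slitPlane := Or.inl hz

/-- `∫_0^∞ s⁻² e^{-A s - B / (4 s)} ds = 4 √(A / B) K_1(√(A B))`, with the Macdonald function
expanded at the origin. -/
theorem besselIntegral_two_eq {A B : ℂ} (hA : 0 < A.re) (hB : 0 < B.re) :
    besselIntegral 2 A B = 4 / B + besselRemainder A B := by
  have hne : ∀ z : ℂ, 0 < z.re → z ≠ 0 := fun z hz h => by simp [h] at hz
  -- Continuation proceeds in one variable at a time: first in `A` at fixed real `y`, then in `B` at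
  -- fixed complex `A`.
  have step : ∀ y : ℝ, 0 < y → ∀ A : ℂ, 0 < A.re →
      besselIntegral 2 A y = 4 / y + besselRemainder A y := by
    intro y hy A hA
    have hyre : 0 < (y : ℂ).re := by simpa
    refine eqOn_re_pos_of_eq_ofReal (f := fun A => besselIntegral 2 A y)
      (g := fun A => 4 / y + besselRemainder A y) ?_ ?_ ?_ hA
    · intro z hz
      exact (hasDerivAt_besselIntegral_left 1 hz hyre).differentiableAt
    · intro z hz
      have h := (analyticAt_besselRemainder (q := (z, (y : ℂ)))
        (slitPlane_of_re_pos hz) (slitPlane_of_re_pos hyre)).differentiableAt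
      have hp : DifferentiableAt ℂ (fun z : ℂ => (z, (y : ℂ))) z := by fun_prop
      exact (DifferentiableAt.comp z h hp).const_add _
    · intro x hx
      exact besselIntegral_two_ofReal hx hy
  refine eqOn_re_pos_of_eq_ofReal (f := fun B => besselIntegral 2 A B)
      (g := fun B => 4 / B + besselRemainder A B) ?_ ?_ ?_ hB
  · intro z hz
    exact (hasDerivAt_besselIntegral_right 2 hA hz).differentiableAt
  · intro z hz
    have h := (analyticAt_besselRemainder (q := (A, z))
      (slitPlane_of_re_pos hA) (slitPlane_of_re_pos hz)).differentiableAt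
    have hp : DifferentiableAt ℂ (fun z : ℂ => (A, z)) z := by fun_prop
    exact ((differentiableAt_const _).div differentiableAt_id (hne z hz)).add
      (DifferentiableAt.comp (g := fun q : ℂ × ℂ => besselRemainder q.1 q.2) z h hp)
  · intro x hx
    exact step x hx A hA

end

noncomputable section

/-! ### The proper-time kernel and its boundary values -/

theorem I_mul_re (z : ℂ) : (Complex.I * z).re = -z.im := by simp

theorem neg_I_mul_re (z : ℂ) : (-(Complex.I * z)).re = z.im := by simp

theorem integrableOn_schwingerIntegrand {M σ : ℂ} (hM : M.im < 0) (hσ : 0 < σ.im) :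
    IntegrableOn (schwingerIntegrand M σ) (Set.Ioi (0 : ℝ)) := by
  have h := integrableOn_besselIntegrand 2 (A := Complex.I * M) (B := -(Complex.I * σ))
    (by rw [I_mul_re]; linarith) (by rwa [neg_I_mul_re])
  exact h.congr (Eventually.of_forall fun s => (schwingerIntegrand_eq M σ s).symm)

/-- The closed form of the proper-time kernel. -/
def closedKernel (M σ : ℂ) : ℂ :=
  1 / (4 * (Real.pi : ℂ)) ^ 2 * (4 / (-(Complex.I * σ)) +
    besselRemainder (Complex.I * M) (-(Complex.I * σ)))

theorem schwingerKernel_eq_closedKernel {M σ : ℂ} (hM : M.im < 0) (hσ : 0 < σ.im) :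
    schwingerKernel M σ = closedKernel M σ := by
  rw [schwingerKernel_eq, closedKernel, besselIntegral_two_eq (by rw [I_mul_re]; linarith)
    (by rwa [neg_I_mul_re])]

theorem analyticAt_closedKernel {q : ℂ × ℂ} (h1 : Complex.I * q.1 ∈ Complex.slitPlane)
    (h2 : -(Complex.I * q.2) ∈ Complex.slitPlane) :
    AnalyticAt ℂ (fun q : ℂ × ℂ => closedKernel q.1 q.2) q := by
  have m1 : AnalyticAt ℂ (fun q : ℂ × ℂ => Complex.I * q.1) q := analyticAt_const.mul analyticAt_fst
  have m2 : AnalyticAt ℂ (fun q : ℂ × ℂ => -(Complex.I * q.2)) q :=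
    (analyticAt_const.mul analyticAt_snd).neg
  have hR : AnalyticAt ℂ (fun q : ℂ × ℂ => besselRemainder q.1 q.2)
      ((fun q : ℂ × ℂ => (Complex.I * q.1, -(Complex.I * q.2))) q) :=
    analyticAt_besselRemainder (q := (Complex.I * q.1, -(Complex.I * q.2))) h1 h2
  have hR2 := AnalyticAt.fun_comp (f := fun q : ℂ × ℂ => (Complex.I * q.1, -(Complex.I * q.2)))
    hR (m1.prod m2)
  exact analyticAt_const.mul ((analyticAt_const.div m2 (Complex.slitPlane_ne_zero h2)).add hR2)

/-- Joint analyticity is read off from the closed form: `iM` and `-iσ` lie in the right half-plane,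
where the principal logarithm is analytic. -/
theorem analyticOnNhd_schwingerKernel :
    AnalyticOnNhd ℂ (fun q : ℂ × ℂ => schwingerKernel q.1 q.2)
      {q : ℂ × ℂ | q.1.im < 0 ∧ 0 < q.2.im} := by
  intro q hq
  have hU : IsOpen {q : ℂ × ℂ | q.1.im < 0 ∧ 0 < q.2.im} :=
    (isOpen_lt (Complex.continuous_im.comp continuous_fst) continuous_const).inter
      (isOpen_lt continuous_const (Complex.continuous_im.comp continuous_snd))
  have h1 : Complex.I * q.1 ∈ Complex.slitPlane :=
    slitPlane_of_re_pos (by rw [I_mul_re]; linarith [hq.1])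
  have h2 : -(Complex.I * q.2) ∈ Complex.slitPlane :=
    slitPlane_of_re_pos (by rw [neg_I_mul_re]; exact hq.2)
  refine (analyticAt_closedKernel h1 h2).congr ?_
  filter_upwards [hU.mem_nhds hq] with p hp
  exact (schwingerKernel_eq_closedKernel hp.1 hp.2).symm

theorem I_mul_ofReal_mem_slitPlane {x : ℝ} (hx : x ≠ 0) :
    Complex.I * (x : ℂ) ∈ Complex.slitPlane := by
  right
  simpa using hx

/-- The boundary value of the proper-time kernel as a function of `σ ≠ 0`. -/
def boundaryKernel (m σ : ℝ) : ℂ := closedKernel ((m : ℂ) ^ 2) (σ : ℂ)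

/-- At the boundary `im²` and `-iσ` lie on the imaginary axis away from `0`, still inside the slit
plane, so the closed form is analytic across the boundary. -/
theorem continuousAt_closedKernel {m σ : ℝ} (hm : 0 < m) (hσ : σ ≠ 0) :
    ContinuousAt (fun q : ℂ × ℂ => closedKernel q.1 q.2) ((m : ℂ) ^ 2, (σ : ℂ)) := by
  refine (analyticAt_closedKernel (q := ((m : ℂ) ^ 2, (σ : ℂ))) ?_ ?_).continuousAt
  · have := I_mul_ofReal_mem_slitPlane (x := m ^ 2) (by positivity)
    simpa using this
  · have := I_mul_ofReal_mem_slitPlane (x := -σ) (neg_ne_zero.2 hσ)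
    simpa using this

theorem sub_I_mul_im_neg (m : ℝ) {ε : ℝ} (hε : 0 < ε) :
    ((m : ℂ) ^ 2 - Complex.I * (ε : ℂ)).im < 0 := by
  have h : ((m : ℂ) ^ 2).im = 0 := by rw [← Complex.ofReal_pow, Complex.ofReal_im]
  simpa [h] using hε

theorem add_I_mul_im_pos (σ : ℝ) {δ : ℝ} (hδ : 0 < δ) :
    0 < ((σ : ℂ) + Complex.I * (δ : ℂ)).im := by
  simpa using hδ

theorem tendsto_schwingerKernel {m σ : ℝ} (hm : 0 < m) (hσ : σ ≠ 0) :
    Tendsto (fun r : ℝ × ℝ => schwingerKernel ((m : ℂ) ^ 2 - Complex.I * (r.1 : ℂ))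
          ((σ : ℂ) + Complex.I * (r.2 : ℂ)))
        (𝓝[>] 0 ×ˢ 𝓝[>] 0) (𝓝 (boundaryKernel m σ)) := by
  have hc : Continuous (fun r : ℝ × ℝ => ((m : ℂ) ^ 2 - Complex.I * (r.1 : ℂ),
      (σ : ℂ) + Complex.I * (r.2 : ℂ))) := by fun_prop
  have h0 := hc.tendsto (0, 0)
  simp only [Complex.ofReal_zero, mul_zero, sub_zero, add_zero] at h0
  have h1 := (continuousAt_closedKernel hm hσ).tendsto.comp h0
  have hle : (𝓝[>] (0 : ℝ)) ×ˢ (𝓝[>] (0 : ℝ)) ≤ 𝓝 (0, 0) := by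
    rw [nhds_prod_eq]
    exact Filter.prod_mono nhdsWithin_le_nhds nhdsWithin_le_nhds
  refine (h1.mono_left hle).congr' ?_
  filter_upwards [prod_mem_prod self_mem_nhdsWithin self_mem_nhdsWithin] with r hr
  exact (schwingerKernel_eq_closedKernel (sub_I_mul_im_neg m hr.1) (add_I_mul_im_pos σ hr.2)).symm

/-! ### The Hankel function -/

/-- The coefficients `1 / (4^k (k!)²)` of `I_0(2 √(z / 4))`. -/
def besselCoeff (k : ℕ) : ℝ := 1 / (4 ^ k * (k.factorial : ℝ) ^ 2)

theorem entireCoeff_besselCoeff : EntireCoeff fun k => (besselCoeff k : ℂ) := by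
  refine EntireCoeff.of_norm_le fun k => ?_
  have hf : (1 : ℝ) ≤ k.factorial := by exact_mod_cast Nat.succ_le_of_lt (Nat.factorial_pos k)
  have h4 : (1 : ℝ) ≤ 4 ^ k := one_le_pow₀ (by norm_num)
  rw [Complex.norm_real, besselCoeff, Real.norm_of_nonneg (by positivity)]
  apply one_div_le_one_div_of_le (by positivity)
  nlinarith [mul_le_mul h4 hf (by norm_num) (by positivity)]

theorem besselCoeff_succ (k : ℕ) : besselCoeff (k + 1) = coneCoeff k / (2 * ((k : ℝ) + 1)) := by
  rw [besselCoeff, coneCoeff, Nat.factorial_succ]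
  push_cast
  have hf : (k.factorial : ℝ) ≠ 0 := by positivity
  rw [pow_succ, show (4 : ℝ) = 2 ^ 2 by norm_num, ← pow_mul, pow_succ _ (2 * k)]
  field_simp

theorem besselJ_zero_eq (z : ℂ) : besselJ 0 z = powerSum (fun k => (besselCoeff k : ℂ)) (-z ^ 2) := by
  rw [besselJ, powerSum]
  refine tsum_congr fun k => ?_
  rw [besselCoeff, add_zero, add_zero, div_pow, pow_mul, pow_mul, neg_pow (z ^ 2)]
  push_cast
  norm_num
  field_simp

theorem besselJ_one_eq (z : ℂ) : besselJ 1 z = z * coneSum (-z ^ 2) := by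
  rw [besselJ, coneSum, powerSum, ← tsum_mul_left]
  refine tsum_congr fun k => ?_
  rw [coneCoeff, div_pow, pow_succ z, pow_mul z, neg_pow (z ^ 2)]
  push_cast
  field_simp

/-- Since `H_{k+1} = h_k + 1/(2(k + 1))`, the series of `Y_1` splits into the one with coefficients
`c_k h_k` and the tail of `J_0`. -/
theorem tsum_harmonic_eq (z : ℂ) :
    ∑' k : ℕ, (-1) ^ k * (harmonic (k + 1) : ℂ) / ((k.factorial : ℂ) * ((k + 1).factorial : ℂ)) *
          (z / 2) ^ (2 * k + 1) =
      z * (coneSum' (-z ^ 2) + powerSum (fun k => (besselCoeff (k + 1) : ℂ)) (-z ^ 2)) := by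
  rw [coneSum', ← powerSum_add entireCoeff_coneCoeff' entireCoeff_besselCoeff.tail, powerSum,
    ← tsum_mul_left]
  refine tsum_congr fun k => ?_
  have h1 : (coneCoeff' k : ℂ) + besselCoeff (k + 1) = coneCoeff k * (harmonic (k + 1) : ℂ) := by
    have : coneCoeff' k + besselCoeff (k + 1) = coneCoeff k * (harmonic (k + 1) : ℝ) := by
      rw [besselCoeff_succ, coneCoeff', harmonic_succ]
      push_cast
      field_simp
      ring
    have h := congrArg (fun x : ℝ => (x : ℂ)) this
    push_cast at h
    exact h
  rw [h1, coneCoeff, div_pow, pow_succ z, pow_mul z, neg_pow (z ^ 2)]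
  push_cast
  field_simp

/-- Writing `J_0(z) = 1 + (-z²) · tail`, the term `-J_0(z)/z` contributes `z · tail`, which cancels
the tail in `tsum_harmonic_eq`. What remains has the shape of the light-cone expansion with `-z²` in
place of `m² σ`. -/
theorem hankelForm_eq (m : ℝ) {z : ℂ} (hz : z ≠ 0) :
    hankelForm m z = Complex.I * (m : ℂ) ^ 2 / (4 * (Real.pi : ℂ) ^ 2) *
      (1 / (-z ^ 2) + ((Real.eulerMascheroniConstant : ℂ) + Complex.log (z / 2)) * coneSum (-z ^ 2) -
        coneSum' (-z ^ 2)) - (m : ℂ) ^ 2 / (8 * (Real.pi : ℂ)) * coneSum (-z ^ 2) := by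
  have hpi : (Real.pi : ℂ) ≠ 0 := by exact_mod_cast Real.pi_ne_zero
  have h0 : besselJ 0 z = 1 + (-z ^ 2) * powerSum (fun k => (besselCoeff (k + 1) : ℂ)) (-z ^ 2) := by
    rw [besselJ_zero_eq, powerSum_eq_zero_add entireCoeff_besselCoeff]
    simp [besselCoeff]
  rw [hankelForm, hankelH2, besselY1, tsum_harmonic_eq, besselJ_one_eq, h0]
  field_simp
  ring

theorem log_I_mul_sq {m : ℝ} (hm : 0 < m) :
    Complex.log (Complex.I * (m : ℂ) ^ 2) = 2 * (Real.log m : ℂ) + Real.pi / 2 * Complex.I := by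
  have h : Complex.I * (m : ℂ) ^ 2 = ((m ^ 2 : ℝ) : ℂ) * Complex.I := by push_cast; ring
  rw [h, Complex.log_ofReal_mul (by positivity) Complex.I_ne_zero, Complex.log_I, Real.log_pow]
  push_cast
  ring

/-- The phase is `π/2` for `σ < 0` and `-π/2` for `σ > 0`. Added to the phase `π/2` of `log (im²)`
it gives `π` or `0`, the source of the step function in `Re G`. -/
theorem log_neg_I_mul_of_neg {σ : ℝ} (hσ : σ < 0) :
    Complex.log (-(Complex.I * (σ : ℂ))) = (Real.log |σ| : ℂ) + Real.pi / 2 * Complex.I := by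
  have h : -(Complex.I * (σ : ℂ)) = ((-σ : ℝ) : ℂ) * Complex.I := by push_cast; ring
  rw [h, Complex.log_ofReal_mul (by linarith) Complex.I_ne_zero, Complex.log_I, abs_of_neg hσ]

theorem log_neg_I_mul_of_pos {σ : ℝ} (hσ : 0 < σ) :
    Complex.log (-(Complex.I * (σ : ℂ))) = (Real.log |σ| : ℂ) - Real.pi / 2 * Complex.I := by
  have h : -(Complex.I * (σ : ℂ)) = (σ : ℂ) * (-Complex.I) := by ring
  rw [h, Complex.log_ofReal_mul hσ (neg_ne_zero.2 Complex.I_ne_zero), Complex.log_neg_I,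
    abs_of_pos hσ]
  ring

theorem I_mul_sq_mul (m σ : ℝ) :
    Complex.I * (m : ℂ) ^ 2 * (-(Complex.I * (σ : ℂ))) = ((m ^ 2 * σ : ℝ) : ℂ) := by
  push_cast
  linear_combination -(m : ℂ) ^ 2 * σ * Complex.I_mul_I

theorem boundaryKernel_eq {m σ : ℝ} {L : ℂ} (hm : 0 < m) (hσ : σ ≠ 0)
    (hL : Complex.log (-(Complex.I * (σ : ℂ))) = L) :
    boundaryKernel m σ = Complex.I * (m : ℂ) ^ 2 / (4 * (Real.pi : ℂ) ^ 2) *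
      (1 / ((m ^ 2 * σ : ℝ) : ℂ) + ((2 * (Real.log m : ℂ) + Real.pi / 2 * Complex.I + L) / 2 +
        (besselConst : ℂ)) * coneSum ((m ^ 2 * σ : ℝ) : ℂ) - coneSum' ((m ^ 2 * σ : ℝ) : ℂ)) := by
  rw [boundaryKernel, closedKernel, besselRemainder, log_I_mul_sq hm, hL, I_mul_sq_mul]
  have hpi : (Real.pi : ℂ) ≠ 0 := by exact_mod_cast Real.pi_ne_zero
  have hmc : (m : ℂ) ≠ 0 := by exact_mod_cast hm.ne'
  have hσc : (σ : ℂ) ≠ 0 := by exact_mod_cast hσ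
  have e : 4 / (-(Complex.I * (σ : ℂ))) = 4 * Complex.I * m ^ 2 * (1 / ((m ^ 2 * σ : ℝ) : ℂ)) := by
    push_cast
    field_simp
    simp
  rw [e]
  field_simp
  ring

theorem boundaryKernel_of_neg {m σ : ℝ} (hm : 0 < m) (hσ : σ < 0) :
    boundaryKernel m σ = hankelForm m ((m * √(-σ) : ℝ) : ℂ) := by
  have hs : 0 < √(-σ) := Real.sqrt_pos.2 (by linarith)
  have hpi : (Real.pi : ℂ) ≠ 0 := by exact_mod_cast Real.pi_ne_zero
  have hz : ((m * √(-σ) : ℝ) : ℂ) ≠ 0 := by exact_mod_cast (mul_pos hm hs).ne'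
  have e : -((m * √(-σ) : ℝ) : ℂ) ^ 2 = ((m ^ 2 * σ : ℝ) : ℂ) := by
    rw [← Complex.ofReal_pow, mul_pow, Real.sq_sqrt (by linarith)]
    push_cast; ring
  have hl : Complex.log (((m * √(-σ) : ℝ) : ℂ) / 2) =
      (Real.log m : ℂ) + Real.log |σ| / 2 - Real.log 2 := by
    have : ((m * √(-σ) : ℝ) : ℂ) / 2 = ((m * √(-σ) / 2 : ℝ) : ℂ) := by push_cast; ring
    rw [this, ← Complex.ofReal_log (by positivity), Real.log_div (mul_pos hm hs).ne' (by norm_num),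
      Real.log_mul hm.ne' hs.ne', Real.log_sqrt (by linarith), abs_of_neg hσ]
    push_cast; ring
  rw [hankelForm_eq m hz, e, hl, boundaryKernel_eq hm hσ.ne (log_neg_I_mul_of_neg hσ), besselConst]
  push_cast
  field_simp
  linear_combination 16 * (m : ℂ) ^ 2 * Real.pi * coneSum (m ^ 2 * σ) * Complex.I_sq

/-- On the negative imaginary axis the principal `log (z / 2)` has phase `-π/2`. Its contribution
cancels the `J_1` term of `hankelForm_eq`, so the value is purely imaginary. -/
theorem boundaryKernel_of_pos {m σ : ℝ} (hm : 0 < m) (hσ : 0 < σ) :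
    boundaryKernel m σ = hankelForm m (-Complex.I * ((m * √σ : ℝ) : ℂ)) := by
  have hs : 0 < √σ := Real.sqrt_pos.2 hσ
  have hpi : (Real.pi : ℂ) ≠ 0 := by exact_mod_cast Real.pi_ne_zero
  have hz0 : ((m * √σ : ℝ) : ℂ) ≠ 0 := by exact_mod_cast (mul_pos hm hs).ne'
  have hz : -Complex.I * ((m * √σ : ℝ) : ℂ) ≠ 0 := mul_ne_zero (neg_ne_zero.2 Complex.I_ne_zero) hz0
  have e : -(-Complex.I * ((m * √σ : ℝ) : ℂ)) ^ 2 = ((m ^ 2 * σ : ℝ) : ℂ) := by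
    rw [mul_pow, ← Complex.ofReal_pow, mul_pow m, Real.sq_sqrt hσ.le, neg_sq, Complex.I_sq]
    push_cast; ring
  have hl : Complex.log (-Complex.I * ((m * √σ : ℝ) : ℂ) / 2) =
      (Real.log m : ℂ) + Real.log |σ| / 2 - Real.log 2 - Real.pi / 2 * Complex.I := by
    have : -Complex.I * ((m * √σ : ℝ) : ℂ) / 2 = ((m * √σ / 2 : ℝ) : ℂ) * (-Complex.I) := by
      push_cast; ring
    rw [this, Complex.log_ofReal_mul (by positivity) (neg_ne_zero.2 Complex.I_ne_zero),
      Complex.log_neg_I, Real.log_div (mul_pos hm hs).ne' (by norm_num),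
      Real.log_mul hm.ne' hs.ne', Real.log_sqrt hσ.le, abs_of_pos hσ]
    push_cast; ring
  rw [hankelForm_eq m hz, e, hl, boundaryKernel_eq hm hσ.ne' (log_neg_I_mul_of_pos hσ), besselConst]
  push_cast
  field_simp
  linear_combination 16 * (m : ℂ) ^ 2 * Real.pi * coneSum (m ^ 2 * σ) * Complex.I_sq

end

noncomputable section

/-! ### Bound for the regular part of the kernel -/

theorem norm_exp_neg_mul_sub_one_le {A : ℂ} (hA : 0 ≤ A.re) {s : ℝ} (hs : 0 ≤ s) :
    ‖Complex.exp (-(A * s)) - 1‖ ≤ 2 * (‖A‖ * s) := by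
  have hn : ‖-(A * (s : ℂ))‖ = ‖A‖ * s := by
    rw [norm_neg, norm_mul, Complex.norm_real, Real.norm_of_nonneg hs]
  rcases le_total (‖A‖ * s) 1 with h | h
  · have := Complex.norm_exp_sub_one_le (x := -(A * (s : ℂ))) (by rwa [hn])
    rwa [hn] at this
  · have h1 : ‖Complex.exp (-(A * s))‖ ≤ 1 := by
      rw [Complex.norm_exp, Real.exp_le_one_iff]
      simp only [Complex.neg_re, Complex.re_mul_ofReal]
      have := mul_nonneg hA hs
      linarith
    calc _ ≤ ‖Complex.exp (-(A * s))‖ + ‖(1 : ℂ)‖ := norm_sub_le _ _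
      _ ≤ 1 + 1 := by rw [norm_one]; gcongr
      _ ≤ _ := by linarith

theorem norm_exp_neg_mul_le_one {A : ℂ} (hA : 0 ≤ A.re) {s : ℝ} (hs : 0 ≤ s) :
    ‖Complex.exp (-(A * s))‖ ≤ 1 := by
  rw [Complex.norm_exp, Real.exp_le_one_iff]
  simp only [Complex.neg_re, Complex.re_mul_ofReal]
  have := mul_nonneg hA hs
  linarith

/-- The primitive `(4 / B) e^{-B / (4 s)}` of `s⁻² e^{-B / (4 s)}`. -/
def inversePrimitive (B : ℂ) (s : ℝ) : ℂ := 4 / B * Complex.exp (-(B / (4 * s)))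

theorem hasDerivAt_inversePrimitive {B : ℂ} (hB : B ≠ 0) {s : ℝ} (hs : s ≠ 0) :
    HasDerivAt (inversePrimitive B) (besselIntegrand 2 0 B s) s := by
  have hsc : (s : ℂ) ≠ 0 := by exact_mod_cast hs
  have h1 : HasDerivAt (fun w : ℂ => -(B / 4 * w⁻¹)) (-(B / 4 * (-((s : ℂ) ^ 2)⁻¹))) (s : ℂ) :=
    ((hasDerivAt_inv hsc).const_mul (B / 4)).neg
  have h2 := ((h1.cexp).const_mul (4 / B)).comp_ofReal
  have e : inversePrimitive B = fun y : ℝ => 4 / B * Complex.exp (-(B / 4 * ((y : ℂ))⁻¹)) := by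
    ext y; rw [inversePrimitive, div_mul_eq_div_div, div_eq_mul_inv (B / 4)]
  rw [e]
  refine h2.congr_deriv ?_
  rw [besselIntegrand, zero_mul, zero_add, div_mul_eq_div_div, div_eq_mul_inv (B / 4) (s : ℂ), inv_pow]
  field_simp

theorem norm_inversePrimitive (B : ℂ) (s : ℝ) :
    ‖inversePrimitive B s‖ = 4 / ‖B‖ * Real.exp (-(B.re / (4 * s))) := by
  rw [inversePrimitive, norm_mul, norm_div, Complex.norm_exp]
  have : B / (4 * (s : ℂ)) = B * (((4 * s)⁻¹ : ℝ) : ℂ) := by push_cast; rw [div_eq_mul_inv]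
  rw [this, Complex.neg_re, Complex.re_mul_ofReal, div_eq_mul_inv B.re]
  norm_num

theorem tendsto_inversePrimitive_zero {B : ℂ} (hB : 0 < B.re) :
    Tendsto (inversePrimitive B) (𝓝[>] 0) (𝓝 0) := by
  have h0 : Tendsto (fun s : ℝ => 4 / ‖B‖ * (4 / B.re * s)) (𝓝[>] 0) (𝓝 0) := by
    have : Tendsto (fun s : ℝ => 4 / ‖B‖ * (4 / B.re * s)) (𝓝 0) (𝓝 (4 / ‖B‖ * (4 / B.re * 0))) :=
      (continuous_const.mul (continuous_const.mul continuous_id)).tendsto 0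
    rw [mul_zero, mul_zero] at this
    exact this.mono_left nhdsWithin_le_nhds
  refine squeeze_zero_norm' ?_ h0
  filter_upwards [self_mem_nhdsWithin] with s hs
  have hs : 0 < s := hs
  rw [norm_inversePrimitive]
  have h := inv_pow_mul_exp_le 1 hB hs
  rw [pow_one, pow_one, Nat.factorial_one, Nat.cast_one, one_mul, inv_mul_le_iff₀ hs] at h
  gcongr
  linarith

theorem tendsto_inversePrimitive_atTop (B : ℂ) :
    Tendsto (inversePrimitive B) atTop (𝓝 (4 / B)) := by
  have h1 : Tendsto (fun s : ℝ => B / 4 * (((s⁻¹ : ℝ)) : ℂ)) atTop (𝓝 (B / 4 * ((0 : ℝ) : ℂ))) :=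
    ((Complex.continuous_ofReal.tendsto 0).comp tendsto_inv_atTop_zero).const_mul _
  have h2 := ((Complex.continuous_exp.tendsto _).comp h1.neg).const_mul (4 / B)
  simp only [Complex.ofReal_zero, mul_zero, neg_zero, Complex.exp_zero, mul_one] at h2
  refine h2.congr fun s => ?_
  rw [inversePrimitive, div_mul_eq_div_div, div_eq_mul_inv (B / 4)]
  simp

theorem inv_sq_mul_exp_le {b s : ℝ} (hb : 0 < b) (hs : 0 < s) :
    (s⁻¹) ^ 2 * Real.exp (-(b / (4 * s))) ≤ (2 * (4 / b) ^ 2 + 1) * (1 + s ^ 2)⁻¹ := by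
  have h2 := inv_pow_mul_exp_le 2 hb hs
  have h0 : Real.exp (-(b / (4 * s))) ≤ 1 := by
    rw [Real.exp_le_one_iff]
    have : 0 ≤ b / (4 * s) := by positivity
    linarith
  rw [← div_eq_mul_inv, le_div_iff₀ (by positivity)]
  have e : s⁻¹ ^ 2 * s ^ 2 = 1 := by rw [inv_pow, inv_mul_cancel₀ (by positivity)]
  norm_num at h2
  calc _ = s⁻¹ ^ 2 * Real.exp (-(b / (4 * s))) + (s⁻¹ ^ 2 * s ^ 2) * Real.exp (-(b / (4 * s))) := by
        ring
    _ ≤ _ := by rw [e, one_mul]; norm_num; linarith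

theorem integrableOn_besselIntegrand_zero {B : ℂ} (hB : 0 < B.re) :
    IntegrableOn (besselIntegrand 2 0 B) (Set.Ioi 0) := by
  have h := (integrable_inv_one_add_sq.const_mul (2 * (4 / B.re) ^ 2 + 1)).integrableOn
    (s := Set.Ioi (0 : ℝ))
  refine Integrable.mono' h
    ((continuousOn_besselIntegrand 2 0 B).aestronglyMeasurable measurableSet_Ioi) ?_
  refine (ae_restrict_mem measurableSet_Ioi).mono fun s hs => ?_
  rw [norm_besselIntegrand 2 0 B hs, Complex.zero_re, zero_mul, zero_add]
  exact inv_sq_mul_exp_le hB hs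

/-- The case `A = 0` reproduces the leading singularity exactly. Subtracting it writes the remainder
as an integral with the factor `e^{-As} - 1`. -/
theorem integral_besselIntegrand_zero {B : ℂ} (hB : 0 < B.re) :
    ∫ s in Set.Ioi (0 : ℝ), besselIntegrand 2 0 B s = 4 / B := by
  have hne : B ≠ 0 := fun h => by simp [h] at hB
  have h := integral_Ioi_deriv_mul_eq_sub (a := 0) (a' := (0 : ℂ)) (b' := 4 / B)
    (u := inversePrimitive B) (v := fun _ => 1)
    (u' := besselIntegrand 2 0 B) (v' := fun _ => 0)
    (fun s hs => hasDerivAt_inversePrimitive hne (Set.mem_Ioi.1 hs).ne')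
    (fun s _ => hasDerivAt_const s 1) ?_ ?_ ?_
  · simpa using h
  · refine (integrableOn_besselIntegrand_zero hB).congr (Eventually.of_forall fun s => ?_)
    simp
  · have := (tendsto_inversePrimitive_zero hB).mul_const 1
    rwa [zero_mul] at this
  · have := (tendsto_inversePrimitive_atTop B).mul_const 1
    rwa [mul_one] at this

theorem besselIntegrand_eq_exp_mul (k : ℕ) (A B : ℂ) (s : ℝ) :
    besselIntegrand k A B s = Complex.exp (-(A * s)) * besselIntegrand k 0 B s := by
  rw [besselIntegrand, besselIntegrand, zero_mul, zero_add, neg_add, Complex.exp_add]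
  ring

/-- The bound depends on `‖B‖` and not on `Re B`, which tends to zero at the boundary, and it does
not grow with `‖B‖`, which an estimate of the two power series term by term would not give. The
integral of `(e^{-As} - 1) s⁻² e^{-B/(4s)}` is cut at `c` and `1`. Below `c` the oscillation of
`e^{-B/(4s)}` is used through its primitive of size `4/‖B‖`; on `[c, 1]` the integrand is at most
`2‖A‖/s`, and beyond `1` at most `2/s²`. -/
theorem norm_besselRemainder_le {A B : ℂ} (hA : 0 < A.re) (hB : 0 < B.re) {c : ℝ} (hc : 0 < c)
    (hc1 : c ≤ 1) (hcB : c ≤ ‖B‖) :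
    ‖besselRemainder A B‖ ≤ 12 * ‖A‖ + 2 * ‖A‖ * Real.log (1 / c) + 2 := by
  have hne : B ≠ 0 := fun h => by simp [h] at hB
  have hBn : 0 < ‖B‖ := norm_pos_iff.2 hne
  set g : ℝ → ℂ := fun s => (Complex.exp (-(A * s)) - 1) * besselIntegrand 2 0 B s with hg
  have hi : IntegrableOn g (Set.Ioi 0) := by
    refine ((integrableOn_besselIntegrand 2 hA hB).sub
      (integrableOn_besselIntegrand_zero hB)).congr (Eventually.of_forall fun s => ?_)
    simp only [Pi.sub_apply, hg]
    rw [besselIntegrand_eq_exp_mul 2 A B]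
    ring
  have hR : besselRemainder A B = ∫ s in Set.Ioi (0 : ℝ), g s := by
    have h1 := besselIntegral_two_eq hA hB
    have h2 : ∫ s in Set.Ioi (0 : ℝ), g s = besselIntegral 2 A B - 4 / B := by
      rw [← integral_besselIntegrand_zero hB, besselIntegral,
        ← integral_sub (integrableOn_besselIntegrand 2 hA hB) (integrableOn_besselIntegrand_zero hB)]
      refine integral_congr_ae (Eventually.of_forall fun s => ?_)
      simp only [hg]
      rw [besselIntegrand_eq_exp_mul 2 A B]
      ring
    rw [h2, h1]; ring
  have hgn : ∀ s : ℝ, 0 < s → ‖besselIntegrand 2 0 B s‖ ≤ (s ^ 2)⁻¹ := fun s hs => by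
    rw [norm_besselIntegrand 2 0 B hs, Complex.zero_re, zero_mul, zero_add, inv_pow]
    have : Real.exp (-(B.re / (4 * s))) ≤ 1 := by
      rw [Real.exp_le_one_iff]
      have : 0 ≤ B.re / (4 * s) := by positivity
      linarith
    exact mul_le_of_le_one_right (by positivity) this
  have hpn : ∀ s : ℝ, 0 < s → ‖inversePrimitive B s‖ ≤ 4 / ‖B‖ := fun s hs => by
    rw [norm_inversePrimitive]
    have : Real.exp (-(B.re / (4 * s))) ≤ 1 := by
      rw [Real.exp_le_one_iff]
      have : 0 ≤ B.re / (4 * s) := by positivity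
      linarith
    exact mul_le_of_le_one_right (by positivity) this
  -- the part near the origin, by partial integration
  have p1 : ‖∫ s in (0 : ℝ)..c, g s‖ ≤ 12 * ‖A‖ := by
    have hexp : Continuous fun s : ℝ => Complex.exp (-(A * s)) := by fun_prop
    have hii : IntervalIntegrable g volume 0 c :=
      (intervalIntegrable_iff_integrableOn_Ioc_of_le hc.le).2 (hi.mono_set Set.Ioc_subset_Ioi_self)
    have hbd : ∀ s ∈ Set.Ioc (0 : ℝ) c,
        ‖-A * Complex.exp (-(A * s)) * inversePrimitive B s‖ ≤ ‖A‖ * (4 / ‖B‖) := fun s hs => by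
      rw [norm_mul, norm_mul, norm_neg]
      have h1 := norm_exp_neg_mul_le_one hA.le hs.1.le
      have h2 := hpn s hs.1
      calc _ ≤ ‖A‖ * 1 * (4 / ‖B‖) := by gcongr
        _ = _ := by ring
    have hi2 : IntervalIntegrable (fun s : ℝ => -A * Complex.exp (-(A * s)) * inversePrimitive B s)
        volume 0 c := by
      rw [intervalIntegrable_iff_integrableOn_Ioc_of_le hc.le]
      refine Measure.integrableOn_of_bounded (M := ‖A‖ * (4 / ‖B‖)) (by simp) ?_ ?_
      · exact Measurable.aestronglyMeasurable (by unfold inversePrimitive; fun_prop)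
      · exact (ae_restrict_mem measurableSet_Ioc).mono hbd
    have hd : ∀ s ∈ Set.Ioo (0 : ℝ) c, HasDerivAt
        (fun s : ℝ => (Complex.exp (-(A * s)) - 1) * inversePrimitive B s)
        (-A * Complex.exp (-(A * s)) * inversePrimitive B s + g s) s := fun s hs => by
      have h1 : HasDerivAt (fun w : ℂ => -(A * w)) (-(A * 1)) (s : ℂ) :=
        ((hasDerivAt_id _).const_mul A).neg
      have h2 := (h1.cexp.comp_ofReal.sub_const 1).mul (hasDerivAt_inversePrimitive hne hs.1.ne')
      refine h2.congr_deriv ?_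
      simp only [hg]
      ring
    have t0 : Tendsto (fun s : ℝ => (Complex.exp (-(A * s)) - 1) * inversePrimitive B s)
        (𝓝[>] 0) (𝓝 0) := by
      have := ((hexp.tendsto 0).mono_left nhdsWithin_le_nhds).sub_const 1 |>.mul
        (tendsto_inversePrimitive_zero hB)
      simpa using this
    have t1 : Tendsto (fun s : ℝ => (Complex.exp (-(A * s)) - 1) * inversePrimitive B s)
        (𝓝[<] c) (𝓝 ((Complex.exp (-(A * c)) - 1) * inversePrimitive B c)) := by
      exact (((hexp.tendsto c).sub_const 1).mul
        (hasDerivAt_inversePrimitive hne hc.ne').continuousAt.tendsto).mono_left nhdsWithin_le_nhds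
    have h := intervalIntegral.integral_eq_sub_of_hasDerivAt_of_tendsto hc hd (hi2.add hii) t0 t1
    rw [intervalIntegral.integral_add hi2 hii, sub_zero] at h
    have h' : ∫ s in (0 : ℝ)..c, g s = (Complex.exp (-(A * c)) - 1) * inversePrimitive B c -
        ∫ s in (0 : ℝ)..c, -A * Complex.exp (-(A * s)) * inversePrimitive B s := by
      rw [← h]; ring
    have b1 : ‖(Complex.exp (-(A * c)) - 1) * inversePrimitive B c‖ ≤ 2 * (‖A‖ * c) * (4 / ‖B‖) := by
      rw [norm_mul]
      have h1 := norm_exp_neg_mul_sub_one_le hA.le hc.le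
      have h2 := hpn c hc
      gcongr
    have b2 : ‖∫ s in (0 : ℝ)..c, -A * Complex.exp (-(A * s)) * inversePrimitive B s‖ ≤
        ‖A‖ * (4 / ‖B‖) * |c - 0| := by
      refine intervalIntegral.norm_integral_le_of_norm_le_const fun s hs => ?_
      rw [Set.uIoc_of_le hc.le] at hs
      exact hbd s hs
    rw [sub_zero, abs_of_pos hc] at b2
    rw [h']
    -- Here `c ≤ ‖B‖` enters. The boundary term contributes `8‖A‖` and the remaining integral
    -- `4‖A‖`.
    have hq : c * (4 / ‖B‖) ≤ 4 := by
      rw [mul_div_assoc', div_le_iff₀ hBn]; linarith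
    have hAn := norm_nonneg A
    calc _ ≤ _ := norm_sub_le _ _
      _ ≤ 2 * (‖A‖ * c) * (4 / ‖B‖) + ‖A‖ * (4 / ‖B‖) * c := add_le_add b1 b2
      _ = 3 * ‖A‖ * (c * (4 / ‖B‖)) := by ring
      _ ≤ 3 * ‖A‖ * 4 := by gcongr
      _ = _ := by ring
  have p2 : ‖∫ s in c..1, g s‖ ≤ 2 * ‖A‖ * Real.log (1 / c) := by
    have hb : IntervalIntegrable (fun s : ℝ => 2 * ‖A‖ * s⁻¹) volume c 1 := by
      refine (ContinuousOn.intervalIntegrable ?_)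
      rw [Set.uIcc_of_le hc1]
      exact continuousOn_const.mul (continuousOn_id.inv₀ fun s hs => (hc.trans_le hs.1).ne')
    have h := intervalIntegral.norm_integral_le_of_norm_le hc1 (f := g) (μ := volume)
      (g := fun s : ℝ => 2 * ‖A‖ * s⁻¹) (Eventually.of_forall fun s hs => ?_) hb
    · rw [intervalIntegral.integral_const_mul, integral_inv_of_pos hc one_pos] at h
      exact h
    · have hs0 : 0 < s := hc.trans hs.1
      simp only [hg]
      rw [norm_mul]
      have h1 := norm_exp_neg_mul_sub_one_le hA.le hs0.le
      have h2 := hgn s hs0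
      calc _ ≤ 2 * (‖A‖ * s) * (s ^ 2)⁻¹ := by gcongr
        _ = _ := by field_simp
  have p3 : ‖∫ s in Set.Ioi (1 : ℝ), g s‖ ≤ 2 := by
    have hb : IntegrableOn (fun s : ℝ => 2 * s ^ (-2 : ℝ)) (Set.Ioi 1) :=
      (integrableOn_Ioi_rpow_of_lt (by norm_num) one_pos).const_mul 2
    have h := norm_integral_le_of_norm_le (f := g) (μ := volume.restrict (Set.Ioi 1)) hb
      ((ae_restrict_mem measurableSet_Ioi).mono fun s hs => ?_)
    · rw [integral_const_mul, integral_Ioi_rpow_of_lt (by norm_num) one_pos] at h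
      norm_num at h
      exact h
    · have hs0 : 0 < s := one_pos.trans hs
      simp only [hg]
      rw [norm_mul]
      have h1 : ‖Complex.exp (-(A * s)) - 1‖ ≤ 2 := by
        calc _ ≤ ‖Complex.exp (-(A * s))‖ + ‖(1 : ℂ)‖ := norm_sub_le _ _
          _ ≤ 1 + 1 := by
              rw [norm_one]
              have := norm_exp_neg_mul_le_one hA.le hs0.le
              gcongr
          _ = 2 := by norm_num
      have h2 := hgn s hs0
      have e : s ^ (-2 : ℝ) = (s ^ 2)⁻¹ := by
        rw [Real.rpow_neg hs0.le]; norm_num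
      rw [e]
      gcongr
  have i1 : IntervalIntegrable g volume 0 c :=
    (intervalIntegrable_iff_integrableOn_Ioc_of_le hc.le).2 (hi.mono_set Set.Ioc_subset_Ioi_self)
  have i2 : IntervalIntegrable g volume c 1 :=
    (intervalIntegrable_iff_integrableOn_Ioc_of_le hc1).2
      (hi.mono_set fun s hs => hc.trans hs.1)
  have i3 : IntegrableOn g (Set.Ioi 1) := hi.mono_set (Set.Ioi_subset_Ioi zero_le_one)
  have hsplit : ∫ s in Set.Ioi (0 : ℝ), g s =
      (∫ s in (0 : ℝ)..c, g s) + (∫ s in c..1, g s) + ∫ s in Set.Ioi (1 : ℝ), g s := by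
    rw [intervalIntegral.integral_add_adjacent_intervals i1 i2,
      intervalIntegral.integral_of_le zero_le_one, ← setIntegral_union
        (Set.Ioc_disjoint_Ioi le_rfl) measurableSet_Ioi (hi.mono_set Set.Ioc_subset_Ioi_self) i3,
      Set.Ioc_union_Ioi_eq_Ioi zero_le_one]
  rw [hR, hsplit]
  calc _ ≤ _ := norm_add₃_le
    _ ≤ _ := by linarith

end

noncomputable section

/-! ### The smeared plane wave -/

theorem continuous_minkowski : Continuous fun q : Spacetime × Spacetime => minkowski q.1 q.2 := by
  unfold minkowski
  fun_prop

@[fun_prop]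
theorem Continuous.minkowski {X : Type*} [TopologicalSpace X] {f g : X → Spacetime}
    (hf : Continuous f) (hg : Continuous g) : Continuous fun x => minkowski (f x) (g x) :=
  continuous_minkowski.comp (hf.prodMk hg)

@[fun_prop]
theorem Continuous.interval {X : Type*} [TopologicalSpace X] {f : X → Spacetime}
    (hf : Continuous f) (x' : Spacetime) : Continuous fun x => interval (f x) x' := by
  unfold _root_.interval
  fun_prop

/-- The test function `φ` smeared with the plane wave `e^{i p (x - x')}`. -/
def waveTransform (x' : Spacetime) (φ : 𝓢(Spacetime, ℂ)) (p : Spacetime) : ℂ :=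
  ∫ x : Spacetime, Complex.exp (Complex.I * (minkowski p (x - x') : ℂ)) * φ x

/-- The linear change of momenta relating the Minkowski product to the kernel of the Fourier
transform. -/
def momentumEquiv : Spacetime ≃L[ℝ] Spacetime :=
  LinearEquiv.toContinuousLinearEquiv
    { toFun := fun p => !₂[p 0 / (2 * Real.pi), -p 1 / (2 * Real.pi), -p 2 / (2 * Real.pi),
        -p 3 / (2 * Real.pi)]
      invFun := fun p => !₂[2 * Real.pi * p 0, -(2 * Real.pi * p 1), -(2 * Real.pi * p 2),
        -(2 * Real.pi * p 3)]
      map_add' := fun p q => by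
        ext i; fin_cases i <;> simp <;> ring
      map_smul' := fun c p => by
        ext i; fin_cases i <;> simp <;> ring
      left_inv := fun p => by
        have := Real.pi_ne_zero
        ext i; fin_cases i <;> simp <;> field_simp
      right_inv := fun p => by
        have := Real.pi_ne_zero
        ext i; fin_cases i <;> simp }

theorem inner_momentumEquiv (x p : Spacetime) :
    -2 * Real.pi * inner ℝ x (momentumEquiv p) = minkowski p x := by
  have := Real.pi_ne_zero
  have e : ∀ i, momentumEquiv p i = (!₂[p 0 / (2 * Real.pi), -p 1 / (2 * Real.pi),
    -p 2 / (2 * Real.pi), -p 3 / (2 * Real.pi)] : Spacetime) i := fun i => rfl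
  rw [PiLp.inner_apply, Fin.sum_univ_four]
  simp only [e, minkowski]
  simp
  field_simp
  ring

theorem minkowski_sub_right (p x y : Spacetime) :
    minkowski p (x - y) = minkowski p x - minkowski p y := by
  simp only [minkowski, PiLp.sub_apply]
  ring

/-- The Schwartz function whose modulus is that of `waveTransform x' φ`. -/
def waveSchwartz : 𝓢(Spacetime, ℂ) →L[ℂ] 𝓢(Spacetime, ℂ) :=
  (SchwartzMap.compCLMOfContinuousLinearEquiv ℂ momentumEquiv).comp
    (SchwartzMap.fourierTransformCLM ℂ)

theorem waveTransform_eq (x' : Spacetime) (φ : 𝓢(Spacetime, ℂ)) (p : Spacetime) :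
    waveTransform x' φ p =
      Complex.exp (-(Complex.I * (minkowski p x' : ℂ))) * waveSchwartz φ p := by
  have h : waveSchwartz φ p = FourierTransform.fourier (φ : Spacetime → ℂ) (momentumEquiv p) := rfl
  rw [h, Real.fourier_eq', waveTransform, ← integral_const_mul]
  refine integral_congr_ae (Eventually.of_forall fun x => ?_)
  simp only [inner_momentumEquiv, smul_eq_mul]
  rw [← mul_assoc, ← Complex.exp_add, minkowski_sub_right]
  congr 2
  push_cast
  ring

theorem norm_cexp_neg_I_mul (r : ℝ) : ‖Complex.exp (-(Complex.I * (r : ℂ)))‖ = 1 := by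
  rw [Complex.norm_exp]; simp

theorem norm_cexp_I_mul (r : ℝ) : ‖Complex.exp (Complex.I * (r : ℂ))‖ = 1 := by
  rw [Complex.norm_exp]; simp

theorem norm_waveTransform (x' : Spacetime) (φ : 𝓢(Spacetime, ℂ)) (p : Spacetime) :
    ‖waveTransform x' φ p‖ = ‖waveSchwartz φ p‖ := by
  rw [waveTransform_eq, norm_mul, norm_cexp_neg_I_mul, one_mul]

theorem continuous_waveTransform (x' : Spacetime) (φ : 𝓢(Spacetime, ℂ)) :
    Continuous (waveTransform x' φ) := by
  have h : waveTransform x' φ = fun p =>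
      Complex.exp (-(Complex.I * (minkowski p x' : ℂ))) * waveSchwartz φ p :=
    funext fun p => waveTransform_eq x' φ p
  rw [h]
  have := (waveSchwartz φ).continuous
  fun_prop

theorem integrable_waveTransform (x' : Spacetime) (φ : 𝓢(Spacetime, ℂ)) :
    Integrable (waveTransform x' φ) := by
  refine ((waveSchwartz φ).integrable (μ := volume)).mono
    (continuous_waveTransform x' φ).aestronglyMeasurable (Eventually.of_forall fun p => ?_)
  rw [norm_waveTransform]

/-! ### The Gaussian integral -/

/-- The quadratic form of the regularised Gaussian. -/
def gaussForm (s τ : ℝ) : Fin 4 → ℂ :=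
  ![τ - Complex.I * s, τ + Complex.I * s, τ + Complex.I * s, τ + Complex.I * s]

theorem gaussForm_re (s τ : ℝ) (i : Fin 4) : (gaussForm s τ i).re = τ := by
  fin_cases i <;> simp [gaussForm]

theorem gaussForm_ne_zero {s : ℝ} (hs : s ≠ 0) (τ : ℝ) (i : Fin 4) : gaussForm s τ i ≠ 0 := by
  intro h
  have h2 := congrArg Complex.im h
  fin_cases i <;> simp [gaussForm, hs] at h2

theorem continuous_gaussForm (s : ℝ) (i : Fin 4) : Continuous fun τ => gaussForm s τ i := by
  fin_cases i <;> simp [gaussForm] <;> fun_prop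

/-- The regularised Gaussian `e^{-i s p² - τ |p|²}`. -/
def gaussWeight (s τ : ℝ) (p : Spacetime) : ℂ :=
  Complex.exp (-∑ i, gaussForm s τ i * (p i : ℂ) ^ 2)

theorem gaussWeight_eq (s τ : ℝ) (p : Spacetime) :
    gaussWeight s τ p = Complex.exp (-(τ * (∑ i, p i ^ 2 : ℝ) : ℝ)) *
      Complex.exp (-(Complex.I * ((s * minkowski p p : ℝ) : ℂ))) := by
  rw [gaussWeight, ← Complex.exp_add, Fin.sum_univ_four, Fin.sum_univ_four]
  simp only [gaussForm, minkowski, Matrix.cons_val]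
  congr 1
  push_cast
  ring

theorem norm_gaussWeight (s τ : ℝ) (p : Spacetime) :
    ‖gaussWeight s τ p‖ = Real.exp (-(τ * ∑ i, p i ^ 2)) := by
  rw [gaussWeight_eq, norm_mul, norm_cexp_neg_I_mul, mul_one, Complex.norm_exp, Complex.neg_re,
    Complex.ofReal_re]

theorem norm_gaussWeight_le (s : ℝ) {τ : ℝ} (hτ : 0 ≤ τ) (p : Spacetime) :
    ‖gaussWeight s τ p‖ ≤ 1 := by
  rw [norm_gaussWeight, Real.exp_le_one_iff]
  have : 0 ≤ ∑ i, p i ^ 2 := Finset.sum_nonneg fun i _ => sq_nonneg _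
  nlinarith

theorem gaussWeight_zero (s : ℝ) (p : Spacetime) :
    gaussWeight s 0 p = Complex.exp (-(Complex.I * ((s * minkowski p p : ℝ) : ℂ))) := by
  rw [gaussWeight_eq]; simp

theorem continuous_gaussWeight (s τ : ℝ) : Continuous (gaussWeight s τ) := by
  unfold gaussWeight
  fun_prop

theorem integrable_gaussWeight (s : ℝ) {τ : ℝ} (hτ : 0 < τ) : Integrable (gaussWeight s τ) := by
  rw [← (PiLp.volume_preserving_toLp (Fin 4)).integrable_comp_emb
    (MeasurableEquiv.toLp 2 _).measurableEmbedding]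
  have h := GaussianFourier.integrable_cexp_neg_sum_mul_add (b := gaussForm s τ)
    (fun i => by rw [gaussForm_re]; exact hτ) 0
  refine h.congr (Eventually.of_forall fun v => ?_)
  simp [gaussWeight]

/-- The Fourier transform of the regularised Gaussian. -/
def gaussTransform (s τ : ℝ) (y : Spacetime) : ℂ :=
  ∏ i, (Real.pi / gaussForm s τ i) ^ (1 / 2 : ℂ) *
    Complex.exp (-((y i : ℂ) ^ 2 / (4 * gaussForm s τ i)))

theorem integral_gaussWeight_mul (s : ℝ) {τ : ℝ} (hτ : 0 < τ) (y : Spacetime) :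
    ∫ p : Spacetime, gaussWeight s τ p * Complex.exp (Complex.I * (minkowski p y : ℂ)) =
      gaussTransform s τ y := by
  rw [← (PiLp.volume_preserving_toLp (Fin 4)).integral_comp
    (MeasurableEquiv.toLp 2 _).measurableEmbedding]
  have h := GaussianFourier.integral_cexp_neg_sum_mul_add (b := gaussForm s τ)
    (fun i => by rw [gaussForm_re]; exact hτ)
    ![-(Complex.I * y 0), Complex.I * y 1, Complex.I * y 2, Complex.I * y 3]
  convert h using 1
  · refine integral_congr_ae (Eventually.of_forall fun v => ?_)
    simp only [gaussWeight]
    rw [← Complex.exp_add]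
    congr 2
    rw [Fin.sum_univ_four]
    simp [minkowski]
    ring
  · rw [gaussTransform]
    refine Finset.prod_congr rfl fun i _ => ?_
    congr 2
    fin_cases i <;> simp [mul_pow, neg_div]

/-- The amplitude `∫ φ(x) s⁻² e^{i (x - x')² / (4 s)} dx` of the proper-time representation. -/
def properTimeAmplitude (x' : Spacetime) (φ : 𝓢(Spacetime, ℂ)) (s : ℝ) : ℂ :=
  ∫ x : Spacetime, φ x * (1 / (s : ℂ) ^ 2 *
    Complex.exp (Complex.I * ((interval x x' / (4 * s) : ℝ) : ℂ)))

theorem integral_gaussWeight_mul_waveTransform (x' : Spacetime) (φ : 𝓢(Spacetime, ℂ)) (s : ℝ)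
    {τ : ℝ} (hτ : 0 < τ) :
    ∫ p : Spacetime, gaussWeight s τ p * waveTransform x' φ p =
      ∫ x : Spacetime, φ x * gaussTransform s τ (x - x') := by
  have hswap := integral_integral_swap (μ := (volume : Measure Spacetime))
    (ν := (volume : Measure Spacetime))
    (f := fun p x => gaussWeight s τ p * Complex.exp (Complex.I * (minkowski p (x - x') : ℂ)) * φ x)
    ?_
  · calc _ = ∫ p : Spacetime, ∫ x : Spacetime,
          gaussWeight s τ p * Complex.exp (Complex.I * (minkowski p (x - x') : ℂ)) * φ x := by
          refine integral_congr_ae (Eventually.of_forall fun p => ?_)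
          simp only [waveTransform]
          rw [← integral_const_mul]
          simp only [mul_assoc]
      _ = _ := by
          rw [hswap]
          refine integral_congr_ae (Eventually.of_forall fun x => ?_)
          simp only []
          rw [integral_mul_const, integral_gaussWeight_mul s hτ, mul_comm]
  · have h := (integrable_gaussWeight s hτ).mul_prod (φ.integrable (μ := volume))
    refine h.mono ?_ (Eventually.of_forall fun q => ?_)
    · have h1 := continuous_gaussWeight s τ
      have h2 := φ.continuous
      refine Continuous.aestronglyMeasurable ?_
      simp only [Function.uncurry_def]
      fun_prop
    · simp only [Function.uncurry_def]
      rw [norm_mul, norm_mul, norm_mul, norm_cexp_I_mul, mul_one]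

theorem norm_exp_neg_sq_div_le {b : ℂ} (hb : 0 ≤ b.re) (y : ℝ) :
    ‖Complex.exp (-((y : ℂ) ^ 2 / (4 * b)))‖ ≤ 1 := by
  rw [Complex.norm_exp, Real.exp_le_one_iff]
  have e : -((y : ℂ) ^ 2 / (4 * b)) = ((-(y ^ 2 / 4) : ℝ) : ℂ) * b⁻¹ := by
    push_cast
    rw [div_mul_eq_div_div, div_eq_mul_inv (_ / 4)]
    ring
  rw [e, Complex.re_ofReal_mul, Complex.inv_re]
  have h1 : 0 ≤ b.re / Complex.normSq b := div_nonneg hb (Complex.normSq_nonneg b)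
  have h2 : 0 ≤ y ^ 2 / 4 := by positivity
  nlinarith [mul_nonneg h2 h1]

/-- At `τ = 0` these quotients are purely imaginary and nonzero, off the cut of the square root, so
the Gaussian prefactors are continuous as `τ → 0`. -/
theorem pi_div_gaussForm_zero_mem {s : ℝ} (hs : s ≠ 0) (i : Fin 4) :
    (Real.pi : ℂ) / gaussForm s 0 i ∈ Complex.slitPlane := by
  have hpi := Real.pi_ne_zero
  have h1 : (Real.pi : ℂ) / (-(Complex.I * s)) = Complex.I * ((Real.pi / s : ℝ) : ℂ) := by
    have : (s : ℂ) ≠ 0 := by exact_mod_cast hs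
    push_cast
    field_simp
    simp
  have h2 : (Real.pi : ℂ) / (Complex.I * s) = Complex.I * ((-(Real.pi / s) : ℝ) : ℂ) := by
    have h1' := congrArg Neg.neg h1
    rw [div_neg, neg_neg] at h1'
    rw [h1']
    push_cast; ring
  have m1 := I_mul_ofReal_mem_slitPlane (x := Real.pi / s) (by positivity)
  have m2 := I_mul_ofReal_mem_slitPlane (x := -(Real.pi / s)) (neg_ne_zero.2 (by positivity))
  rw [← h1] at m1
  rw [← h2] at m2
  fin_cases i <;> simpa [gaussForm]

theorem gaussTransform_eq (s τ : ℝ) (y : Spacetime) :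
    gaussTransform s τ y = (∏ i, (Real.pi / gaussForm s τ i) ^ (1 / 2 : ℂ)) *
      ∏ i, Complex.exp (-((y i : ℂ) ^ 2 / (4 * gaussForm s τ i))) := by
  rw [gaussTransform, Finset.prod_mul_distrib]

/-- The time direction contributes the phase `e^{iπ/4}` and each of the three space directions
`e^{-iπ/4}`; together they give `-i`. -/
theorem prod_gaussForm_zero {s : ℝ} (hs : 0 < s) :
    ∏ i, ((Real.pi : ℂ) / gaussForm s 0 i) ^ (1 / 2 : ℂ) =
      -Complex.I * (Real.pi : ℂ) ^ 2 / (s : ℂ) ^ 2 := by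
  have hsc : (s : ℂ) ≠ 0 := by exact_mod_cast hs.ne'
  have hq : 0 < Real.pi / s := div_pos Real.pi_pos hs
  set r := Real.pi / s with hr
  have hrc : (r : ℂ) ≠ 0 := by exact_mod_cast hq.ne'
  have e1 : (Real.pi : ℂ) / (-(Complex.I * s)) = (r : ℂ) * Complex.I := by
    rw [hr]; push_cast; field_simp; simp
  have e2 : (Real.pi : ℂ) / (Complex.I * s) = (r : ℂ) * (-Complex.I) := by
    have h1' := congrArg Neg.neg e1
    rw [div_neg, neg_neg] at h1'
    rw [h1']; ring
  have hI := Complex.I_ne_zero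
  rw [Fin.prod_univ_four]
  simp only [gaussForm, Matrix.cons_val, Complex.ofReal_zero, zero_sub, zero_add]
  rw [e1, e2]
  have c1 : ((r : ℂ) * Complex.I) ^ (1 / 2 : ℂ) * ((r : ℂ) * (-Complex.I)) ^ (1 / 2 : ℂ) = r := by
    rw [Complex.cpow_def_of_ne_zero (mul_ne_zero hrc hI),
      Complex.cpow_def_of_ne_zero (mul_ne_zero hrc (neg_ne_zero.2 hI)), ← Complex.exp_add,
      Complex.log_ofReal_mul hq hI, Complex.log_ofReal_mul hq (neg_ne_zero.2 hI), Complex.log_I,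
      Complex.log_neg_I]
    rw [show ((Real.log r : ℂ) + Real.pi / 2 * Complex.I) * (1 / 2) +
      ((Real.log r : ℂ) + -(Real.pi / 2) * Complex.I) * (1 / 2) = (Real.log r : ℂ) by ring,
      ← Complex.ofReal_exp, Real.exp_log hq]
  have c2 : ((r : ℂ) * (-Complex.I)) ^ (1 / 2 : ℂ) * ((r : ℂ) * (-Complex.I)) ^ (1 / 2 : ℂ) =
      r * (-Complex.I) := by
    rw [← Complex.cpow_add _ _ (mul_ne_zero hrc (neg_ne_zero.2 hI))]
    norm_num
  rw [mul_assoc, c1, c2, hr]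
  push_cast
  ring

theorem prod_exp_gaussForm_zero {s : ℝ} (hs : 0 < s) (x x' : Spacetime) :
    ∏ i, Complex.exp (-((((x - x') i : ℝ) : ℂ) ^ 2 / (4 * gaussForm s 0 i))) =
      Complex.exp (Complex.I * ((interval x x' / (4 * s) : ℝ) : ℂ)) := by
  have hsc : (s : ℂ) ≠ 0 := by exact_mod_cast hs.ne'
  rw [← Complex.exp_sum, Fin.sum_univ_four]
  congr 1
  simp only [gaussForm, Matrix.cons_val, Complex.ofReal_zero, zero_sub, zero_add, interval, minkowski]
  have hI : Complex.I ^ 2 = -1 := Complex.I_sq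
  push_cast
  field_simp
  linear_combination (((x - x') 0 : ℂ) ^ 2 - ((x - x') 1 : ℂ) ^ 2 - ((x - x') 2 : ℂ) ^ 2 -
    ((x - x') 3 : ℂ) ^ 2) * hI

/-- The oscillating Gaussian integral, smeared with a test function. -/
theorem integral_exp_mul_waveTransform (x' : Spacetime) (φ : 𝓢(Spacetime, ℂ)) {s : ℝ} (hs : 0 < s) :
    ∫ p : Spacetime, Complex.exp (-(Complex.I * ((s * minkowski p p : ℝ) : ℂ))) *
      waveTransform x' φ p = -Complex.I * (Real.pi : ℂ) ^ 2 * properTimeAmplitude x' φ s := by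
  -- The damping `e^{-τ|p|²}` makes Fubini available. The limit `τ → 0` is then taken in momentum
  -- space, here, and in position space, in `t4`.
  have t1 : Tendsto (fun τ : ℝ => ∫ p : Spacetime, gaussWeight s τ p * waveTransform x' φ p)
      (𝓝[>] 0) (𝓝 (∫ p : Spacetime, gaussWeight s 0 p * waveTransform x' φ p)) := by
    refine tendsto_integral_filter_of_dominated_convergence (fun p => ‖waveTransform x' φ p‖) ?_ ?_
      (integrable_waveTransform x' φ).norm ?_
    · exact Eventually.of_forall fun τ =>
        ((continuous_gaussWeight s τ).mul (continuous_waveTransform x' φ)).aestronglyMeasurable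
    · filter_upwards [self_mem_nhdsWithin] with τ hτ
      refine Eventually.of_forall fun p => ?_
      rw [norm_mul]
      exact mul_le_of_le_one_left (norm_nonneg _) (norm_gaussWeight_le s (le_of_lt hτ) p)
    · refine Eventually.of_forall fun p => ?_
      have hc : Continuous fun τ => gaussWeight s τ p * waveTransform x' φ p := by
        unfold gaussWeight
        have := continuous_gaussForm s
        fun_prop
      exact (hc.tendsto 0).mono_left nhdsWithin_le_nhds
  have t2 : Tendsto (fun τ : ℝ => ∏ i, ((Real.pi : ℂ) / gaussForm s τ i) ^ (1 / 2 : ℂ)) (𝓝[>] 0)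
      (𝓝 (∏ i, ((Real.pi : ℂ) / gaussForm s 0 i) ^ (1 / 2 : ℂ))) := by
    refine tendsto_finsetProd _ fun i _ => ?_
    have h1 : ContinuousAt (fun τ => (Real.pi : ℂ) / gaussForm s τ i) 0 :=
      continuousAt_const.div (continuous_gaussForm s i).continuousAt (gaussForm_ne_zero hs.ne' 0 i)
    exact (h1.cpow continuousAt_const (pi_div_gaussForm_zero_mem hs.ne' i)).tendsto.mono_left
      nhdsWithin_le_nhds
  -- Each exponential has modulus at most one for `τ > 0`, so `‖φ‖` dominates.
  have t3 : Tendsto (fun τ : ℝ => ∫ x : Spacetime, φ x *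
      ∏ i, Complex.exp (-((((x - x') i : ℝ) : ℂ) ^ 2 / (4 * gaussForm s τ i)))) (𝓝[>] 0)
      (𝓝 (∫ x : Spacetime, φ x *
        ∏ i, Complex.exp (-((((x - x') i : ℝ) : ℂ) ^ 2 / (4 * gaussForm s 0 i))))) := by
    refine tendsto_integral_filter_of_dominated_convergence (fun x => ‖φ x‖) ?_ ?_
      (φ.integrable (μ := volume)).norm ?_
    · refine Eventually.of_forall fun τ => Continuous.aestronglyMeasurable ?_
      have := φ.continuous
      have h2 : ∀ i, Continuous fun x : Spacetime => (((x - x') i : ℝ) : ℂ) := fun i => by fun_prop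
      refine this.mul (continuous_finsetProd _ fun i _ => ?_)
      exact Complex.continuous_exp.comp (((h2 i).pow 2).div_const _).neg
    · filter_upwards [self_mem_nhdsWithin] with τ hτ
      refine Eventually.of_forall fun x => ?_
      rw [norm_mul, norm_prod]
      refine mul_le_of_le_one_right (norm_nonneg _) (Finset.prod_le_one (fun i _ => norm_nonneg _)
        fun i _ => norm_exp_neg_sq_div_le ?_ _)
      rw [gaussForm_re]; exact le_of_lt hτ
    · refine Eventually.of_forall fun x => ?_
      refine Tendsto.const_mul _ (tendsto_finsetProd _ fun i _ => ?_)
      have h1 : ContinuousAt (fun τ => (((x - x') i : ℝ) : ℂ) ^ 2 / (4 * gaussForm s τ i)) 0 :=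
        continuousAt_const.div (continuousAt_const.mul (continuous_gaussForm s i).continuousAt)
          (mul_ne_zero (by norm_num) (gaussForm_ne_zero hs.ne' 0 i))
      exact ((Complex.continuous_exp.continuousAt.comp h1.neg).tendsto).mono_left nhdsWithin_le_nhds
  have t4 : Tendsto (fun τ : ℝ => ∫ p : Spacetime, gaussWeight s τ p * waveTransform x' φ p)
      (𝓝[>] 0) (𝓝 (-Complex.I * (Real.pi : ℂ) ^ 2 * properTimeAmplitude x' φ s)) := by
    have h := t2.mul t3
    rw [prod_gaussForm_zero hs] at h
    simp only [prod_exp_gaussForm_zero hs] at h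
    have e : -Complex.I * (Real.pi : ℂ) ^ 2 / (s : ℂ) ^ 2 * ∫ x : Spacetime, φ x *
        Complex.exp (Complex.I * ((interval x x' / (4 * s) : ℝ) : ℂ)) =
        -Complex.I * (Real.pi : ℂ) ^ 2 * properTimeAmplitude x' φ s := by
      rw [properTimeAmplitude, ← integral_const_mul, ← integral_const_mul]
      refine integral_congr_ae (Eventually.of_forall fun x => ?_)
      simp only []
      ring
    rw [e] at h
    refine h.congr' ?_
    filter_upwards [self_mem_nhdsWithin] with τ hτ
    rw [integral_gaussWeight_mul_waveTransform x' φ s hτ, ← integral_const_mul]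
    refine integral_congr_ae (Eventually.of_forall fun x => ?_)
    simp only [gaussTransform_eq]
    ring
  have h := tendsto_nhds_unique t1 t4
  simpa only [gaussWeight_zero] using h

end

noncomputable section

/-! ### The proper-time representation of the propagator -/

/-- A continuous bound for the proper-time amplitude. -/
def amplitudeBound (φ : 𝓢(Spacetime, ℂ)) : ℝ :=
  (∫ x : Spacetime, ‖φ x‖) + ∫ p : Spacetime, ‖waveSchwartz φ p‖

/-- Both summands are `L¹` norms of Schwartz functions depending continuously on `φ`. This
continuity is what makes the propagator a tempered distribution. -/
theorem continuous_amplitudeBound : Continuous amplitudeBound := by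
  have h1 : Continuous fun φ : 𝓢(Spacetime, ℂ) => ‖φ.toLp 1 (volume : Measure Spacetime)‖ := by
    fun_prop
  have h2 : Continuous fun φ : 𝓢(Spacetime, ℂ) =>
      ‖(waveSchwartz φ).toLp 1 (volume : Measure Spacetime)‖ :=
    h1.comp waveSchwartz.continuous
  simp only [SchwartzMap.norm_toLp_one] at h1 h2
  exact h1.add h2

theorem amplitudeBound_zero : amplitudeBound 0 = 0 := by
  simp [amplitudeBound]

/-- In position space the explicit `s⁻²` gives decay at large `s`. In momentum space the amplitude
is, up to a constant, a unimodular weight integrated against an integrable function, so it is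
bounded down to `s = 0`. The sum of the two bounds is integrable on the half line. -/
theorem norm_properTimeAmplitude_le (x' : Spacetime) (φ : 𝓢(Spacetime, ℂ)) {s : ℝ} (hs : 0 < s) :
    ‖properTimeAmplitude x' φ s‖ ≤ amplitudeBound φ * (1 + s ^ 2)⁻¹ := by
  have b1 : s ^ 2 * ‖properTimeAmplitude x' φ s‖ ≤ ∫ x : Spacetime, ‖φ x‖ := by
    have h : ‖properTimeAmplitude x' φ s‖ ≤ ∫ x : Spacetime, ‖φ x‖ * (s ^ 2)⁻¹ := by
      refine norm_integral_le_of_norm_le ((φ.integrable (μ := volume)).norm.mul_const _)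
        (Eventually.of_forall fun x => ?_)
      rw [norm_mul, norm_mul, norm_cexp_I_mul, mul_one, norm_div, norm_one, norm_pow,
        Complex.norm_real, Real.norm_of_nonneg hs.le, one_div]
    rw [integral_mul_const, ← div_eq_mul_inv, le_div_iff₀ (by positivity)] at h
    linarith
  have b2 : ‖properTimeAmplitude x' φ s‖ ≤ ∫ p : Spacetime, ‖waveSchwartz φ p‖ := by
    have h := integral_exp_mul_waveTransform x' φ hs
    have h2 : ‖∫ p : Spacetime, Complex.exp (-(Complex.I * ((s * minkowski p p : ℝ) : ℂ))) *
        waveTransform x' φ p‖ ≤ ∫ p : Spacetime, ‖waveSchwartz φ p‖ := by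
      refine norm_integral_le_of_norm_le ((waveSchwartz φ).integrable (μ := volume)).norm
        (Eventually.of_forall fun p => ?_)
      rw [norm_mul, norm_cexp_neg_I_mul, one_mul, norm_waveTransform]
    rw [h, norm_mul, norm_mul, norm_neg, Complex.norm_I, one_mul, norm_pow, Complex.norm_real,
      Real.norm_of_nonneg Real.pi_pos.le] at h2
    -- The factor `π²` from the Gaussian integral only helps and is dropped.
    have h3 : 1 ≤ Real.pi ^ 2 := by nlinarith [Real.pi_gt_three]
    exact (le_mul_of_one_le_left (norm_nonneg _) h3).trans h2
  rw [← div_eq_mul_inv, le_div_iff₀ (by positivity), amplitudeBound]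
  linarith

theorem stronglyMeasurable_properTimeAmplitude (x' : Spacetime) (φ : 𝓢(Spacetime, ℂ)) :
    StronglyMeasurable (properTimeAmplitude x' φ) := by
  unfold properTimeAmplitude
  refine StronglyMeasurable.integral_prod_right (f := fun (s : ℝ) (x : Spacetime) =>
    φ x * (1 / (s : ℂ) ^ 2 * Complex.exp (Complex.I * ((interval x x' / (4 * s) : ℝ) : ℂ)))) ?_
  refine Measurable.stronglyMeasurable ?_
  have h1 : Measurable fun q : ℝ × Spacetime => interval q.2 x' :=
    Continuous.measurable (by fun_prop)
  have h2 : Measurable fun q : ℝ × Spacetime => φ q.2 :=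
    (φ.continuous.comp continuous_snd).measurable
  simp only [Function.uncurry_def]
  fun_prop

theorem integrableOn_inv_one_add_sq (C : ℝ) :
    IntegrableOn (fun s : ℝ => C * (1 + s ^ 2)⁻¹) (Set.Ioi 0) :=
  (integrable_inv_one_add_sq.const_mul C).integrableOn

theorem integrableOn_mul_properTimeAmplitude (x' : Spacetime) (φ : 𝓢(Spacetime, ℂ)) {f : ℝ → ℂ}
    (hf : Measurable f) (hf1 : ∀ s, 0 < s → ‖f s‖ ≤ 1) :
    IntegrableOn (fun s => f s * properTimeAmplitude x' φ s) (Set.Ioi 0) := by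
  refine Integrable.mono' (integrableOn_inv_one_add_sq (amplitudeBound φ))
    (hf.aestronglyMeasurable.mul (stronglyMeasurable_properTimeAmplitude x' φ).aestronglyMeasurable) ?_
  refine (ae_restrict_mem measurableSet_Ioi).mono fun s hs => ?_
  rw [norm_mul]
  exact (mul_le_of_le_one_left (norm_nonneg _) (hf1 s hs)).trans (norm_properTimeAmplitude_le x' φ hs)

/-- The phase `e^{-i m² s}`. -/
def massPhase (m s : ℝ) : ℂ := Complex.exp (-(Complex.I * ((m ^ 2 * s : ℝ) : ℂ)))

theorem measurable_massPhase (m : ℝ) : Measurable (massPhase m) := by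
  unfold massPhase; fun_prop

theorem norm_massPhase (m s : ℝ) : ‖massPhase m s‖ = 1 := norm_cexp_neg_I_mul _

theorem properTimeAmplitude_add (x' : Spacetime) (φ ψ : 𝓢(Spacetime, ℂ)) {s : ℝ} (hs : 0 < s) :
    properTimeAmplitude x' (φ + ψ) s = properTimeAmplitude x' φ s + properTimeAmplitude x' ψ s := by
  have hi : ∀ φ : 𝓢(Spacetime, ℂ), Integrable fun x : Spacetime => φ x * (1 / (s : ℂ) ^ 2 *
      Complex.exp (Complex.I * ((interval x x' / (4 * s) : ℝ) : ℂ))) := fun φ => by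
    refine ((φ.integrable (μ := volume)).norm.mul_const (s ^ 2)⁻¹).mono' ?_
      (Eventually.of_forall fun x => ?_)
    · have := φ.continuous
      exact Continuous.aestronglyMeasurable (by fun_prop)
    · rw [norm_mul, norm_mul, norm_cexp_I_mul, mul_one, norm_div, norm_one, norm_pow,
        Complex.norm_real, Real.norm_of_nonneg hs.le, one_div]
  simp only [properTimeAmplitude]
  rw [← integral_add (hi φ) (hi ψ)]
  simp only [add_apply, add_mul]

theorem properTimeAmplitude_smul (x' : Spacetime) (c : ℂ) (φ : 𝓢(Spacetime, ℂ)) (s : ℝ) :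
    properTimeAmplitude x' (c • φ) s = c * properTimeAmplitude x' φ s := by
  simp only [properTimeAmplitude]
  rw [← integral_const_mul]
  simp only [smul_apply, smul_eq_mul, mul_assoc]

/-- The propagator as a linear functional on test functions. -/
def propagatorLinear (m : ℝ) (x' : Spacetime) : 𝓢(Spacetime, ℂ) →ₗ[ℂ] ℂ where
  toFun φ := 1 / (4 * (Real.pi : ℂ)) ^ 2 *
    ∫ s in Set.Ioi (0 : ℝ), massPhase m s * properTimeAmplitude x' φ s
  map_add' φ ψ := by
    have hi := fun φ => integrableOn_mul_properTimeAmplitude x' φ (measurable_massPhase m)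
      (fun s _ => (norm_massPhase m s).le)
    rw [← mul_add, ← integral_add (hi φ) (hi ψ)]
    congr 1
    refine setIntegral_congr_fun measurableSet_Ioi fun s hs => ?_
    rw [properTimeAmplitude_add x' φ ψ hs, mul_add]
  map_smul' c φ := by
    have h : ∀ s, massPhase m s * properTimeAmplitude x' (c • φ) s =
        c * (massPhase m s * properTimeAmplitude x' φ s) := fun s => by
      rw [properTimeAmplitude_smul]
      ring
    simp only [h, integral_const_mul, RingHom.id_apply, smul_eq_mul]
    ring

theorem norm_propagatorLinear_le (m : ℝ) (x' : Spacetime) (φ : 𝓢(Spacetime, ℂ)) :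
    ‖propagatorLinear m x' φ‖ ≤ ‖1 / (4 * (Real.pi : ℂ)) ^ 2‖ *
      ((∫ s in Set.Ioi (0 : ℝ), (1 + s ^ 2)⁻¹) * amplitudeBound φ) := by
  change ‖1 / (4 * (Real.pi : ℂ)) ^ 2 *
    ∫ s in Set.Ioi (0 : ℝ), massPhase m s * properTimeAmplitude x' φ s‖ ≤ _
  rw [norm_mul, ← integral_mul_const]
  refine mul_le_mul_of_nonneg_left ?_ (norm_nonneg _)
  refine norm_integral_le_of_norm_le (integrable_inv_one_add_sq.integrableOn.mul_const _) ?_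
  refine (ae_restrict_mem measurableSet_Ioi).mono fun s hs => ?_
  rw [norm_mul, norm_massPhase, one_mul, mul_comm]
  exact norm_properTimeAmplitude_le x' φ hs

theorem continuous_propagatorLinear (m : ℝ) (x' : Spacetime) :
    Continuous (propagatorLinear m x') := by
  refine continuous_of_continuousAt_zero (propagatorLinear m x') ?_
  have h : Tendsto (fun φ => ‖1 / (4 * (Real.pi : ℂ)) ^ 2‖ *
      ((∫ s in Set.Ioi (0 : ℝ), (1 + s ^ 2)⁻¹) * amplitudeBound φ)) (𝓝 0) (𝓝 0) := by
    have := ((continuous_amplitudeBound.const_mul (∫ s in Set.Ioi (0 : ℝ), (1 + s ^ 2)⁻¹)).const_mul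
      ‖1 / (4 * (Real.pi : ℂ)) ^ 2‖).tendsto 0
    simpa [amplitudeBound_zero] using this
  rw [ContinuousAt, map_zero]
  exact squeeze_zero_norm (norm_propagatorLinear_le m x') h

/-- The Feynman propagator, defined by its proper-time representation. -/
def feynmanPropagator (m : ℝ) (x' : Spacetime) : 𝓢'(Spacetime, ℂ) :=
  ContinuousLinearMap.toPointwiseConvergenceCLM _ _ _ _
    (⟨propagatorLinear m x', continuous_propagatorLinear m x'⟩ : 𝓢(Spacetime, ℂ) →L[ℂ] ℂ)

theorem feynmanPropagator_apply (m : ℝ) (x' : Spacetime) (φ : 𝓢(Spacetime, ℂ)) :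
    feynmanPropagator m x' φ = 1 / (4 * (Real.pi : ℂ)) ^ 2 *
      ∫ s in Set.Ioi (0 : ℝ), massPhase m s * properTimeAmplitude x' φ s := rfl

theorem integral_mul_schwingerIntegrand (m : ℝ) (x' : Spacetime) (φ : 𝓢(Spacetime, ℂ)) (s : ℝ) :
    ∫ x : Spacetime, φ x * schwingerIntegrand ((m : ℂ) ^ 2) (interval x x' : ℂ) s =
      massPhase m s * properTimeAmplitude x' φ s := by
  rw [properTimeAmplitude, ← integral_const_mul]
  refine integral_congr_ae (Eventually.of_forall fun x => ?_)
  simp only [schwingerIntegrand, massPhase]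
  have e : Complex.exp (-Complex.I * ((m : ℂ) ^ 2 * s - (interval x x' : ℂ) / (4 * s))) =
      Complex.exp (-(Complex.I * ((m ^ 2 * s : ℝ) : ℂ))) *
        Complex.exp (Complex.I * ((interval x x' / (4 * s) : ℝ) : ℂ)) := by
    rw [← Complex.exp_add]
    congr 1
    push_cast
    ring
  rw [e]
  ring

/-! ### The momentum-space definition -/

theorem feynman_denominator_ne_zero (D : ℝ) {ε : ℝ} (hε : 0 < ε) :
    (D : ℂ) - Complex.I * (ε : ℂ) ≠ 0 := by
  intro h
  have := congrArg Complex.im h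
  simp at this
  exact hε.ne' this

/-- The prescription `-iε` selects the half line `s > 0` on which the exponential decays. -/
theorem inv_feynman_denominator (D : ℝ) {ε : ℝ} (hε : 0 < ε) :
    1 / ((D : ℂ) - Complex.I * (ε : ℂ)) =
      Complex.I * ∫ s in Set.Ioi (0 : ℝ), Complex.exp (-((ε : ℂ) + Complex.I * D) * s) := by
  have hne := feynman_denominator_ne_zero D hε
  have e : (ε : ℂ) + Complex.I * D = Complex.I * ((D : ℂ) - Complex.I * (ε : ℂ)) := by
    linear_combination (ε : ℂ) * Complex.I_mul_I
  have hI := Complex.I_ne_zero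
  rw [integral_exp_mul_complex_Ioi (by simpa using hε)]
  simp only [Complex.ofReal_zero, mul_zero, Complex.exp_zero]
  rw [neg_div_neg_eq, e]
  field_simp

theorem feynmanIntegrand_eq (m ε : ℝ) (x' : Spacetime) (φ : 𝓢(Spacetime, ℂ)) (p : Spacetime) :
    feynmanIntegrand m ε x' φ p = waveTransform x' φ p *
      (1 / (((m ^ 2 + minkowski p p : ℝ) : ℂ) - Complex.I * (ε : ℂ))) := by
  rw [feynmanIntegrand, waveTransform, mul_one_div]
  congr 1
  push_cast
  ring

theorem norm_inv_feynman_denominator_le (D : ℝ) {ε : ℝ} (hε : 0 < ε) :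
    ‖1 / ((D : ℂ) - Complex.I * (ε : ℂ))‖ ≤ 1 / ε := by
  rw [norm_div, norm_one]
  apply one_div_le_one_div_of_le hε
  have := Complex.abs_im_le_norm ((D : ℂ) - Complex.I * (ε : ℂ))
  simp at this
  exact (le_abs_self ε).trans this

theorem integrable_feynmanIntegrand (m : ℝ) (x' : Spacetime) (φ : 𝓢(Spacetime, ℂ)) {ε : ℝ}
    (hε : 0 < ε) : Integrable (feynmanIntegrand m ε x' φ) := by
  have h : feynmanIntegrand m ε x' φ = fun p => waveTransform x' φ p *
      (1 / (((m ^ 2 + minkowski p p : ℝ) : ℂ) - Complex.I * (ε : ℂ))) :=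
    funext fun p => feynmanIntegrand_eq m ε x' φ p
  rw [h]
  refine ((integrable_waveTransform x' φ).norm.mul_const (1 / ε)).mono' ?_
    (Eventually.of_forall fun p => ?_)
  · refine ((continuous_waveTransform x' φ).mul (continuous_const.div ?_ fun p =>
      feynman_denominator_ne_zero _ hε)).aestronglyMeasurable
    fun_prop
  · rw [norm_mul]
    exact mul_le_mul_of_nonneg_left (norm_inv_feynman_denominator_le _ hε) (norm_nonneg _)

/-- The factor `e^{-εs}` makes the double integral in `p` and `s` absolutely convergent. After the
exchange the momentum integral is the oscillating Gaussian, and `i · (-iπ²) = π²`. -/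
theorem integral_feynmanIntegrand (m : ℝ) (x' : Spacetime) (φ : 𝓢(Spacetime, ℂ)) {ε : ℝ}
    (hε : 0 < ε) :
    ∫ p : Spacetime, feynmanIntegrand m ε x' φ p = (Real.pi : ℂ) ^ 2 *
      ∫ s in Set.Ioi (0 : ℝ), Complex.exp (-((ε * s : ℝ) : ℂ)) * massPhase m s *
        properTimeAmplitude x' φ s := by
  set F : Spacetime → ℝ → ℂ := fun p s => waveTransform x' φ p *
    Complex.exp (-((ε : ℂ) + Complex.I * ((m ^ 2 + minkowski p p : ℝ) : ℂ)) * s) with hF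
  have hnorm : ∀ p s, ‖F p s‖ = ‖waveTransform x' φ p‖ * Real.exp (-ε * s) := fun p s => by
    rw [hF]
    simp only []
    rw [norm_mul, Complex.norm_exp, Complex.re_mul_ofReal]
    generalize m ^ 2 + minkowski p p = r
    simp
  have hswap := integral_integral_swap (μ := (volume : Measure Spacetime))
    (ν := (volume : Measure ℝ).restrict (Set.Ioi 0)) (f := F) ?_
  · have e1 : ∀ p, feynmanIntegrand m ε x' φ p =
        Complex.I * ∫ s in Set.Ioi (0 : ℝ), F p s := fun p => by
      rw [feynmanIntegrand_eq, inv_feynman_denominator _ hε, hF, integral_const_mul]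
      ring
    simp only [e1]
    rw [integral_const_mul, hswap, ← integral_const_mul, ← integral_const_mul]
    refine setIntegral_congr_fun measurableSet_Ioi fun s hs => ?_
    have e2 : ∀ p, F p s = Complex.exp (-((ε * s : ℝ) : ℂ)) * massPhase m s *
        (Complex.exp (-(Complex.I * ((s * minkowski p p : ℝ) : ℂ))) * waveTransform x' φ p) :=
      fun p => by
        have : Complex.exp (-((ε : ℂ) + Complex.I * ((m ^ 2 + minkowski p p : ℝ) : ℂ)) * s) =
            Complex.exp (-((ε * s : ℝ) : ℂ)) * massPhase m s *
              Complex.exp (-(Complex.I * ((s * minkowski p p : ℝ) : ℂ))) := by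
          rw [massPhase, ← Complex.exp_add, ← Complex.exp_add]
          congr 1
          push_cast
          ring
        simp only [hF]
        rw [this]
        ring
    simp only [e2]
    rw [integral_const_mul, integral_exp_mul_waveTransform x' φ hs]
    linear_combination -(Complex.exp (-((ε * s : ℝ) : ℂ)) * massPhase m s * (Real.pi : ℂ) ^ 2 *
      properTimeAmplitude x' φ s) * Complex.I_mul_I
  · have h := (integrable_waveTransform x' φ).norm.mul_prod
      (integrableOn_exp_mul_Ioi (a := -ε) (by linarith) 0)
    refine h.mono' ?_ (Eventually.of_forall fun q => ?_)
    · have := continuous_waveTransform x' φ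
      refine Continuous.aestronglyMeasurable ?_
      simp only [Function.uncurry_def, hF]
      fun_prop
    · exact (hnorm q.1 q.2).le

theorem isFeynmanPropagator_feynmanPropagator (m : ℝ) (x' : Spacetime) :
    IsFeynmanPropagator m x' (feynmanPropagator m x') := by
  intro φ
  refine ⟨fun ε hε => integrable_feynmanIntegrand m x' φ hε, ?_⟩
  have h : Tendsto (fun ε : ℝ => ∫ s in Set.Ioi (0 : ℝ), Complex.exp (-((ε * s : ℝ) : ℂ)) *
      massPhase m s * properTimeAmplitude x' φ s) (𝓝[>] 0)
      (𝓝 (∫ s in Set.Ioi (0 : ℝ), massPhase m s * properTimeAmplitude x' φ s)) := by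
    refine tendsto_integral_filter_of_dominated_convergence
      (fun s => amplitudeBound φ * (1 + s ^ 2)⁻¹) ?_ ?_
      (integrableOn_inv_one_add_sq (amplitudeBound φ)) ?_
    · refine Eventually.of_forall fun ε => ?_
      have h1 : Measurable fun s : ℝ => Complex.exp (-((ε * s : ℝ) : ℂ)) := by fun_prop
      exact (h1.mul (measurable_massPhase m)).aestronglyMeasurable.mul
        (stronglyMeasurable_properTimeAmplitude x' φ).aestronglyMeasurable
    · filter_upwards [self_mem_nhdsWithin] with ε hε
      refine (ae_restrict_mem measurableSet_Ioi).mono fun s hs => ?_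
      have hs : 0 < s := hs
      have hε : 0 < ε := hε
      rw [norm_mul, norm_mul, norm_massPhase, mul_one, Complex.norm_exp, ← Complex.ofReal_neg,
        Complex.ofReal_re]
      refine (mul_le_of_le_one_left (norm_nonneg _) ?_).trans (norm_properTimeAmplitude_le x' φ hs)
      rw [Real.exp_le_one_iff]
      nlinarith
    · refine Eventually.of_forall fun s => ?_
      have hc : Continuous fun ε : ℝ => Complex.exp (-((ε * s : ℝ) : ℂ)) * massPhase m s *
          properTimeAmplitude x' φ s := by fun_prop
      have := (hc.tendsto 0).mono_left (nhdsWithin_le_nhds (s := Set.Ioi 0))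
      simpa using this
  have h2 := (h.const_mul ((Real.pi : ℂ) ^ 2)).const_mul (1 / (2 * (Real.pi : ℂ)) ^ 4)
  have hpi : (Real.pi : ℂ) ≠ 0 := by exact_mod_cast Real.pi_ne_zero
  -- The normalisation `π² / (2π)⁴ = 1 / (4π)²`.
  have e : 1 / (2 * (Real.pi : ℂ)) ^ 4 * ((Real.pi : ℂ) ^ 2 *
      ∫ s in Set.Ioi (0 : ℝ), massPhase m s * properTimeAmplitude x' φ s) =
      feynmanPropagator m x' φ := by
    rw [feynmanPropagator_apply]
    field_simp
    ring
  rw [e] at h2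
  refine h2.congr' ?_
  filter_upwards [self_mem_nhdsWithin] with ε hε
  rw [integral_feynmanIntegrand m x' φ hε]

/-! ### The propagator as a boundary value -/

/-- The two regularisations become one real damping factor: `ε` controls large proper times and `δ`
small ones. -/
theorem schwingerIntegrand_regularised (m ε δ σ s : ℝ) :
    schwingerIntegrand ((m : ℂ) ^ 2 - Complex.I * (ε : ℂ)) ((σ : ℂ) + Complex.I * (δ : ℂ)) s =
      Complex.exp (-((ε * s + δ / (4 * s) : ℝ) : ℂ)) * massPhase m s *
        (1 / (s : ℂ) ^ 2 * Complex.exp (Complex.I * ((σ / (4 * s) : ℝ) : ℂ))) := by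
  rw [schwingerIntegrand, massPhase]
  have e : Complex.exp (-Complex.I * (((m : ℂ) ^ 2 - Complex.I * (ε : ℂ)) * s -
      ((σ : ℂ) + Complex.I * (δ : ℂ)) / (4 * s))) =
      Complex.exp (-((ε * s + δ / (4 * s) : ℝ) : ℂ)) *
        Complex.exp (-(Complex.I * ((m ^ 2 * s : ℝ) : ℂ))) *
        Complex.exp (Complex.I * ((σ / (4 * s) : ℝ) : ℂ)) := by
    rw [← Complex.exp_add, ← Complex.exp_add]
    congr 1
    push_cast
    linear_combination ((ε : ℂ) * s + δ / (4 * s)) * Complex.I_mul_I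
  rw [e]
  ring

theorem integrable_prod_schwingerIntegrand (m : ℝ) (x' : Spacetime) (φ : 𝓢(Spacetime, ℂ)) {ε δ : ℝ}
    (hε : 0 < ε) (hδ : 0 < δ) :
    Integrable (Function.uncurry fun (x : Spacetime) (s : ℝ) => φ x *
      schwingerIntegrand ((m : ℂ) ^ 2 - Complex.I * (ε : ℂ))
        ((interval x x' : ℂ) + Complex.I * (δ : ℂ)) s)
      (volume.prod (volume.restrict (Set.Ioi 0))) := by
  have h := (φ.integrable (μ := volume)).norm.mul_prod (integrableOn_inv_pow_mul_exp 2 hε hδ)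
  refine h.mono' ?_ ?_
  · have h1 : Measurable fun q : Spacetime × ℝ => interval q.1 x' :=
      Continuous.measurable (by fun_prop)
    have h2 : Measurable fun q : Spacetime × ℝ => φ q.1 :=
      (φ.continuous.comp continuous_fst).measurable
    refine Measurable.aestronglyMeasurable ?_
    simp only [Function.uncurry_def, schwingerIntegrand]
    fun_prop
  · have hae : ∀ᵐ q : Spacetime × ℝ ∂(volume.prod (volume.restrict (Set.Ioi 0))), 0 < q.2 :=
      Measure.quasiMeasurePreserving_snd.ae (ae_restrict_mem measurableSet_Ioi)
    filter_upwards [hae] with q hs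
    simp only [Function.uncurry_def]
    rw [schwingerIntegrand_regularised, norm_mul, norm_mul, norm_mul, norm_mul, norm_massPhase,
      norm_cexp_I_mul, Complex.norm_exp, ← Complex.ofReal_neg, Complex.ofReal_re, norm_div, norm_one,
      norm_pow, Complex.norm_real, Real.norm_of_nonneg hs.le, inv_pow]
    rw [mul_one, mul_one, one_div, mul_comm (Real.exp _)]

theorem integrable_mul_schwingerKernel (m : ℝ) (x' : Spacetime) (φ : 𝓢(Spacetime, ℂ)) {ε δ : ℝ}
    (hε : 0 < ε) (hδ : 0 < δ) :
    Integrable (fun x : Spacetime => φ x * schwingerKernel ((m : ℂ) ^ 2 - Complex.I * (ε : ℂ))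
      ((interval x x' : ℂ) + Complex.I * (δ : ℂ))) := by
  have h := (integrable_prod_schwingerIntegrand m x' φ hε hδ).integral_prod_left.const_mul
    (1 / (4 * (Real.pi : ℂ)) ^ 2)
  refine h.congr (Eventually.of_forall fun x => ?_)
  simp only [Function.uncurry_apply_pair]
  rw [integral_const_mul, schwingerKernel]
  ring

theorem integral_mul_schwingerKernel (m : ℝ) (x' : Spacetime) (φ : 𝓢(Spacetime, ℂ)) {ε δ : ℝ}
    (hε : 0 < ε) (hδ : 0 < δ) :
    ∫ x : Spacetime, φ x * schwingerKernel ((m : ℂ) ^ 2 - Complex.I * (ε : ℂ))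
      ((interval x x' : ℂ) + Complex.I * (δ : ℂ)) = 1 / (4 * (Real.pi : ℂ)) ^ 2 *
      ∫ s in Set.Ioi (0 : ℝ), Complex.exp (-((ε * s + δ / (4 * s) : ℝ) : ℂ)) * massPhase m s *
        properTimeAmplitude x' φ s := by
  have hswap := integral_integral_swap (integrable_prod_schwingerIntegrand m x' φ hε hδ)
  have e1 : ∀ x : Spacetime, φ x * schwingerKernel ((m : ℂ) ^ 2 - Complex.I * (ε : ℂ))
      ((interval x x' : ℂ) + Complex.I * (δ : ℂ)) = 1 / (4 * (Real.pi : ℂ)) ^ 2 *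
      ∫ s in Set.Ioi (0 : ℝ), φ x * schwingerIntegrand ((m : ℂ) ^ 2 - Complex.I * (ε : ℂ))
        ((interval x x' : ℂ) + Complex.I * (δ : ℂ)) s := fun x => by
    rw [integral_const_mul, schwingerKernel]
    ring
  simp only [e1]
  rw [integral_const_mul, hswap]
  congr 1
  refine setIntegral_congr_fun measurableSet_Ioi fun s hs => ?_
  simp only [schwingerIntegrand_regularised, properTimeAmplitude]
  rw [← integral_const_mul]
  refine integral_congr_ae (Eventually.of_forall fun x => ?_)
  simp only []
  ring

/-- The damping factor is at most one, so the bound on the amplitude dominates independently of both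
parameters and the limit is a genuine joint limit. -/
theorem tendsto_integral_mul_schwingerKernel (m : ℝ) (x' : Spacetime) (φ : 𝓢(Spacetime, ℂ)) :
    Tendsto (fun r : ℝ × ℝ => ∫ x : Spacetime, φ x *
        schwingerKernel ((m : ℂ) ^ 2 - Complex.I * (r.1 : ℂ))
          ((interval x x' : ℂ) + Complex.I * (r.2 : ℂ)))
      (𝓝[>] 0 ×ˢ 𝓝[>] 0) (𝓝 (feynmanPropagator m x' φ)) := by
  have hpos : ∀ᶠ r : ℝ × ℝ in 𝓝[>] 0 ×ˢ 𝓝[>] 0, 0 < r.1 ∧ 0 < r.2 :=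
    prod_mem_prod self_mem_nhdsWithin self_mem_nhdsWithin
  have h : Tendsto (fun r : ℝ × ℝ => ∫ s in Set.Ioi (0 : ℝ),
      Complex.exp (-((r.1 * s + r.2 / (4 * s) : ℝ) : ℂ)) *
      massPhase m s * properTimeAmplitude x' φ s) (𝓝[>] 0 ×ˢ 𝓝[>] 0)
      (𝓝 (∫ s in Set.Ioi (0 : ℝ), massPhase m s * properTimeAmplitude x' φ s)) := by
    refine tendsto_integral_filter_of_dominated_convergence
      (fun s => amplitudeBound φ * (1 + s ^ 2)⁻¹) ?_ ?_
      (integrableOn_inv_one_add_sq (amplitudeBound φ)) ?_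
    · refine Eventually.of_forall fun r => ?_
      have h1 : Measurable fun s : ℝ => Complex.exp (-((r.1 * s + r.2 / (4 * s) : ℝ) : ℂ)) := by
        fun_prop
      exact (h1.mul (measurable_massPhase m)).aestronglyMeasurable.mul
        (stronglyMeasurable_properTimeAmplitude x' φ).aestronglyMeasurable
    · filter_upwards [hpos] with r hr
      obtain ⟨hr1, hr2⟩ := hr
      refine (ae_restrict_mem measurableSet_Ioi).mono fun s hs => ?_
      have hs : 0 < s := hs
      rw [norm_mul, norm_mul, norm_massPhase, mul_one, Complex.norm_exp, ← Complex.ofReal_neg,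
        Complex.ofReal_re]
      refine (mul_le_of_le_one_left (norm_nonneg _) ?_).trans (norm_properTimeAmplitude_le x' φ hs)
      rw [Real.exp_le_one_iff]
      have : 0 ≤ r.1 * s + r.2 / (4 * s) := by positivity
      linarith
    · refine Eventually.of_forall fun s => ?_
      have hc : Continuous fun r : ℝ × ℝ => Complex.exp (-((r.1 * s + r.2 / (4 * s) : ℝ) : ℂ)) *
          massPhase m s * properTimeAmplitude x' φ s := by fun_prop
      have hle : (𝓝[>] (0 : ℝ)) ×ˢ (𝓝[>] (0 : ℝ)) ≤ 𝓝 (0, 0) := by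
        rw [nhds_prod_eq]
        exact Filter.prod_mono nhdsWithin_le_nhds nhdsWithin_le_nhds
      have := (hc.tendsto (0, 0)).mono_left hle
      simpa using this
  have h2 := h.const_mul (1 / (4 * (Real.pi : ℂ)) ^ 2)
  rw [← feynmanPropagator_apply] at h2
  refine h2.congr' ?_
  filter_upwards [hpos] with r hr
  rw [integral_mul_schwingerKernel m x' φ hr.1 hr.2]

end

noncomputable section

/-! ### Coordinates adapted to the light cone -/

open scoped ENNReal

/-- The unit sphere of directions in space. -/
abbrev Direction : Type := Metric.sphere (0 : EuclideanSpace ℝ (Fin 3)) 1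

/-- The surface measure on the sphere of directions. -/
abbrev directionMeasure : Measure Direction :=
  (volume : Measure (EuclideanSpace ℝ (Fin 3))).toSphere

theorem lintegral_polar {g : EuclideanSpace ℝ (Fin 3) → ℝ≥0∞} (hg : Measurable g) :
    ∫⁻ y, g y = ∫⁻ ω : Direction, (∫⁻ r in Set.Ioi (0 : ℝ),
      ENNReal.ofReal (r ^ 2) * g (r • (ω : EuclideanSpace ℝ (Fin 3)))) ∂directionMeasure := by
  have hmp := (volume : Measure (EuclideanSpace ℝ (Fin 3))).measurePreserving_homeomorphUnitSphereProd
  have h0 : MeasurableSet ({0}ᶜ : Set (EuclideanSpace ℝ (Fin 3))) := (measurableSet_singleton _).compl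
  have hd : Module.finrank ℝ (EuclideanSpace ℝ (Fin 3)) - 1 = 2 := by simp
  rw [hd] at hmp
  have hG : Measurable fun q : Direction × Set.Ioi (0 : ℝ) =>
      g ((q.2 : ℝ) • (q.1 : EuclideanSpace ℝ (Fin 3))) :=
    hg.comp (Continuous.measurable (by fun_prop))
  calc ∫⁻ y, g y = ∫⁻ y in ({0}ᶜ : Set (EuclideanSpace ℝ (Fin 3))), g y := by
        rw [MeasureTheory.restrict_compl_singleton]
    _ = ∫⁻ y : ({0}ᶜ : Set (EuclideanSpace ℝ (Fin 3))), g y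
          ∂(Measure.comap (↑) (volume : Measure (EuclideanSpace ℝ (Fin 3)))) :=
        (lintegral_subtype_comap h0 g).symm
    _ = ∫⁻ y : ({0}ᶜ : Set (EuclideanSpace ℝ (Fin 3))),
          (fun q : Direction × Set.Ioi (0 : ℝ) =>
            g ((q.2 : ℝ) • (q.1 : EuclideanSpace ℝ (Fin 3)))) (homeomorphUnitSphereProd _ y)
          ∂(Measure.comap (↑) (volume : Measure (EuclideanSpace ℝ (Fin 3)))) := by
        refine lintegral_congr fun y => ?_
        have hy : ‖(y : EuclideanSpace ℝ (Fin 3))‖ ≠ 0 := norm_ne_zero_iff.mpr y.2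
        simp [smul_smul, hy]
    _ = ∫⁻ q, g ((q.2 : ℝ) • (q.1 : EuclideanSpace ℝ (Fin 3)))
          ∂(directionMeasure.prod (Measure.volumeIoiPow 2)) :=
        hmp.lintegral_comp hG
    _ = ∫⁻ ω, ∫⁻ r, g ((r : ℝ) • (ω : EuclideanSpace ℝ (Fin 3))) ∂(Measure.volumeIoiPow 2)
          ∂directionMeasure := lintegral_prod _ hG.aemeasurable
    _ = _ := by
        refine lintegral_congr fun ω => ?_
        have hω : Measurable fun r : Set.Ioi (0 : ℝ) =>
            g ((r : ℝ) • (ω : EuclideanSpace ℝ (Fin 3))) :=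
          hg.comp (Continuous.measurable (by fun_prop))
        rw [Measure.volumeIoiPow, lintegral_withDensity_eq_lintegral_mul _ (by fun_prop) hω]
        exact lintegral_subtype_comap measurableSet_Ioi
          fun r : ℝ => ENNReal.ofReal (r ^ 2) * g (r • (ω : EuclideanSpace ℝ (Fin 3)))

/-- The event at time `t` and position `y`. -/
def event (t : ℝ) (y : EuclideanSpace ℝ (Fin 3)) : Spacetime := !₂[t, y 0, y 1, y 2]

theorem continuous_event : Continuous fun q : ℝ × EuclideanSpace ℝ (Fin 3) => event q.1 q.2 := by
  unfold event
  refine (PiLp.continuous_toLp 2 _).comp (continuous_pi fun i => ?_)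
  fin_cases i <;> simp <;> fun_prop

theorem Continuous.event {X : Type*} [TopologicalSpace X] {f : X → ℝ}
    {g : X → EuclideanSpace ℝ (Fin 3)} (hf : Continuous f) (hg : Continuous g) :
    Continuous fun x => event (f x) (g x) :=
  continuous_event.comp (hf.prodMk hg)

attribute [fun_prop] Continuous.event

theorem measurePreserving_event :
    MeasurePreserving fun q : ℝ × EuclideanSpace ℝ (Fin 3) => event q.1 q.2 := by
  have h1 := PiLp.volume_preserving_toLp (Fin 4)
  have h2 := (volume_preserving_piFinSuccAbove (fun _ : Fin 4 => ℝ) 0).symm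
  have h3 : MeasurePreserving (Prod.map id WithLp.ofLp :
      ℝ × EuclideanSpace ℝ (Fin 3) → ℝ × (Fin 3 → ℝ)) :=
    (MeasurePreserving.id (volume : Measure ℝ)).prod (PiLp.volume_preserving_ofLp (Fin 3))
  convert h1.comp (h2.comp h3) using 1
  funext q
  ext i
  fin_cases i <;> rfl

theorem lintegral_event (x' : Spacetime) {g : Spacetime → ℝ≥0∞} (hg : Measurable g) :
    ∫⁻ x, g x = ∫⁻ t : ℝ, ∫⁻ y, g (x' + event t y) := by
  rw [← lintegral_add_left_eq_self g x']
  have hg' : Measurable fun x => g (x' + x) := hg.comp (measurable_const_add x')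
  rw [← measurePreserving_event.lintegral_comp hg']
  exact lintegral_prod _ (hg'.comp measurePreserving_event.measurable).aemeasurable

/-- The substitution `u = r² - t²` gives `r² dr = (√(t² + u) / 2) du`. The integral may run over all
real `u`, since the real square root vanishes for `u ≤ -t²`. -/
theorem lintegral_radius_eq (t : ℝ) (g : ℝ → ℝ≥0∞) :
    ∫⁻ r in Set.Ioi (0 : ℝ), ENNReal.ofReal (r ^ 2) * g r =
      ∫⁻ u : ℝ, ENNReal.ofReal (√(t ^ 2 + u) / 2) * g √(t ^ 2 + u) := by
  have himg : (fun r : ℝ => r ^ 2 - t ^ 2) '' Set.Ioi 0 = Set.Ioi (-t ^ 2) := by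
    ext u
    constructor
    · rintro ⟨r, hr, rfl⟩
      have : 0 < r ^ 2 := pow_pos hr 2
      simpa using this
    · intro hu
      have hu : -t ^ 2 < u := hu
      have hp : 0 < t ^ 2 + u := by linarith
      refine ⟨√(t ^ 2 + u), Real.sqrt_pos.mpr hp, ?_⟩
      simp only
      rw [Real.sq_sqrt hp.le]
      ring
  have h := lintegral_image_eq_lintegral_abs_deriv_mul (f := fun r : ℝ => r ^ 2 - t ^ 2)
    (f' := fun r => 2 * r) (measurableSet_Ioi (a := (0 : ℝ)))
    (fun r _ => (by simpa using ((hasDerivAt_pow 2 r).sub_const (t ^ 2)).hasDerivWithinAt))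
    (fun a ha b hb hab => by
      have ha : 0 < a := ha
      have hb : 0 < b := hb
      simp only at hab
      nlinarith [sq_nonneg (a - b)])
    (fun u => ENNReal.ofReal (√(t ^ 2 + u) / 2) * g √(t ^ 2 + u))
  rw [himg] at h
  have h2 : ∫⁻ u : ℝ, ENNReal.ofReal (√(t ^ 2 + u) / 2) * g √(t ^ 2 + u) =
      ∫⁻ u in Set.Ioi (-t ^ 2), ENNReal.ofReal (√(t ^ 2 + u) / 2) * g √(t ^ 2 + u) := by
    rw [setLIntegral_eq_of_support_subset]
    intro u hu
    by_contra hc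
    have hc : u ≤ -t ^ 2 := not_lt.mp hc
    rw [Function.mem_support, Real.sqrt_eq_zero_of_nonpos (by linarith)] at hu
    simp at hu
  rw [h2, h]
  refine setLIntegral_congr_fun measurableSet_Ioi fun r hr => ?_
  have hr : 0 < r := hr
  have e : t ^ 2 + (r ^ 2 - t ^ 2) = r ^ 2 := by ring
  simp only [e, Real.sqrt_sq hr.le]
  rw [← mul_assoc, ← ENNReal.ofReal_mul (abs_nonneg _), abs_of_pos (by positivity)]
  congr 2
  ring

/-- The coordinates `((t, ω), u)` of the event with time `t`, direction `ω` and squared interval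
`u` from `x'`. -/
def coneChart (x' : Spacetime) (q : (ℝ × Direction) × ℝ) : Spacetime :=
  x' + event q.1.1 (√(q.1.1 ^ 2 + q.2) • (q.1.2 : EuclideanSpace ℝ (Fin 3)))

/-- The density of Lebesgue measure in the coordinates of `coneChart`. -/
def coneDensity (q : (ℝ × Direction) × ℝ) : NNReal := (√(q.1.1 ^ 2 + q.2) / 2).toNNReal

/-- The reference measure in the coordinates of `coneChart`. -/
abbrev coneMeasure : Measure ((ℝ × Direction) × ℝ) :=
  ((volume : Measure ℝ).prod directionMeasure).prod volume

theorem continuous_coneChart (x' : Spacetime) : Continuous (coneChart x') := by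
  unfold coneChart; fun_prop

theorem measurable_coneDensity : Measurable coneDensity := by
  unfold coneDensity; fun_prop

theorem coe_coneDensity (q : (ℝ × Direction) × ℝ) :
    (coneDensity q : ℝ) = √(q.1.1 ^ 2 + q.2) / 2 :=
  Real.coe_toNNReal _ (by positivity)

/-- Polar coordinates in space followed by the substitution from radius to interval. Stated as a
push-forward, it transfers integrability and integrals without an inverse chart. -/
theorem map_coneChart (x' : Spacetime) :
    (coneMeasure.withDensity fun q => (coneDensity q : ℝ≥0∞)).map (coneChart x') = volume := by
  refine Measure.ext_of_lintegral _ fun g hg => ?_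
  have hΨ := (continuous_coneChart x').measurable
  have hd : Measurable fun q => (coneDensity q : ℝ≥0∞) := measurable_coneDensity.coe_nnreal_ennreal
  have hm : Measurable fun q => (coneDensity q : ℝ≥0∞) * g (coneChart x' q) := hd.mul (hg.comp hΨ)
  rw [lintegral_map hg hΨ, lintegral_withDensity_eq_lintegral_mul (g := fun q => g (coneChart x' q)) _ hd (hg.comp hΨ),
    lintegral_event x' hg]
  simp only [Pi.mul_apply]
  rw [lintegral_prod _ hm.aemeasurable, lintegral_prod _ hm.lintegral_prod_right'.aemeasurable]
  refine lintegral_congr fun t => ?_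
  have hgt : Measurable fun y => g (x' + event t y) := by
    refine hg.comp (Continuous.measurable ?_)
    fun_prop
  rw [lintegral_polar hgt]
  refine lintegral_congr fun ω => ?_
  exact (lintegral_radius_eq t
    fun r => g (x' + event t (r • (ω : EuclideanSpace ℝ (Fin 3))))).symm

/-- A nonzero density means `t² + u > 0`; for `t² + u < 0` the square root is truncated to zero and
the interval is `-t²` instead of `u`. -/
theorem interval_coneChart (x' : Spacetime) {q : (ℝ × Direction) × ℝ} (hq : coneDensity q ≠ 0) :
    interval (coneChart x' q) x' = q.2 := by
  obtain ⟨⟨t, ω⟩, u⟩ := q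
  have hpos : 0 < t ^ 2 + u := by
    by_contra hc
    exact hq (by simp [coneDensity, Real.sqrt_eq_zero_of_nonpos (not_lt.mp hc)])
  have hω : ‖(ω : EuclideanSpace ℝ (Fin 3))‖ ^ 2 = 1 := by simp
  rw [EuclideanSpace.norm_sq_eq, Fin.sum_univ_three] at hω
  simp only [Real.norm_eq_abs, sq_abs] at hω
  have hs := Real.sq_sqrt hpos.le
  simp only [interval, coneChart, minkowski, event, add_sub_cancel_left]
  simp
  linear_combination (√(t ^ 2 + u)) ^ 2 * hω + hs

end

noncomputable section

/-! ### Integrals of functions of the interval against a test function -/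

theorem integrable_iff_coneChart (x' : Spacetime) {f : Spacetime → ℝ} (hf : Measurable f) :
    Integrable f ↔
      Integrable (fun q => √(q.1.1 ^ 2 + q.2) / 2 * f (coneChart x' q)) coneMeasure := by
  have hΨ := (continuous_coneChart x').measurable
  conv_lhs => rw [← map_coneChart x']
  rw [integrable_map_measure hf.aestronglyMeasurable hΨ.aemeasurable,
    integrable_withDensity_iff_integrable_coe_smul measurable_coneDensity]
  simp only [coe_coneDensity, smul_eq_mul, Function.comp_apply]

theorem integral_eq_coneChart (x' : Spacetime) {f : Spacetime → ℝ} (hf : Measurable f) :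
    ∫ x, f x = ∫ q, √(q.1.1 ^ 2 + q.2) / 2 * f (coneChart x' q) ∂coneMeasure := by
  have hΨ := (continuous_coneChart x').measurable
  conv_lhs => rw [← map_coneChart x']
  rw [integral_map hΨ.aemeasurable hf.aestronglyMeasurable,
    integral_withDensity_eq_integral_smul measurable_coneDensity]
  simp only [NNReal.smul_def, coe_coneDensity, smul_eq_mul]

theorem ae_interval_ne_zero (x' : Spacetime) : ∀ᵐ x : Spacetime, interval x x' ≠ 0 := by
  have hΨ := (continuous_coneChart x').measurable
  have hm : MeasurableSet {x : Spacetime | interval x x' ≠ 0} :=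
    (isOpen_ne_fun (by fun_prop) continuous_const).measurableSet
  rw [← map_coneChart x', ae_map_iff hΨ.aemeasurable hm,
    ae_withDensity_iff measurable_coneDensity.coe_nnreal_ennreal]
  have h0 : ∀ᵐ q ∂coneMeasure, q.2 ≠ 0 :=
    Measure.quasiMeasurePreserving_snd.ae (Measure.ae_ne volume 0)
  filter_upwards [h0] with q hq hd
  rw [interval_coneChart x' (by exact_mod_cast hd)]
  exact hq

/-- A test function in the coordinates of `coneChart`, multiplied by the density of Lebesgue
measure. -/
def coneWeight (x' : Spacetime) (φ : 𝓢(Spacetime, ℝ)) (q : (ℝ × Direction) × ℝ) : ℝ :=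
  √(q.1.1 ^ 2 + q.2) / 2 * φ (coneChart x' q)

theorem continuous_coneWeight (x' : Spacetime) (φ : 𝓢(Spacetime, ℝ)) :
    Continuous (coneWeight x' φ) := by
  have h := φ.continuous.comp (continuous_coneChart x')
  have h2 : Continuous fun q : (ℝ × Direction) × ℝ => √(q.1.1 ^ 2 + q.2) / 2 := by fun_prop
  exact h2.mul h

theorem norm_event_sq (t : ℝ) (y : EuclideanSpace ℝ (Fin 3)) :
    ‖event t y‖ ^ 2 = t ^ 2 + ‖y‖ ^ 2 := by
  rw [EuclideanSpace.norm_sq_eq, EuclideanSpace.norm_sq_eq, Fin.sum_univ_four, Fin.sum_univ_three]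
  simp [event]
  ring

/-- Decay of the test function beats the growth of the density uniformly in the direction and in
`u`, leaving a function integrable over `(t, ω)`. Thus any integrable function of the interval can
be tested, without any condition on its decay beyond that. -/
theorem exists_coneWeight_le (x' : Spacetime) (φ : 𝓢(Spacetime, ℝ)) :
    ∃ C : ℝ, ∀ q, ‖coneWeight x' φ q‖ ≤ C * (1 + q.1.1 ^ 2)⁻¹ := by
  -- Of the three powers one pays for the density `√(t² + u) / 2` and two for the factor `1 + t²`.
  obtain ⟨C, hC⟩ : ∃ C : ℝ, ∀ x : Spacetime, (1 + ‖x‖) ^ 3 * ‖φ x‖ ≤ C := by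
    refine ⟨2 ^ 3 * ((Finset.Iic (3, 0)).sup fun m => SchwartzMap.seminorm ℝ m.1 m.2) φ,
      fun x => ?_⟩
    simpa using SchwartzMap.one_add_le_sup_seminorm_apply (𝕜 := ℝ) (m := (3, 0)) le_rfl le_rfl φ x
  refine ⟨(1 + ‖x'‖) ^ 3 * C, fun q => ?_⟩
  obtain ⟨⟨t, ω⟩, u⟩ := q
  set r := √(t ^ 2 + u) with hr
  have hr0 : 0 ≤ r := Real.sqrt_nonneg _
  have hω : ‖(ω : EuclideanSpace ℝ (Fin 3))‖ = 1 := by simp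
  set z := event t (r • (ω : EuclideanSpace ℝ (Fin 3))) with hz
  have hz2 : ‖z‖ ^ 2 = t ^ 2 + r ^ 2 := by
    rw [hz, norm_event_sq, norm_smul, hω, mul_one, Real.norm_eq_abs, sq_abs]
  have hrz : r ≤ ‖z‖ := le_of_sq_le_sq (by nlinarith [sq_nonneg t]) (norm_nonneg z)
  have h1 : r / 2 * (1 + t ^ 2) ≤ (1 + ‖z‖) ^ 3 := by
    have ht : t ^ 2 ≤ ‖z‖ ^ 2 := by nlinarith
    calc r / 2 * (1 + t ^ 2) ≤ ‖z‖ * (1 + ‖z‖ ^ 2) :=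
          mul_le_mul (by linarith) (by linarith) (by positivity) (norm_nonneg z)
      _ ≤ (1 + ‖z‖) ^ 3 := by nlinarith [norm_nonneg z, sq_nonneg ‖z‖]
  have h2 : 1 + ‖z‖ ≤ (1 + ‖x'‖) * (1 + ‖x' + z‖) := by
    have : ‖z‖ ≤ ‖x' + z‖ + ‖x'‖ := by simpa using norm_sub_le (x' + z) x'
    nlinarith [norm_nonneg x', norm_nonneg (x' + z), mul_nonneg (norm_nonneg x') (norm_nonneg (x' + z))]
  have h3 : (1 + ‖z‖) ^ 3 ≤ (1 + ‖x'‖) ^ 3 * (1 + ‖x' + z‖) ^ 3 := by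
    rw [← mul_pow]
    exact pow_le_pow_left₀ (by positivity) h2 3
  rw [← div_eq_mul_inv, le_div_iff₀ (by positivity), coneWeight, norm_mul,
    Real.norm_of_nonneg (by positivity)]
  calc r / 2 * ‖φ (x' + z)‖ * (1 + t ^ 2) = r / 2 * (1 + t ^ 2) * ‖φ (x' + z)‖ := by ring
    _ ≤ (1 + ‖x'‖) ^ 3 * (1 + ‖x' + z‖) ^ 3 * ‖φ (x' + z)‖ :=
        mul_le_mul_of_nonneg_right (h1.trans h3) (norm_nonneg _)
    _ ≤ (1 + ‖x'‖) ^ 3 * C := by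
        rw [mul_assoc]
        exact mul_le_mul_of_nonneg_left (hC _) (by positivity)

theorem integrable_coneBound (C : ℝ) :
    Integrable (fun p : ℝ × Direction => C * (1 + p.1 ^ 2)⁻¹)
      ((volume : Measure ℝ).prod directionMeasure) := by
  have h := (integrable_inv_one_add_sq.const_mul C).mul_prod
    (integrable_const (1 : ℝ) (μ := directionMeasure))
  simpa using h

theorem coneChart_mul_comp_interval (x' : Spacetime) (φ : 𝓢(Spacetime, ℝ)) (h : ℝ → ℝ)
    (q : (ℝ × Direction) × ℝ) :
    √(q.1.1 ^ 2 + q.2) / 2 * (φ (coneChart x' q) * h (interval (coneChart x' q) x')) =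
      coneWeight x' φ q * h q.2 := by
  by_cases hq : coneDensity q = 0
  · have : √(q.1.1 ^ 2 + q.2) / 2 = 0 := by rw [← coe_coneDensity, hq, NNReal.coe_zero]
    rw [coneWeight, this]
    ring
  · rw [interval_coneChart x' hq, coneWeight]
    ring

theorem integrable_coneWeight_comp_mul (x' : Spacetime) (φ : 𝓢(Spacetime, ℝ)) (c : ℝ) {h : ℝ → ℝ}
    (hh : Integrable h) :
    Integrable (fun q : (ℝ × Direction) × ℝ => coneWeight x' φ (q.1, c * q.2) * h q.2)
      coneMeasure := by
  obtain ⟨C, hC⟩ := exists_coneWeight_le x' φ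
  refine ((integrable_coneBound C).mul_prod hh.norm).mono' ?_ (Eventually.of_forall fun q => ?_)
  · have hc : Continuous fun q : (ℝ × Direction) × ℝ => coneWeight x' φ (q.1, c * q.2) :=
      (continuous_coneWeight x' φ).comp (by fun_prop)
    exact hc.aestronglyMeasurable.mul hh.aestronglyMeasurable.comp_snd
  · rw [norm_mul]
    exact mul_le_mul_of_nonneg_right (hC _) (norm_nonneg _)

theorem measurable_mul_comp_interval (x' : Spacetime) (φ : 𝓢(Spacetime, ℝ)) {h : ℝ → ℝ}
    (hm : Measurable h) : Measurable fun x : Spacetime => φ x * h (interval x x') := by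
  have h1 : Measurable fun x : Spacetime => interval x x' := Continuous.measurable (by fun_prop)
  exact φ.continuous.measurable.mul (hm.comp h1)

theorem integrable_mul_comp_interval (x' : Spacetime) (φ : 𝓢(Spacetime, ℝ)) {h : ℝ → ℝ}
    (hm : Measurable h) (hh : Integrable h) :
    Integrable fun x : Spacetime => φ x * h (interval x x') := by
  rw [integrable_iff_coneChart x' (measurable_mul_comp_interval x' φ hm)]
  simp only [coneChart_mul_comp_interval]
  simpa using integrable_coneWeight_comp_mul x' φ 1 hh

theorem integral_mul_comp_interval_div (x' : Spacetime) (φ : 𝓢(Spacetime, ℝ)) {k : ℝ → ℝ}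
    (hm : Measurable k) (hk : Integrable k) {η : ℝ} (hη : 0 < η) :
    ∫ x : Spacetime, φ x * (η⁻¹ * k (interval x x' / η)) =
      ∫ q, coneWeight x' φ (q.1, η * q.2) * k q.2 ∂coneMeasure := by
  have hm' : Measurable fun u : ℝ => η⁻¹ * k (u / η) := by fun_prop
  have hk' : Integrable fun u : ℝ => η⁻¹ * k (u / η) := (hk.comp_div hη.ne').const_mul _
  have h1 := integrable_coneWeight_comp_mul x' φ 1 hk'
  simp only [one_mul] at h1
  have e := coneChart_mul_comp_interval x' φ fun u : ℝ => η⁻¹ * k (u / η)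
  rw [integral_eq_coneChart x' (measurable_mul_comp_interval x' φ hm')]
  simp only [e]
  rw [integral_prod _ h1, integral_prod _ (integrable_coneWeight_comp_mul x' φ η hk)]
  refine integral_congr_ae (Eventually.of_forall fun p => ?_)
  have h2 := Measure.integral_comp_mul_left (fun u => coneWeight x' φ (p, u) * (η⁻¹ * k (u / η))) η
  rw [abs_of_pos (inv_pos.mpr hη), smul_eq_mul, inv_mul_eq_div, eq_div_iff hη.ne'] at h2
  refine h2.symm.trans ?_
  rw [← integral_mul_const]
  refine integral_congr_ae (Eventually.of_forall fun v => ?_)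
  simp only [mul_div_cancel_left₀ _ hη.ne']
  field_simp

/-- The weight of the light cone against a test function, in the coordinates of `coneChart`. -/
def coneMass (x' : Spacetime) (φ : 𝓢(Spacetime, ℝ)) : ℝ :=
  ∫ p : ℝ × Direction, coneWeight x' φ (p, 0) ∂((volume : Measure ℝ).prod directionMeasure)

/-- After rescaling `u = η v` the weight is evaluated at `u = η v → 0`, so `η⁻¹ k(σ/η)` tends to `(∫
k) δ(σ)`. The Poisson kernel as `k` gives the delta function; an odd `k` gives the comparison of two
principal values. -/
theorem tendsto_integral_mul_comp_interval_div (x' : Spacetime) (φ : 𝓢(Spacetime, ℝ)) {k : ℝ → ℝ}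
    (hm : Measurable k) (hk : Integrable k) :
    Tendsto (fun η : ℝ => ∫ x : Spacetime, φ x * (η⁻¹ * k (interval x x' / η))) (𝓝[>] 0)
      (𝓝 (coneMass x' φ * ∫ v, k v)) := by
  have h : Tendsto (fun η : ℝ => ∫ q, coneWeight x' φ (q.1, η * q.2) * k q.2 ∂coneMeasure) (𝓝[>] 0)
      (𝓝 (∫ q, coneWeight x' φ (q.1, 0) * k q.2 ∂coneMeasure)) := by
    obtain ⟨C, hC⟩ := exists_coneWeight_le x' φ
    refine tendsto_integral_filter_of_dominated_convergence
      (fun q => C * (1 + q.1.1 ^ 2)⁻¹ * ‖k q.2‖) ?_ ?_ ((integrable_coneBound C).mul_prod hk.norm) ?_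
    · exact Eventually.of_forall fun η =>
        (integrable_coneWeight_comp_mul x' φ η hk).aestronglyMeasurable
    · refine Eventually.of_forall fun η => Eventually.of_forall fun q => ?_
      rw [norm_mul]
      exact mul_le_mul_of_nonneg_right (hC _) (norm_nonneg _)
    · refine Eventually.of_forall fun q => ?_
      have hc : Continuous fun η : ℝ => coneWeight x' φ (q.1, η * q.2) * k q.2 :=
        ((continuous_coneWeight x' φ).comp (by fun_prop)).mul continuous_const
      have := (hc.tendsto 0).mono_left (nhdsWithin_le_nhds (s := Set.Ioi 0))
      simpa using this
  rw [integral_prod_mul (fun p => coneWeight x' φ (p, 0)) k] at h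
  refine h.congr' ?_
  filter_upwards [self_mem_nhdsWithin] with η hη
  rw [integral_mul_comp_interval_div x' φ hm hk hη]

/-! ### The delta function of the light cone -/

theorem map_polar :
    ((((volume : Measure ℝ).restrict (Set.Ioi 0)).prod directionMeasure).withDensity
      fun p => (((p.1 ^ 2).toNNReal : NNReal) : ENNReal)).map
      (fun p : ℝ × Direction => p.1 • (p.2 : EuclideanSpace ℝ (Fin 3))) = volume := by
  refine Measure.ext_of_lintegral _ fun g hg => ?_
  have hΨ : Measurable fun p : ℝ × Direction => p.1 • (p.2 : EuclideanSpace ℝ (Fin 3)) :=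
    Continuous.measurable (by fun_prop)
  have hd : Measurable fun p : ℝ × Direction => (((p.1 ^ 2).toNNReal : NNReal) : ENNReal) := by
    fun_prop
  have hgΨ : Measurable fun p : ℝ × Direction => g (p.1 • (p.2 : EuclideanSpace ℝ (Fin 3))) :=
    hg.comp hΨ
  rw [lintegral_map hg hΨ, lintegral_withDensity_eq_lintegral_mul _ hd hgΨ, lintegral_polar hg]
  exact lintegral_prod_symm' _ (hd.mul hgΨ)

theorem measurable_lightConeIntegrand (x' : Spacetime) (φ : 𝓢(Spacetime, ℝ)) :
    Measurable (lightConeIntegrand x' φ) := by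
  have h1 : Continuous fun ξ : EuclideanSpace ℝ (Fin 3) => φ (x' + event ‖ξ‖ ξ) :=
    φ.continuous.comp (by fun_prop)
  have h2 : Continuous fun ξ : EuclideanSpace ℝ (Fin 3) => φ (x' + event (-‖ξ‖) ξ) :=
    φ.continuous.comp (by fun_prop)
  exact (h1.measurable.add h2.measurable).div (by fun_prop)

/-- The Jacobian `r²` times `1/(2r)` is `r/2`, the density `√(t² + u) / 2` at `u = 0` and `t = ±r`.
-/
theorem lightConeIntegrand_polar (x' : Spacetime) (φ : 𝓢(Spacetime, ℝ)) {p : ℝ × Direction}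
    (hp : 0 < p.1) :
    p.1 ^ 2 * lightConeIntegrand x' φ (p.1 • (p.2 : EuclideanSpace ℝ (Fin 3))) =
      coneWeight x' φ (p, 0) + coneWeight x' φ ((-p.1, p.2), 0) := by
  obtain ⟨r, ω⟩ := p
  have hr : 0 < r := hp
  have hω : ‖(ω : EuclideanSpace ℝ (Fin 3))‖ = 1 := by simp
  have hn : ‖r • (ω : EuclideanSpace ℝ (Fin 3))‖ = r := by
    rw [norm_smul, hω, mul_one, Real.norm_of_nonneg hr.le]
  change r ^ 2 * ((φ (x' + event ‖r • (ω : EuclideanSpace ℝ (Fin 3))‖ _) +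
    φ (x' + event (-‖r • (ω : EuclideanSpace ℝ (Fin 3))‖) _)) /
      (2 * ‖r • (ω : EuclideanSpace ℝ (Fin 3))‖)) = _
  simp only [coneWeight, coneChart, hn, add_zero, neg_sq, Real.sqrt_sq hr.le]
  field_simp

theorem integrable_coneWeight_zero (x' : Spacetime) (φ : 𝓢(Spacetime, ℝ)) :
    Integrable (fun p : ℝ × Direction => coneWeight x' φ (p, 0))
      ((volume : Measure ℝ).prod directionMeasure) := by
  obtain ⟨C, hC⟩ := exists_coneWeight_le x' φ
  refine (integrable_coneBound C).mono' ?_ (Eventually.of_forall fun p => hC (p, 0))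
  exact ((continuous_coneWeight x' φ).comp (by fun_prop)).aestronglyMeasurable

/-- In polar coordinates the future and past sheets `t = ±r` are the two halves of the time axis;
reflecting the past one joins them into the integral over all `t` at `u = 0`. -/
theorem integrable_and_integral_lightConeIntegrand (x' : Spacetime) (φ : 𝓢(Spacetime, ℝ)) :
    Integrable (lightConeIntegrand x' φ) ∧ lightConeDelta x' φ = coneMass x' φ := by
  set g : ℝ × Direction → ℝ := fun p => coneWeight x' φ (p, 0) with hg
  set ν := ((volume : Measure ℝ).restrict (Set.Ioi 0)).prod directionMeasure with hν
  have hle : ν ≤ (volume : Measure ℝ).prod directionMeasure := by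
    have : ν = ((volume : Measure ℝ).prod directionMeasure).restrict (Set.Ioi 0 ×ˢ Set.univ) := by
      rw [← Measure.prod_restrict, Measure.restrict_univ]
    rw [this]
    exact Measure.restrict_le_self
  have hgi := integrable_coneWeight_zero x' φ
  have hrefl : MeasurePreserving (Prod.map Neg.neg id : ℝ × Direction → ℝ × Direction)
      ((volume : Measure ℝ).prod directionMeasure) ((volume : Measure ℝ).prod directionMeasure) :=
    (Measure.measurePreserving_neg volume).prod (MeasurePreserving.id _)
  have hgi' : Integrable (fun p : ℝ × Direction => g (-p.1, p.2))
      ((volume : Measure ℝ).prod directionMeasure) :=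
    hrefl.integrable_comp_of_integrable hgi
  have h1 : Integrable g ν := hgi.mono_measure hle
  have h2 : Integrable (fun p : ℝ × Direction => g (-p.1, p.2)) ν := hgi'.mono_measure hle
  have hae : ∀ᵐ p ∂ν, (p.1 ^ 2).toNNReal • lightConeIntegrand x' φ
      (p.1 • (p.2 : EuclideanSpace ℝ (Fin 3))) = g p + g (-p.1, p.2) := by
    have hpos : ∀ᵐ p : ℝ × Direction ∂ν, 0 < p.1 :=
      Measure.quasiMeasurePreserving_fst.ae (ae_restrict_mem measurableSet_Ioi)
    filter_upwards [hpos] with p hp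
    rw [NNReal.smul_def, Real.coe_toNNReal _ (sq_nonneg _), smul_eq_mul,
      lightConeIntegrand_polar x' φ hp]
  have hΨ : Measurable fun p : ℝ × Direction => p.1 • (p.2 : EuclideanSpace ℝ (Fin 3)) :=
    Continuous.measurable (by fun_prop)
  have hd : Measurable fun p : ℝ × Direction => (p.1 ^ 2).toNNReal := by fun_prop
  have hm := measurable_lightConeIntegrand x' φ
  constructor
  · rw [← map_polar, integrable_map_measure hm.aestronglyMeasurable hΨ.aemeasurable,
      integrable_withDensity_iff_integrable_smul hd]
    exact (h1.add h2).congr (hae.mono fun p hp => hp.symm)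
  · have e1 : lightConeDelta x' φ = ∫ p, (g p + g (-p.1, p.2)) ∂ν := by
      rw [lightConeDelta]
      conv_lhs => rw [← map_polar]
      rw [integral_map hΨ.aemeasurable hm.aestronglyMeasurable,
        integral_withDensity_eq_integral_smul hd]
      exact integral_congr_ae hae
    have e2 : coneMass x' φ = ∫ t : ℝ, ∫ ω, g (t, ω) ∂directionMeasure := integral_prod _ hgi
    have hG : Integrable fun t : ℝ => ∫ ω, g (t, ω) ∂directionMeasure := hgi.integral_prod_left
    rw [e1, e2, integral_add h1 h2, hν, integral_prod _ h1, integral_prod _ h2]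
    simp only
    rw [integral_comp_neg_Ioi 0 fun t : ℝ => ∫ ω, g (t, ω) ∂directionMeasure, neg_zero, add_comm,
      intervalIntegral.integral_Iic_add_Ioi hG.integrableOn hG.integrableOn]

end

noncomputable section

/-! ### The regularised kernel and its boundary value -/

/-- Dominated convergence from the right at `0`, with integrability of the limit. -/
theorem integrable_and_tendsto_integral {F : ℝ → Spacetime → ℂ} {f : Spacetime → ℂ}
    {bound : Spacetime → ℝ} (hF : ∀ η, 0 < η → AEStronglyMeasurable (F η))
    (hb : ∀ᵐ x, ∀ η, 0 < η → η ≤ 1 → ‖F η x‖ ≤ bound x) (hbound : Integrable bound)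
    (hlim : ∀ᵐ x, Tendsto (fun η => F η x) (𝓝[>] 0) (𝓝 (f x))) :
    Integrable f ∧ Tendsto (fun η => ∫ x, F η x) (𝓝[>] 0) (𝓝 (∫ x, f x)) := by
  have hsmall : ∀ᶠ η : ℝ in 𝓝[>] 0, 0 < η ∧ η ≤ 1 := by
    filter_upwards [Ioc_mem_nhdsGT (zero_lt_one' ℝ)] with η hη using hη
  refine ⟨hbound.mono' ?_ ?_, ?_⟩
  · have hu : Tendsto (fun n : ℕ => 1 / ((n : ℝ) + 1)) atTop (𝓝[>] 0) :=
      tendsto_nhdsWithin_iff.mpr ⟨tendsto_one_div_add_atTop_nhds_zero_nat,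
        Eventually.of_forall fun n => Set.mem_Ioi.mpr Nat.one_div_pos_of_nat⟩
    exact aestronglyMeasurable_of_tendsto_ae atTop (fun n : ℕ => hF _ Nat.one_div_pos_of_nat)
      (hlim.mono fun x hx => hx.comp hu)
  · filter_upwards [hb, hlim] with x hx hl
    exact le_of_tendsto hl.norm (hsmall.mono fun η hη => hx η hη.1 hη.2)
  · refine tendsto_integral_filter_of_dominated_convergence bound ?_ ?_ hbound hlim
    · exact hsmall.mono fun η hη => hF η hη.1
    · exact hsmall.mono fun η hη => hb.mono fun x hx => hx η hη.1 hη.2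

/-- The kernel at equal regularisations `ε = δ = η` of the squared mass and the interval. -/
def regularKernel (m η σ : ℝ) : ℂ :=
  schwingerKernel ((m : ℂ) ^ 2 - Complex.I * (η : ℂ)) ((σ : ℂ) + Complex.I * (η : ℂ))

/-- The less singular part of `regularKernel`, up to normalisation. -/
def regularRemainder (m η σ : ℝ) : ℂ :=
  besselRemainder (Complex.I * ((m : ℂ) ^ 2 - Complex.I * (η : ℂ)))
    (-(Complex.I * ((σ : ℂ) + Complex.I * (η : ℂ))))

/-- This is `4/(η - iσ) = 4(η + iσ)/(η² + σ²)`. The real part is put in the form `η⁻¹ k(σ/η)` of an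
approximate identity; the imaginary part smooths `4/σ`. -/
theorem four_div_regular (σ : ℝ) {η : ℝ} (hη : 0 < η) :
    4 / (-(Complex.I * ((σ : ℂ) + Complex.I * (η : ℂ)))) =
      ((η⁻¹ * (4 * (1 + (σ / η) ^ 2)⁻¹) : ℝ) : ℂ) + ((4 * (σ / (η ^ 2 + σ ^ 2)) : ℝ) : ℂ) * Complex.I := by
  have hη' : (η : ℂ) ≠ 0 := by exact_mod_cast hη.ne'
  have hp : 0 < η ^ 2 + σ ^ 2 := by positivity
  have hp' : (η : ℂ) ^ 2 + (σ : ℂ) ^ 2 ≠ 0 := by exact_mod_cast hp.ne'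
  have hne : -(Complex.I * ((σ : ℂ) + Complex.I * (η : ℂ))) ≠ 0 := by
    intro h
    have := congrArg Complex.re h
    simp at this
    exact hη.ne' this
  have e : (η⁻¹ * (4 * (1 + (σ / η) ^ 2)⁻¹) : ℝ) = 4 * (η / (η ^ 2 + σ ^ 2)) := by
    field_simp
  rw [e, div_eq_iff hne]
  push_cast
  field_simp
  linear_combination ((η : ℂ) ^ 2 + (σ : ℂ) ^ 2 + σ * η * Complex.I) * Complex.I_sq

theorem regularKernel_eq (m σ : ℝ) {η : ℝ} (hη : 0 < η) :
    regularKernel m η σ = 1 / (4 * (Real.pi : ℂ)) ^ 2 *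
      (4 / (-(Complex.I * ((σ : ℂ) + Complex.I * (η : ℂ)))) + regularRemainder m η σ) := by
  rw [regularKernel, schwingerKernel_eq_closedKernel (sub_I_mul_im_neg m hη) (add_I_mul_im_pos σ hη)]
  rfl

theorem abs_le_norm_regular (σ η : ℝ) :
    |σ| ≤ ‖-(Complex.I * ((σ : ℂ) + Complex.I * (η : ℂ)))‖ := by
  have h := Complex.abs_re_le_norm ((σ : ℂ) + Complex.I * (η : ℂ))
  rw [norm_neg, norm_mul, Complex.norm_I, one_mul]
  simpa using h

theorem norm_regularRemainder_le (m σ : ℝ) {η c : ℝ} (hη : 0 < η) (hη1 : η ≤ 1) (hc : 0 < c)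
    (hc1 : c ≤ 1) (hcσ : c ≤ |σ|) :
    ‖regularRemainder m η σ‖ ≤ 12 * (m ^ 2 + 1) + 2 + 2 * (m ^ 2 + 1) * Real.log (1 / c) := by
  have h := norm_besselRemainder_le (A := Complex.I * ((m : ℂ) ^ 2 - Complex.I * (η : ℂ)))
    (B := -(Complex.I * ((σ : ℂ) + Complex.I * (η : ℂ))))
    (by rw [I_mul_re]; linarith [sub_I_mul_im_neg m hη])
    (by rw [neg_I_mul_re]; exact add_I_mul_im_pos σ hη) hc hc1
    (hcσ.trans (abs_le_norm_regular σ η))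
  have hA : ‖Complex.I * ((m : ℂ) ^ 2 - Complex.I * (η : ℂ))‖ ≤ m ^ 2 + 1 := by
    rw [norm_mul, Complex.norm_I, one_mul]
    refine (norm_sub_le _ _).trans ?_
    rw [norm_mul, Complex.norm_I, one_mul, norm_pow, Complex.norm_real, Complex.norm_real,
      Real.norm_of_nonneg hη.le, Real.norm_eq_abs, sq_abs]
    linarith
  have hL : 0 ≤ Real.log (1 / c) := Real.log_nonneg (by rw [le_div_iff₀ hc]; linarith)
  have := mul_le_mul_of_nonneg_right hA hL
  rw [regularRemainder]
  linarith

theorem tendsto_regularRemainder {m σ : ℝ} (hm : 0 < m) (hσ : σ ≠ 0) :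
    Tendsto (fun η => regularRemainder m η σ) (𝓝[>] 0) (𝓝 (regularRemainder m 0 σ)) := by
  have hA := I_mul_ofReal_mem_slitPlane (x := m ^ 2) (by positivity)
  have hB := I_mul_ofReal_mem_slitPlane (x := -σ) (neg_ne_zero.mpr hσ)
  have h := (analyticAt_besselRemainder (q := (Complex.I * ((m : ℂ) ^ 2 - Complex.I * ((0 : ℝ) : ℂ)),
    -(Complex.I * ((σ : ℂ) + Complex.I * ((0 : ℝ) : ℂ))))) (by simpa using hA)
    (by simpa using hB)).continuousAt
  have hc : ContinuousAt (fun η : ℝ => (Complex.I * ((m : ℂ) ^ 2 - Complex.I * (η : ℂ)),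
    -(Complex.I * ((σ : ℂ) + Complex.I * (η : ℂ))))) 0 := by fun_prop
  exact (ContinuousAt.comp (f := fun η : ℝ => (Complex.I * ((m : ℂ) ^ 2 - Complex.I * (η : ℂ)),
    -(Complex.I * ((σ : ℂ) + Complex.I * (η : ℂ))))) h hc).tendsto.mono_left nhdsWithin_le_nhds

/-- Since the two-parameter limits exist, their values may be computed along `ε = δ = η`. -/
theorem tendsto_diagonal : Tendsto (fun η : ℝ => (η, η)) (𝓝[>] 0) (𝓝[>] 0 ×ˢ 𝓝[>] 0) :=
  tendsto_id.prodMk tendsto_id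

theorem tendsto_regularKernel {m σ : ℝ} (hm : 0 < m) (hσ : σ ≠ 0) :
    Tendsto (fun η => regularKernel m η σ) (𝓝[>] 0) (𝓝 (boundaryKernel m σ)) := by
  have h := (tendsto_schwingerKernel hm hσ).comp tendsto_diagonal
  simpa only [Function.comp_def, regularKernel] using h

theorem integrable_mul_regularKernel (m : ℝ) (x' : Spacetime) (φ : 𝓢(Spacetime, ℂ)) {η : ℝ}
    (hη : 0 < η) : Integrable fun x : Spacetime => φ x * regularKernel m η (interval x x') :=
  integrable_mul_schwingerKernel m x' φ hη hη

theorem tendsto_integral_mul_regularKernel (m : ℝ) (x' : Spacetime) (φ : 𝓢(Spacetime, ℂ)) :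
    Tendsto (fun η => ∫ x : Spacetime, φ x * regularKernel m η (interval x x')) (𝓝[>] 0)
      (𝓝 (feynmanPropagator m x' φ)) := by
  have h := (tendsto_integral_mul_schwingerKernel m x' φ).comp tendsto_diagonal
  simpa only [Function.comp_def, regularKernel] using h

/-! ### The propagator away from the light cone -/

/-- On a compact support off the cone `|σ|` is bounded below, so the regularised kernels are bounded
uniformly in `η ≤ 1` and dominated convergence identifies the limit. -/
theorem feynmanPropagator_of_interval_ne_zero {m : ℝ} (hm : 0 < m) (x' : Spacetime)
    (φ : 𝓢(Spacetime, ℂ)) (hφ : HasCompactSupport φ)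
    (hne : ∀ x ∈ tsupport φ, interval x x' ≠ 0) :
    Integrable (fun x : Spacetime => φ x * boundaryKernel m (interval x x')) ∧
      feynmanPropagator m x' φ = ∫ x : Spacetime, φ x * boundaryKernel m (interval x x') := by
  obtain ⟨c₀, hc₀, hmin⟩ := IsCompact.exists_forall_le' (f := fun x => |interval x x'|) hφ
    (Continuous.continuousOn (by fun_prop)) (a := 0) fun x hx => abs_pos.mpr (hne x hx)
  set c := min c₀ 1
  have hc : 0 < c := lt_min hc₀ one_pos
  set D := 4 / c + (12 * (m ^ 2 + 1) + 2 + 2 * (m ^ 2 + 1) * Real.log (1 / c))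
  have h := integrable_and_tendsto_integral
    (F := fun η x => φ x * regularKernel m η (interval x x'))
    (f := fun x => φ x * boundaryKernel m (interval x x'))
    (bound := fun x => ‖φ x‖ * (‖1 / (4 * (Real.pi : ℂ)) ^ 2‖ * D))
    (fun η hη => (integrable_mul_regularKernel m x' φ hη).aestronglyMeasurable) ?_
    ((φ.integrable (μ := volume)).norm.mul_const _) ?_
  · exact ⟨h.1, tendsto_nhds_unique (tendsto_integral_mul_regularKernel m x' φ) h.2⟩
  · refine Eventually.of_forall fun x η hη hη1 => ?_
    rw [norm_mul]
    by_cases hx : x ∈ tsupport φ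
    · have hcx : c ≤ |interval x x'| := (min_le_left _ _).trans (hmin x hx)
      refine mul_le_mul_of_nonneg_left ?_ (norm_nonneg _)
      rw [regularKernel_eq m _ hη, norm_mul]
      refine mul_le_mul_of_nonneg_left ((norm_add_le _ _).trans (add_le_add ?_
        (norm_regularRemainder_le m _ hη hη1 hc (min_le_right _ _) hcx))) (norm_nonneg _)
      rw [norm_div, Complex.norm_ofNat]
      exact div_le_div_of_nonneg_left (by norm_num) hc (hcx.trans (abs_le_norm_regular _ η))
    · rw [image_eq_zero_of_notMem_tsupport hx]
      simp
  · refine Eventually.of_forall fun x => ?_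
    by_cases hx : x ∈ tsupport φ
    · exact (tendsto_regularKernel hm (hne x hx)).const_mul _
    · simp only [image_eq_zero_of_notMem_tsupport hx, zero_mul]
      exact tendsto_const_nhds

theorem feynmanPropagator_timelike {m : ℝ} (hm : 0 < m) (x' : Spacetime)
    (φ : 𝓢(Spacetime, ℂ)) (hφ : HasCompactSupport φ)
    (hsub : tsupport φ ⊆ {x : Spacetime | interval x x' < 0}) :
    Integrable (fun x : Spacetime =>
        φ x * hankelForm m ((m * √(-interval x x') : ℝ) : ℂ)) ∧
      feynmanPropagator m x' φ =
        ∫ x : Spacetime, φ x * hankelForm m ((m * √(-interval x x') : ℝ) : ℂ) := by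
  have h := feynmanPropagator_of_interval_ne_zero hm x' φ hφ fun x hx => (hsub hx).ne
  have e : (fun x : Spacetime => φ x * boundaryKernel m (interval x x')) =
      fun x => φ x * hankelForm m ((m * √(-interval x x') : ℝ) : ℂ) := by
    funext x
    by_cases hx : x ∈ tsupport φ
    · rw [boundaryKernel_of_neg hm (hsub hx)]
    · rw [image_eq_zero_of_notMem_tsupport hx, zero_mul, zero_mul]
  rwa [e] at h

theorem feynmanPropagator_spacelike {m : ℝ} (hm : 0 < m) (x' : Spacetime)
    (φ : 𝓢(Spacetime, ℂ)) (hφ : HasCompactSupport φ)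
    (hsub : tsupport φ ⊆ {x : Spacetime | 0 < interval x x'}) :
    Integrable (fun x : Spacetime =>
        φ x * hankelForm m (-Complex.I * ((m * √(interval x x') : ℝ) : ℂ))) ∧
      feynmanPropagator m x' φ =
        ∫ x : Spacetime, φ x * hankelForm m (-Complex.I * ((m * √(interval x x') : ℝ) : ℂ)) := by
  have h := feynmanPropagator_of_interval_ne_zero hm x' φ hφ fun x hx => (hsub hx).ne'
  have e : (fun x : Spacetime => φ x * boundaryKernel m (interval x x')) =
      fun x => φ x * hankelForm m (-Complex.I * ((m * √(interval x x') : ℝ) : ℂ)) := by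
    funext x
    by_cases hx : x ∈ tsupport φ
    · rw [boundaryKernel_of_pos hm (hsub hx)]
    · rw [image_eq_zero_of_notMem_tsupport hx, zero_mul, zero_mul]
  rwa [e] at h

/-! ### The regular part near the light cone -/

/-- The logarithmic bound `log⁺ (1 / |u|)`. -/
def logSingularity (u : ℝ) : ℝ := Real.log (1 / min |u| 1)

theorem logSingularity_eq :
    logSingularity = (Set.Ioc (-1) 1).indicator fun u => -Real.log u := by
  funext u
  rw [logSingularity, one_div, Real.log_inv]
  by_cases hu : u ∈ Set.Ioc (-1 : ℝ) 1
  · rw [Set.indicator_of_mem hu, min_eq_left (abs_le.mpr ⟨hu.1.le, hu.2⟩), Real.log_abs]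
  · have h1 : 1 ≤ |u| := by
      by_contra hc
      have := abs_lt.mp (not_le.mp hc)
      exact hu ⟨this.1, this.2.le⟩
    rw [Set.indicator_of_notMem hu, min_eq_right h1, Real.log_one, neg_zero]

theorem measurable_logSingularity : Measurable logSingularity := by
  unfold logSingularity; fun_prop

theorem integrable_logSingularity : Integrable logSingularity := by
  rw [logSingularity_eq, integrable_indicator_iff measurableSet_Ioc]
  have h := intervalIntegral.intervalIntegrable_log' (a := -1) (b := 1)
  rw [intervalIntegrable_iff_integrableOn_Ioc_of_le (by norm_num)] at h
  exact h.neg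

theorem complexify_apply (φ : 𝓢(Spacetime, ℝ)) (x : Spacetime) : complexify φ x = (φ x : ℂ) := rfl

theorem integrable_ofReal_mul_four_div (x' : Spacetime) (φ : 𝓢(Spacetime, ℝ)) {η : ℝ} (hη : 0 < η) :
    Integrable fun x : Spacetime => (φ x : ℂ) *
      (4 / (-(Complex.I * ((interval x x' : ℂ) + Complex.I * (η : ℂ))))) := by
  have hre : ∀ σ : ℝ, (-(Complex.I * ((σ : ℂ) + Complex.I * (η : ℂ)))).re = η := fun σ => by simp
  have hne : ∀ σ : ℝ, -(Complex.I * ((σ : ℂ) + Complex.I * (η : ℂ))) ≠ 0 := fun σ h => by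
    have := hre σ
    rw [h] at this
    exact hη.ne this
  refine ((φ.integrable (μ := volume)).norm.mul_const (4 / η)).mono' ?_
    (Eventually.of_forall fun x => ?_)
  · have h1 : Continuous fun x : Spacetime => (φ x : ℂ) :=
      Complex.continuous_ofReal.comp φ.continuous
    refine (h1.mul (continuous_const.div ?_ fun x => hne _)).aestronglyMeasurable
    fun_prop
  · rw [norm_mul, Complex.norm_real, norm_div, Complex.norm_ofNat]
    refine mul_le_mul_of_nonneg_left (div_le_div_of_nonneg_left (by norm_num) hη ?_) (norm_nonneg _)
    have := Complex.re_le_norm (-(Complex.I * ((interval x x' : ℂ) + Complex.I * (η : ℂ))))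
    rwa [hre] at this

theorem integrable_ofReal_mul_regularRemainder (m : ℝ) (x' : Spacetime) (φ : 𝓢(Spacetime, ℝ))
    {η : ℝ} (hη : 0 < η) :
    Integrable fun x : Spacetime => (φ x : ℂ) * regularRemainder m η (interval x x') := by
  have h := ((integrable_mul_regularKernel m x' (complexify φ) hη).const_mul
    ((4 * (Real.pi : ℂ)) ^ 2)).sub (integrable_ofReal_mul_four_div x' φ hη)
  have hpi : (Real.pi : ℂ) ≠ 0 := by exact_mod_cast Real.pi_ne_zero
  refine h.congr (Eventually.of_forall fun x => ?_)
  simp only [Pi.sub_apply, complexify_apply]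
  rw [regularKernel_eq m _ hη]
  field_simp
  ring

/-- Uniformly in `η ≤ 1` the remainder is at most a constant plus a multiple of `logSingularity`.
The latter is integrable in the interval, hence against a test function, so nothing concentrates on
the cone. -/
theorem integrable_and_tendsto_regularRemainder {m : ℝ} (hm : 0 < m) (x' : Spacetime)
    (φ : 𝓢(Spacetime, ℝ)) :
    Integrable (fun x : Spacetime => (φ x : ℂ) * regularRemainder m 0 (interval x x')) ∧
      Tendsto (fun η => ∫ x : Spacetime, (φ x : ℂ) * regularRemainder m η (interval x x')) (𝓝[>] 0)
        (𝓝 (∫ x : Spacetime, (φ x : ℂ) * regularRemainder m 0 (interval x x'))) := by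
  refine integrable_and_tendsto_integral
    (bound := fun x => ‖φ x‖ * (12 * (m ^ 2 + 1) + 2) +
      2 * (m ^ 2 + 1) * ‖φ x * logSingularity (interval x x')‖)
    (fun η hη => (integrable_ofReal_mul_regularRemainder m x' φ hη).aestronglyMeasurable) ?_ ?_ ?_
  · filter_upwards [ae_interval_ne_zero x'] with x hx η hη hη1
    have h := norm_regularRemainder_le m (interval x x') hη hη1
      (lt_min (abs_pos.mpr hx) one_pos) (min_le_right _ _) (min_le_left _ _)
    have h2 : logSingularity (interval x x') ≤ ‖logSingularity (interval x x')‖ := le_abs_self _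
    rw [norm_mul, norm_mul, Complex.norm_real]
    calc ‖φ x‖ * ‖regularRemainder m η (interval x x')‖
        ≤ ‖φ x‖ * (12 * (m ^ 2 + 1) + 2 + 2 * (m ^ 2 + 1) * ‖logSingularity (interval x x')‖) :=
          mul_le_mul_of_nonneg_left
            (h.trans (add_le_add le_rfl (mul_le_mul_of_nonneg_left h2 (by positivity))))
            (norm_nonneg _)
      _ = _ := by ring
  · exact ((φ.integrable (μ := volume)).norm.mul_const _).add
      ((integrable_mul_comp_interval x' φ measurable_logSingularity
        integrable_logSingularity).norm.const_mul _)
  · filter_upwards [ae_interval_ne_zero x'] with x hx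
    exact (tendsto_regularRemainder hm hx).const_mul _

theorem regularRemainder_zero_eq {m σ : ℝ} {L : ℂ} (hm : 0 < m)
    (hL : Complex.log (-(Complex.I * (σ : ℂ))) = L) :
    regularRemainder m 0 σ = 4 * Complex.I * (m : ℂ) ^ 2 *
      (((2 * (Real.log m : ℂ) + Real.pi / 2 * Complex.I + L) / 2 + (besselConst : ℂ)) *
        (coneSeries (m ^ 2 * σ) : ℂ) - (coneSeries' (m ^ 2 * σ) : ℂ)) := by
  have e1 : (m : ℂ) ^ 2 - Complex.I * ((0 : ℝ) : ℂ) = (m : ℂ) ^ 2 := by simp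
  have e2 : (σ : ℂ) + Complex.I * ((0 : ℝ) : ℂ) = (σ : ℂ) := by simp
  rw [regularRemainder, e1, e2, besselRemainder, log_I_mul_sq hm, hL, I_mul_sq_mul, coneSum_ofReal,
    coneSum'_ofReal]
  ring

/-- The regular part of `G^{(1)}`, up to normalisation. -/
def hadamardRemainder (m σ : ℝ) : ℝ :=
  4 * m ^ 2 * ((Real.eulerMascheroniConstant - Real.log 2 + Real.log m + Real.log |σ| / 2) *
    coneSeries (m ^ 2 * σ) - coneSeries' (m ^ 2 * σ))

/-- The regular part of `Ḡ`, up to normalisation. -/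
def timelikeRemainder (m σ : ℝ) : ℝ :=
  if σ < 0 then -(2 * Real.pi * m ^ 2) * coneSeries (m ^ 2 * σ) else 0

/-- For `σ < 0` the phases add to `iπ`, and `4im² · iπ/2 = -2πm²` gives the real part; for `σ > 0`
they cancel. -/
theorem regularRemainder_zero {m σ : ℝ} (hm : 0 < m) (hσ : σ ≠ 0) :
    regularRemainder m 0 σ = (timelikeRemainder m σ : ℂ) + (hadamardRemainder m σ : ℂ) * Complex.I := by
  rcases hσ.lt_or_gt with h | h
  · rw [regularRemainder_zero_eq hm (log_neg_I_mul_of_neg h), timelikeRemainder, if_pos h,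
      hadamardRemainder, besselConst]
    push_cast
    linear_combination 2 * (Real.pi : ℂ) * m ^ 2 * coneSeries (m ^ 2 * σ) * Complex.I_sq
  · rw [regularRemainder_zero_eq hm (log_neg_I_mul_of_pos h), timelikeRemainder, if_neg h.not_gt,
      hadamardRemainder, besselConst]
    push_cast
    ring

theorem hadamardExpansion_eq {m : ℝ} (hm : 0 < m) (σ : ℝ) :
    hadamardExpansion m σ = 1 / (8 * Real.pi ^ 2) * (4 * σ⁻¹ + hadamardRemainder m σ) := by
  rw [hadamardExpansion, hadamardRemainder]
  have := Real.pi_ne_zero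
  -- At `σ = 0` both reciprocals are zero by convention, so the identity needs no restriction on
  -- `σ`.
  by_cases hσ : σ = 0
  · simp [hσ]
    field_simp
    ring
  · field_simp
    ring

end

noncomputable section

/-! ### The singular structure on the light cone -/

theorem re_integral_ofReal_mul {φ : Spacetime → ℝ} {f : Spacetime → ℂ}
    (h : Integrable fun x => (φ x : ℂ) * f x) :
    (∫ x, (φ x : ℂ) * f x).re = ∫ x, φ x * (f x).re := by
  have e := integral_re h
  simp only [RCLike.re_to_complex, Complex.re_ofReal_mul] at e
  exact e.symm

theorem im_integral_ofReal_mul {φ : Spacetime → ℝ} {f : Spacetime → ℂ}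
    (h : Integrable fun x => (φ x : ℂ) * f x) :
    (∫ x, (φ x : ℂ) * f x).im = ∫ x, φ x * (f x).im := by
  have e := integral_im h
  simp only [RCLike.im_to_complex, Complex.im_ofReal_mul] at e
  exact e.symm

theorem integrable_re_ofReal_mul {φ : Spacetime → ℝ} {f : Spacetime → ℂ}
    (h : Integrable fun x => (φ x : ℂ) * f x) : Integrable fun x => φ x * (f x).re := by
  have e := h.re
  simpa only [RCLike.re_to_complex, Complex.re_ofReal_mul] using e

theorem integrable_im_ofReal_mul {φ : Spacetime → ℝ} {f : Spacetime → ℂ}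
    (h : Integrable fun x => (φ x : ℂ) * f x) : Integrable fun x => φ x * (f x).im := by
  have e := h.im
  simpa only [RCLike.im_to_complex, Complex.im_ofReal_mul] using e

theorem regularRemainder_zero_re {m σ : ℝ} (hm : 0 < m) (hσ : σ ≠ 0) :
    (regularRemainder m 0 σ).re = timelikeRemainder m σ := by
  rw [regularRemainder_zero hm hσ]; simp

theorem regularRemainder_zero_im {m σ : ℝ} (hm : 0 < m) (hσ : σ ≠ 0) :
    (regularRemainder m 0 σ).im = hadamardRemainder m σ := by
  rw [regularRemainder_zero hm hσ]; simp

theorem integral_mul_regularKernel_eq (m : ℝ) (x' : Spacetime) (φ : 𝓢(Spacetime, ℝ)) {η : ℝ}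
    (hη : 0 < η) :
    ∫ x : Spacetime, complexify φ x * regularKernel m η (interval x x') =
      ((1 / (16 * Real.pi ^ 2) : ℝ) : ℂ) *
        ((∫ x : Spacetime, (φ x : ℂ) *
            (4 / (-(Complex.I * ((interval x x' : ℂ) + Complex.I * (η : ℂ)))))) +
          ∫ x : Spacetime, (φ x : ℂ) * regularRemainder m η (interval x x')) := by
  rw [← integral_add (integrable_ofReal_mul_four_div x' φ hη)
    (integrable_ofReal_mul_regularRemainder m x' φ hη), ← integral_const_mul]
  refine integral_congr_ae (Eventually.of_forall fun x => ?_)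
  simp only [complexify_apply]
  rw [regularKernel_eq m _ hη]
  push_cast
  ring

theorem four_div_regular_re (σ : ℝ) {η : ℝ} (hη : 0 < η) :
    (4 / (-(Complex.I * ((σ : ℂ) + Complex.I * (η : ℂ))))).re = η⁻¹ * (4 * (1 + (σ / η) ^ 2)⁻¹) := by
  rw [four_div_regular σ hη, Complex.add_re, Complex.ofReal_re, Complex.re_ofReal_mul]
  simp

theorem four_div_regular_im (σ : ℝ) {η : ℝ} (hη : 0 < η) :
    (4 / (-(Complex.I * ((σ : ℂ) + Complex.I * (η : ℂ))))).im = 4 * (σ / (η ^ 2 + σ ^ 2)) := by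
  rw [four_div_regular σ hη, Complex.add_im, Complex.ofReal_im, Complex.im_ofReal_mul]
  simp

/-- The Poisson kernel has mass `∫ 4/(1 + v²) dv = 4π`, and `4π / (16π²) = 1/(4π)`; the remainder
contributes `-2πm² / (16π²) = -m²/(8π)` inside the cone and nothing outside. -/
theorem barG_feynmanPropagator {m : ℝ} (hm : 0 < m) (x' : Spacetime) (φ : 𝓢(Spacetime, ℝ)) :
    IntegrableOn (fun x : Spacetime => φ x * coneSeries (m ^ 2 * interval x x'))
        {x : Spacetime | interval x x' < 0} ∧
      barG (feynmanPropagator m x') φ = 1 / (4 * Real.pi) * lightConeDelta x' φ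
        - m ^ 2 / (8 * Real.pi) * ∫ x in {x : Spacetime | interval x x' < 0},
            φ x * coneSeries (m ^ 2 * interval x x') := by
  have hset : MeasurableSet {x : Spacetime | interval x x' < 0} :=
    (isOpen_lt (by fun_prop) continuous_const).measurableSet
  have hpi := Real.pi_pos
  obtain ⟨hi, ht⟩ := integrable_and_tendsto_regularRemainder hm x' φ
  have hae : (fun x : Spacetime => φ x * (regularRemainder m 0 (interval x x')).re) =ᵐ[volume]
      fun x => -(2 * Real.pi * m ^ 2) * {x : Spacetime | interval x x' < 0}.indicator
        (fun x => φ x * coneSeries (m ^ 2 * interval x x')) x := by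
    filter_upwards [ae_interval_ne_zero x'] with x hx
    rw [regularRemainder_zero_re hm hx, timelikeRemainder]
    by_cases h : interval x x' < 0
    · rw [if_pos h, Set.indicator_of_mem (by exact h)]
      ring
    · rw [if_neg h, Set.indicator_of_notMem (by exact h)]
      ring
  have hind := (integrable_congr hae).mp (integrable_re_ofReal_mul hi)
  rw [integrable_const_mul_iff (by simp [hpi.ne', hm.ne']), integrable_indicator_iff hset] at hind
  refine ⟨hind, ?_⟩
  have hpoisson := tendsto_integral_mul_comp_interval_div x' φ
    (k := fun v => 4 * (1 + v ^ 2)⁻¹) (by fun_prop) (integrable_inv_one_add_sq.const_mul 4)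
  rw [integral_const_mul, integral_univ_inv_one_add_sq] at hpoisson
  have hrem := (Complex.continuous_re.tendsto _).comp ht
  have hlim := (hpoisson.add hrem).const_mul (1 / (16 * Real.pi ^ 2))
  have hG := (Complex.continuous_re.tendsto _).comp
    (tendsto_integral_mul_regularKernel m x' (complexify φ))
  have huniq := tendsto_nhds_unique (hG.congr' ?_) hlim
  · rw [barG, huniq, (integrable_and_integral_lightConeIntegrand x' φ).2, re_integral_ofReal_mul hi,
      integral_congr_ae hae, integral_const_mul, integral_indicator hset]
    field_simp
    ring
  · filter_upwards [self_mem_nhdsWithin] with η hη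
    simp only [Function.comp_apply]
    rw [integral_mul_regularKernel_eq m x' φ hη, Complex.re_ofReal_mul, Complex.add_re,
      re_integral_ofReal_mul (integrable_ofReal_mul_four_div x' φ hη)]
    simp only [four_div_regular_re _ hη]

/-- The difference of the truncated and the smoothed reciprocals, at unit scale. -/
def principalValueKernel (v : ℝ) : ℝ := (if 1 < |v| then v⁻¹ else 0) - v / (1 + v ^ 2)

theorem measurable_principalValueKernel : Measurable principalValueKernel := by
  unfold principalValueKernel
  refine (Measurable.ite (measurableSet_lt measurable_const (by fun_prop)) (by fun_prop)
    (by fun_prop)).sub (by fun_prop)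

/-- Neither reciprocal is integrable at infinity, but for `|v| > 1` their difference is `v⁻¹ / (1 +
v²)`. -/
theorem abs_principalValueKernel_le (v : ℝ) : ‖principalValueKernel v‖ ≤ (1 + v ^ 2)⁻¹ := by
  have hp : 0 < 1 + v ^ 2 := by positivity
  rw [principalValueKernel, Real.norm_eq_abs]
  split_ifs with h
  · have hv : v ≠ 0 := fun h0 => by norm_num [h0] at h
    have e : v⁻¹ - v / (1 + v ^ 2) = v⁻¹ * (1 + v ^ 2)⁻¹ := by
      field_simp
      ring
    rw [e, abs_mul, abs_inv, abs_of_pos (inv_pos.mpr hp)]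
    exact mul_le_of_le_one_left (inv_pos.mpr hp).le (inv_le_one_of_one_le₀ h.le)
  · rw [zero_sub, abs_neg, abs_div, abs_of_pos hp, div_eq_mul_inv]
    exact mul_le_of_le_one_left (inv_pos.mpr hp).le (not_lt.mp h)

theorem integrable_principalValueKernel : Integrable principalValueKernel :=
  integrable_inv_one_add_sq.mono' measurable_principalValueKernel.aestronglyMeasurable
    (Eventually.of_forall abs_principalValueKernel_le)

theorem integral_principalValueKernel : ∫ v, principalValueKernel v = 0 := by
  have h := integral_neg_eq_self principalValueKernel volume
  have hodd : ∀ v, principalValueKernel (-v) = -principalValueKernel v := fun v => by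
    simp only [principalValueKernel, abs_neg, neg_sq, inv_neg]
    split_ifs <;> ring
  simp only [hodd] at h
  rw [integral_neg] at h
  linarith

theorem principalValueKernel_scaled (σ : ℝ) {η : ℝ} (hη : 0 < η) :
    η⁻¹ * principalValueKernel (σ / η) =
      (if η < |σ| then σ⁻¹ else 0) - σ / (η ^ 2 + σ ^ 2) := by
  have h : 1 < |σ / η| ↔ η < |σ| := by
    rw [abs_div, abs_of_pos hη, one_lt_div hη]
  have hp : 0 < η ^ 2 + σ ^ 2 := by positivity
  have e : η⁻¹ * (σ / η / (1 + (σ / η) ^ 2)) = σ / (η ^ 2 + σ ^ 2) := by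
    field_simp
  rw [principalValueKernel, mul_sub, e]
  simp only [h]
  split_ifs
  · field_simp
  · rw [mul_zero]

theorem measurableSet_lt_abs_interval (x' : Spacetime) (η : ℝ) :
    MeasurableSet {x : Spacetime | η < |interval x x'|} :=
  (isOpen_lt continuous_const (by fun_prop)).measurableSet

theorem integrableOn_mul_inv_interval (x' : Spacetime) (φ : 𝓢(Spacetime, ℝ)) {η : ℝ} (hη : 0 < η) :
    IntegrableOn (fun x : Spacetime => φ x * (interval x x')⁻¹)
      {x : Spacetime | η < |interval x x'|} := by
  refine Integrable.mono' ((φ.integrable (μ := volume)).norm.mul_const η⁻¹).integrableOn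
    (measurable_mul_comp_interval x' φ measurable_inv).aestronglyMeasurable
    ((ae_restrict_mem (measurableSet_lt_abs_interval x' η)).mono fun x hx => ?_)
  have hx : η < |interval x x'| := hx
  rw [norm_mul, norm_inv, Real.norm_eq_abs (interval x x')]
  exact mul_le_mul_of_nonneg_left (inv_anti₀ hη hx.le) (norm_nonneg _)

theorem integrable_mul_hadamardRemainder {m : ℝ} (hm : 0 < m) (x' : Spacetime)
    (φ : 𝓢(Spacetime, ℝ)) :
    Integrable fun x : Spacetime => φ x * hadamardRemainder m (interval x x') := by
  refine (integrable_im_ofReal_mul (integrable_and_tendsto_regularRemainder hm x' φ).1).congr ?_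
  filter_upwards [ae_interval_ne_zero x'] with x hx
  rw [regularRemainder_zero_im hm hx]

theorem integrableOn_mul_hadamardExpansion {m : ℝ} (hm : 0 < m) (x' : Spacetime)
    (φ : 𝓢(Spacetime, ℝ)) {η : ℝ} (hη : 0 < η) :
    IntegrableOn (fun x : Spacetime => φ x * hadamardExpansion m (interval x x'))
      {x : Spacetime | η < |interval x x'|} := by
  have h := (((integrableOn_mul_inv_interval x' φ hη).const_mul 4).add
    (integrable_mul_hadamardRemainder hm x' φ).integrableOn).const_mul (1 / (8 * Real.pi ^ 2))
  refine h.congr (Eventually.of_forall fun x => ?_)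
  simp only [Pi.add_apply]
  rw [hadamardExpansion_eq hm]
  ring

theorem setIntegral_mul_hadamardExpansion {m : ℝ} (hm : 0 < m) (x' : Spacetime)
    (φ : 𝓢(Spacetime, ℝ)) {η : ℝ} (hη : 0 < η) :
    ∫ x in {x : Spacetime | η < |interval x x'|}, φ x * hadamardExpansion m (interval x x') =
      1 / (8 * Real.pi ^ 2) *
        (4 * (∫ x in {x : Spacetime | η < |interval x x'|}, φ x * (interval x x')⁻¹) +
          ∫ x in {x : Spacetime | η < |interval x x'|}, φ x * hadamardRemainder m (interval x x')) := by
  rw [← integral_const_mul, ← integral_add ((integrableOn_mul_inv_interval x' φ hη).const_mul 4)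
    (integrable_mul_hadamardRemainder hm x' φ).integrableOn, ← integral_const_mul]
  refine integral_congr_ae (Eventually.of_forall fun x => ?_)
  simp only
  rw [hadamardExpansion_eq hm]
  ring

theorem tendsto_setIntegral_lt_abs_interval (x' : Spacetime) {f : Spacetime → ℝ}
    (hf : Integrable f) :
    Tendsto (fun η : ℝ => ∫ x in {x : Spacetime | η < |interval x x'|}, f x) (𝓝[>] 0)
      (𝓝 (∫ x, f x)) := by
  have e : ∀ η : ℝ, ∫ x in {x : Spacetime | η < |interval x x'|}, f x =
      ∫ x, {x : Spacetime | η < |interval x x'|}.indicator f x := fun η =>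
    (integral_indicator (measurableSet_lt_abs_interval x' η)).symm
  simp only [e]
  refine tendsto_integral_filter_of_dominated_convergence (fun x => ‖f x‖) ?_ ?_ hf.norm ?_
  · exact Eventually.of_forall fun η =>
      hf.aestronglyMeasurable.indicator (measurableSet_lt_abs_interval x' η)
  · exact Eventually.of_forall fun η => Eventually.of_forall fun x => norm_indicator_le_norm_self f x
  · filter_upwards [ae_interval_ne_zero x'] with x hx
    refine tendsto_const_nhds.congr' ?_
    filter_upwards [Ioo_mem_nhdsGT (abs_pos.mpr hx)] with η hη
    rw [Set.indicator_of_mem (by exact hη.2)]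

/-- The difference is tested through `η⁻¹ k(σ/η)` with `k` odd and integrable, so the limiting delta
function has mass zero. Convergence of either term separately is not needed. -/
theorem tendsto_truncated_sub_smoothed (x' : Spacetime) (φ : 𝓢(Spacetime, ℝ)) :
    Tendsto (fun η : ℝ =>
      (∫ x in {x : Spacetime | η < |interval x x'|}, φ x * (interval x x')⁻¹) -
        ∫ x : Spacetime, φ x * (interval x x' / (η ^ 2 + interval x x' ^ 2))) (𝓝[>] 0) (𝓝 0) := by
  have h := tendsto_integral_mul_comp_interval_div x' φ measurable_principalValueKernel
    integrable_principalValueKernel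
  rw [integral_principalValueKernel, mul_zero] at h
  refine h.congr' ?_
  filter_upwards [self_mem_nhdsWithin] with η hη
  have hη : 0 < η := hη
  have hS := measurableSet_lt_abs_interval x' η
  have h2 : Integrable fun x : Spacetime => φ x * (interval x x' / (η ^ 2 + interval x x' ^ 2)) := by
    have := (integrable_im_ofReal_mul (integrable_ofReal_mul_four_div x' φ hη)).const_mul (1 / 4)
    refine this.congr (Eventually.of_forall fun x => ?_)
    simp only [four_div_regular_im _ hη]
    ring
  rw [← integral_indicator hS, ← integral_sub
    ((integrable_indicator_iff hS).mpr (integrableOn_mul_inv_interval x' φ hη)) h2]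
  refine integral_congr_ae (Eventually.of_forall fun x => ?_)
  simp only
  rw [principalValueKernel_scaled _ hη]
  by_cases hx : η < |interval x x'|
  · rw [if_pos hx, Set.indicator_of_mem (by exact hx)]
    ring
  · rw [if_neg hx, Set.indicator_of_notMem (by exact hx)]
    ring

/-- The truncated integral equals twice the imaginary part of the regularised propagator plus a
difference that tends to zero, so existence of the principal value follows from that of the
propagator. The constant is `2 / (16π²) = 1/(8π²)`. -/
theorem tendsto_hadamardG {m : ℝ} (hm : 0 < m) (x' : Spacetime) (φ : 𝓢(Spacetime, ℝ)) :
    Tendsto (fun η : ℝ => ∫ x in {x : Spacetime | η < |interval x x'|},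
        φ x * hadamardExpansion m (interval x x'))
      (𝓝[>] 0) (𝓝 (hadamardG (feynmanPropagator m x') φ)) := by
  have hG := ((Complex.continuous_im.tendsto _).comp
    (tendsto_integral_mul_regularKernel m x' (complexify φ))).const_mul 2
  obtain ⟨hi, ht⟩ := integrable_and_tendsto_regularRemainder hm x' φ
  have hrem := (Complex.continuous_im.tendsto _).comp ht
  have e : (∫ x : Spacetime, (φ x : ℂ) * regularRemainder m 0 (interval x x')).im =
      ∫ x, φ x * hadamardRemainder m (interval x x') := by
    rw [im_integral_ofReal_mul hi]
    refine integral_congr_ae ?_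
    filter_upwards [ae_interval_ne_zero x'] with x hx
    rw [regularRemainder_zero_im hm hx]
  rw [e] at hrem
  have hdiff := (((tendsto_truncated_sub_smoothed x' φ).const_mul 4).add
    ((tendsto_setIntegral_lt_abs_interval x' (integrable_mul_hadamardRemainder hm x' φ)).sub
      hrem)).const_mul (1 / (8 * Real.pi ^ 2))
  have hsum := hG.add hdiff
  rw [sub_self, mul_zero, add_zero, mul_zero, add_zero] at hsum
  refine hsum.congr' ?_
  filter_upwards [self_mem_nhdsWithin] with η hη
  simp only [Function.comp_apply]
  rw [integral_mul_regularKernel_eq m x' φ hη, Complex.im_ofReal_mul, Complex.add_im,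
    im_integral_ofReal_mul (integrable_ofReal_mul_four_div x' φ hη),
    setIntegral_mul_hadamardExpansion hm x' φ hη]
  have e4 : ∀ x : Spacetime, φ x * (4 / (-(Complex.I * ((interval x x' : ℂ) +
      Complex.I * (η : ℂ))))).im = 4 * (φ x * (interval x x' / (η ^ 2 + interval x x' ^ 2))) :=
    fun x => by
      rw [four_div_regular_im _ hη]
      ring
  simp only [e4]
  rw [integral_const_mul]
  have := Real.pi_ne_zero
  field_simp
  ring

end

/-! ### The propagator and its three descriptions -/

theorem mainTheorem3 (m : ℝ) (hm : 0 < m) :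
    -- the regularised proper-time integral converges absolutely and is analytic
    (∀ M σ : ℂ, M.im < 0 → 0 < σ.im →
      IntegrableOn (schwingerIntegrand M σ) (Set.Ioi (0 : ℝ))) ∧
    AnalyticOnNhd ℂ (fun q : ℂ × ℂ => schwingerKernel q.1 q.2)
      {q : ℂ × ℂ | q.1.im < 0 ∧ 0 < q.2.im} ∧
    -- its boundary values off the light cone, for timelike and for spacelike separation
    (∀ σ : ℝ, σ < 0 →
      Tendsto (fun r : ℝ × ℝ => schwingerKernel ((m : ℂ) ^ 2 - Complex.I * (r.1 : ℂ))
          ((σ : ℂ) + Complex.I * (r.2 : ℂ)))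
        (𝓝[>] 0 ×ˢ 𝓝[>] 0) (𝓝 (hankelForm m ((m * √(-σ) : ℝ) : ℂ)))) ∧
    (∀ σ : ℝ, 0 < σ →
      Tendsto (fun r : ℝ × ℝ => schwingerKernel ((m : ℂ) ^ 2 - Complex.I * (r.1 : ℂ))
          ((σ : ℂ) + Complex.I * (r.2 : ℂ)))
        (𝓝[>] 0 ×ˢ 𝓝[>] 0) (𝓝 (hankelForm m (-Complex.I * ((m * √σ : ℝ) : ℂ))))) ∧
    -- convergence of the series in the light-cone expansions
    (∀ t : ℝ, Summable (fun k : ℕ => coneCoeff k * t ^ k) ∧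
      Summable (fun k : ℕ => coneCoeff' k * t ^ k)) ∧
    -- the Feynman propagator as a distribution in `x`, for every `x'`
    ∃ G : Spacetime → 𝓢'(Spacetime, ℂ), ∀ x' : Spacetime,
      IsFeynmanPropagator m x' (G x') ∧
      -- the proper-time representation, smeared with a test function
      (∀ φ : 𝓢(Spacetime, ℂ),
        IntegrableOn
          (fun s : ℝ => ∫ x : Spacetime, φ x * schwingerIntegrand ((m : ℂ) ^ 2) (interval x x' : ℂ) s)
          (Set.Ioi (0 : ℝ)) ∧
        G x' φ = 1 / (4 * (Real.pi : ℂ)) ^ 2 * ∫ s in Set.Ioi (0 : ℝ),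
          ∫ x : Spacetime, φ x * schwingerIntegrand ((m : ℂ) ^ 2) (interval x x' : ℂ) s) ∧
      -- the propagator is the boundary value of the analytic proper-time integral
      (∀ φ : 𝓢(Spacetime, ℂ),
        (∀ ε δ : ℝ, 0 < ε → 0 < δ →
          Integrable (fun x : Spacetime => φ x *
            schwingerKernel ((m : ℂ) ^ 2 - Complex.I * (ε : ℂ))
              ((interval x x' : ℂ) + Complex.I * (δ : ℂ)))) ∧
        Tendsto (fun r : ℝ × ℝ => ∫ x : Spacetime, φ x *
            schwingerKernel ((m : ℂ) ^ 2 - Complex.I * (r.1 : ℂ))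
              ((interval x x' : ℂ) + Complex.I * (r.2 : ℂ)))
          (𝓝[>] 0 ×ˢ 𝓝[>] 0) (𝓝 (G x' φ))) ∧
      -- timelike separation: `z = m (-(x - x')²)^{1/2} > 0`
      (∀ φ : 𝓢(Spacetime, ℂ), HasCompactSupport φ →
        tsupport φ ⊆ {x : Spacetime | interval x x' < 0} →
        Integrable (fun x : Spacetime =>
          φ x * hankelForm m ((m * √(-interval x x') : ℝ) : ℂ)) ∧
        G x' φ = ∫ x : Spacetime, φ x * hankelForm m ((m * √(-interval x x') : ℝ) : ℂ)) ∧
      -- spacelike separation: `z = -i m ((x - x')²)^{1/2}`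
      (∀ φ : 𝓢(Spacetime, ℂ), HasCompactSupport φ →
        tsupport φ ⊆ {x : Spacetime | 0 < interval x x'} →
        Integrable (fun x : Spacetime =>
          φ x * hankelForm m (-Complex.I * ((m * √(interval x x') : ℝ) : ℂ))) ∧
        G x' φ = ∫ x : Spacetime,
          φ x * hankelForm m (-Complex.I * ((m * √(interval x x') : ℝ) : ℂ))) ∧
      -- the singular structure of `Ḡ = Re G`
      (∀ φ : 𝓢(Spacetime, ℝ),
        Integrable (lightConeIntegrand x' φ) ∧
        IntegrableOn (fun x : Spacetime => φ x * coneSeries (m ^ 2 * interval x x'))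
          {x : Spacetime | interval x x' < 0} ∧
        barG (G x') φ = 1 / (4 * Real.pi) * lightConeDelta x' φ
          - m ^ 2 / (8 * Real.pi) * ∫ x in {x : Spacetime | interval x x' < 0},
              φ x * coneSeries (m ^ 2 * interval x x')) ∧
      -- the singular structure of `G^{(1)} = 2 Im G`, as a principal value at the light cone
      (∀ φ : 𝓢(Spacetime, ℝ),
        (∀ η : ℝ, 0 < η →
          IntegrableOn (fun x : Spacetime => φ x * hadamardExpansion m (interval x x'))
            {x : Spacetime | η < |interval x x'|}) ∧
        Tendsto (fun η : ℝ => ∫ x in {x : Spacetime | η < |interval x x'|},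
            φ x * hadamardExpansion m (interval x x'))
          (𝓝[>] 0) (𝓝 (hadamardG (G x') φ))) := by
  refine ⟨fun M σ hM hσ => integrableOn_schwingerIntegrand hM hσ, analyticOnNhd_schwingerKernel,
    fun σ hσ => ?_, fun σ hσ => ?_,
    fun t => ⟨entireCoeff_coneCoeff.summable_ofReal t, entireCoeff_coneCoeff'.summable_ofReal t⟩,
    feynmanPropagator m, fun x' => ⟨isFeynmanPropagator_feynmanPropagator m x', fun φ => ?_,
      fun φ => ⟨fun ε δ hε hδ => integrable_mul_schwingerKernel m x' φ hε hδ,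
        tendsto_integral_mul_schwingerKernel m x' φ⟩,
      feynmanPropagator_timelike hm x', feynmanPropagator_spacelike hm x',
      fun φ => ⟨(integrable_and_integral_lightConeIntegrand x' φ).1, barG_feynmanPropagator hm x' φ⟩,
      fun φ => ⟨fun η hη => integrableOn_mul_hadamardExpansion hm x' φ hη,
        tendsto_hadamardG hm x' φ⟩⟩⟩
  · rw [← boundaryKernel_of_neg hm hσ]
    exact tendsto_schwingerKernel hm hσ.ne
  · rw [← boundaryKernel_of_pos hm hσ]
    exact tendsto_schwingerKernel hm hσ.ne'
  · simp only [integral_mul_schwingerIntegrand]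
    exact ⟨integrableOn_mul_properTimeAmplitude x' φ (measurable_massPhase m)
      (fun s _ => (norm_massPhase m s).le), feynmanPropagator_apply m x' φ⟩
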